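/- **Setting.** Let $P$ be a set of atomic propositions, named by pairwise different binary words. A path is a finite sequence $\rho=\rho_0,\dots,\rho_{n-1}$ of states $\rho_i\subseteq P$, with length $|\rho|=n$. BLTL+Past formulas are built from $p\in P$ with $\neg$, the unary operators $\mathrm X^\exists,\mathrm X^\forall$ (strong/weak Next), $\mathrm Y^\exists,\mathrm Y^\forall$ (strong/weak Yesterday), and the binary operators $\vee,\wedge$, Until $\mathsf U$, Release $\mathsf R$, Since $\mathsf S$, Trigger $\mathsf T$ and their bounded versions $\mathsf U_b,\mathsf R_b,\mathsf S_b,\mathsf T_b$ ($b\in\mathbb N$). At a position $i$ of $\rho$ ($0\le i<n$; all positions $j,k$ below range over $0,\dots,n-1$): - $p$ holds iff $p\in\rho_i$, and $\neg,\vee,\wedge$ are as usual; - $\mathrm X^\exists\phi$ holds iff $i+1<n$ and $\phi$ holds at $i+1$; $\mathrm X^\forall\phi$ holds iff $i+1=n$ or $\phi$ holds at $i+1$; $\mathrm Y^\exists\phi$ holds iff $i>0$ and $\phi$ holds at $i-1$; $\mathrm Y^\forall\phi$ holds iff $i=0$ or $\phi$ holds at $i-1$; - $\phi\,\mathsf U\,\psi$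 holds iff for some $j\ge i$, $\psi$ holds at $j$ and $\phi$ holds at all $k$ with $i\le k<j$; $\phi\,\mathsf R\,\psi$ holds iff for every $j\ge i$, $\psi$ holds at $j$ or $\phi$ holds at some $k$ with $i\le k<j$; - $\phi\,\mathsf S\,\psi$ and $\phi\,\mathsf T\,\psi$ are the mirror images for the past, with $j\le i$ and $j<k\le i$ in place of $j\ge i$ and $i\le k<j$; - in the bounded versions, $j$ is in addition restricted to $|i-j|\le b$. Write $\phi(\rho)\in\mathbb B^{|\rho|}$ for the sequence of truth values of $\phi$ at the positions of $\rho$. A *transducer circuit* is a finite acyclic monotone Boolean circuit, whose gates are labeled as constants $0,1$, as variables, or as $\langle\mathrm{and},g,h\rangle$, $\langle\mathrm{or},g,h\rangle$, $\langle\mathrm{id},g\rangle$ with gates $g,h$, together with an ordering $I$ of all its variable gates (the input) and an ordering $O$ of some of its gates (the output). Its *evaluation* propagates constants: an and- /or- /id-gate whose value is determined by the constants becomes a constant gate, and an and- /or-gate with exactly one constant argument that does not determine its value becomes an id-gate of the other argument. The circuit is *evaluated* if no gate depends on a constant gate. It is *one-input-face planar* if its dependence graph has a planar embedding such that all variable gates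 and all constant gates on which some gate depends lie on the outer face, and on the outer face the input gates appear in counter-clockwise order and the output gates in clockwise order, not interleaved (counter-clockwise: first $I$ from first to last, then $O$ from last to first). For a transducer circuit $T$, $f_T:\mathbb B^{|I|}\to\mathbb B^{|O|}$ is the function whose value at $s$ is obtained by composing the constant circuit for $s$ with $T$ (the $i$-th input gate of $T$ becomes an id-gate of the $i$-th constant), evaluating, and reading off the output gates. **Lemma.** There is a function, written $(\rho,a)\mapsto \mathrm{cir}_\rho(a)$, that assigns a transducer circuit to every path $\rho$ and every argument $a$ of one of the forms $p$, $op$ (unary), $(s,op)$, $(op,s)$ ($op$ binary, $s\in\mathbb B^{|\rho|}$), with the following properties. 1. It is computable by a deterministic Turing machine with read-only input tape, write-only output tape and $O(\log N)$ cells on its work tapes, where $N$ is the length of the input word. This word lists, for each state of $\rho$, the names of the propositions that are true in it (in any order), followed by $a$; bounds are written in unary. (Paths with an infinite state have no such word.) 2. Every value $\mathrm{cir}_\rho(a)$ is an evaluated one-input-face planar transducer circuit. 3. For all paths $\rho$, atomic propositions $p$, BLTL+Past formulas $\phi,\psi$, and $s=\phi(\rho)$, $t=\psi(\rho)$: - $f_{\mathrm{cir}_\rho(p)}()=p(\rho)$,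 where $\mathrm{cir}_\rho(p)$ has no inputs; - $f_{\mathrm{cir}_\rho(op)}(s)=(op\,\phi)(\rho)$ for $op\in\{\mathrm X^\exists,\mathrm X^\forall,\mathrm Y^\exists,\mathrm Y^\forall\}$; - $f_{\mathrm{cir}_\rho(s,op)}(t)=(\phi\,op\,\psi)(\rho)$ and $f_{\mathrm{cir}_\rho(op,t)}(s)=(\phi\,op\,\psi)(\rho)$ for $op\in\{\vee,\wedge,\mathsf U,\mathsf U_b,\mathsf R,\mathsf R_b,\mathsf S,\mathsf S_b,\mathsf T,\mathsf T_b\}$ and $b\in\mathbb N$. -/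

import Mathlib

namespace PathCheck

/-! ## Linear-time temporal logic with past and bounds on finite paths -/

/-- The unary temporal operators: strong and weak Next, strong and weak Yesterday. -/
inductive UnOp where
  | strongNext
  | weakNext
  | strongYesterday
  | weakYesterday

/-- The binary operators; the bounded ones carry their bound. -/
inductive BinOp where
  | or
  | and
  | until
  | release
  | since
  | trigger
  | boundedUntil (b : ℕ)
  | boundedRelease (b : ℕ)
  | boundedSince (b : ℕ)
  | boundedTrigger (b : ℕ)

/-- Formulas of BLTL+Past over the set `P` of atomic propositions. -/
inductive Formula (P : Type*) where
  | atom (p : P)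
  | neg (φ : Formula P)
  | unary (op : UnOp) (φ : Formula P)
  | binary (op : BinOp) (φ ψ : Formula P)

/-- `UnOp.Holds op s i`: the formula `op φ` holds at position `i` of a path of length `n`,
when `s j` says that `φ` holds at position `j`. -/
def UnOp.Holds {n : ℕ} (op : UnOp) (s : Fin n → Prop) (i : Fin n) : Prop :=
  match op with
  | .strongNext => ∃ j : Fin n, (j : ℕ) = i + 1 ∧ s j
  | .weakNext => ∀ j : Fin n, (j : ℕ) = i + 1 → s j
  | .strongYesterday => ∃ j : Fin n, (j : ℕ) + 1 = i ∧ s j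
  | .weakYesterday => ∀ j : Fin n, (j : ℕ) + 1 = i → s j

/-- `BinOp.Holds op l r i`: the formula `φ op ψ` holds at position `i` of a path of length `n`,
when `l j` and `r j` say that `φ` and `ψ` hold at position `j`. -/
def BinOp.Holds {n : ℕ} (op : BinOp) (l r : Fin n → Prop) (i : Fin n) : Prop :=
  match op with
  | .or => l i ∨ r i
  | .and => l i ∧ r i
  | .until => ∃ j, i ≤ j ∧ r j ∧ ∀ k, i ≤ k → k < j → l k
  | .release => ∀ j, i ≤ j → r j ∨ ∃ k, i ≤ k ∧ k < j ∧ l k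
  | .since => ∃ j, j ≤ i ∧ r j ∧ ∀ k, k ≤ i → j < k → l k
  | .trigger => ∀ j, j ≤ i → r j ∨ ∃ k, k ≤ i ∧ j < k ∧ l k
  | .boundedUntil b =>
      ∃ j, i ≤ j ∧ (j : ℕ) ≤ i + b ∧ r j ∧ ∀ k, i ≤ k → k < j → l k
  | .boundedRelease b =>
      ∀ j, i ≤ j → (j : ℕ) ≤ i + b → r j ∨ ∃ k, i ≤ k ∧ k < j ∧ l k
  | .boundedSince b =>
      ∃ j, j ≤ i ∧ (i : ℕ) ≤ j + b ∧ r j ∧ ∀ k, k ≤ i → j < k → l k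
  | .boundedTrigger b =>
      ∀ j, j ≤ i → (i : ℕ) ≤ j + b → r j ∨ ∃ k, k ≤ i ∧ j < k ∧ l k

/-- `Sat ρ φ i`: the path `ρ`, whose states are valuations of `P`, satisfies `φ` at `i`. -/
def Sat {P : Type*} {n : ℕ} (ρ : Fin n → Set P) : Formula P → Fin n → Prop
  | .atom p => fun i => p ∈ ρ i
  | .neg φ => fun i => ¬ Sat ρ φ i
  | .unary op φ => fun i => op.Holds (Sat ρ φ) i
  | .binary op φ ψ => fun i => op.Holds (Sat ρ φ) (Sat ρ ψ) i

open Classical in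
/-- The Boolean sequence `φ(ρ)` of the truth values of `φ` at the positions of `ρ`. -/
noncomputable def truthSeq {P : Type*} {n : ℕ} (ρ : Fin n → Set P) (φ : Formula P) :
    Fin n → Bool :=
  fun i => decide (Sat ρ φ i)

/-! ## Monotone Boolean circuits -/

/-- The gate labels of a monotone Boolean circuit with gates in `G`. -/
inductive GateLabel (G : Type*) where
  | const (b : Bool)
  | var
  | and (l r : G)
  | or (l r : G)
  | id (g : G)

/-- The gates to which a label refers. -/
def GateLabel.Refers {G : Type*} : GateLabel G → G → Prop
  | .const _ => fun _ => False
  | .var => fun _ => False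
  | .and l r => fun h => h = l ∨ h = r
  | .or l r => fun h => h = l ∨ h = r
  | .id g => fun h => h = g

/-- Renaming the gates in a label. -/
def GateLabel.map {G H : Type*} (f : G → H) : GateLabel G → GateLabel H
  | .const b => .const b
  | .var => .var
  | .and l r => .and (f l) (f r)
  | .or l r => .or (f l) (f r)
  | .id g => .id (f g)

/-- A monotone Boolean circuit: a gate labeling without cyclic dependencies. -/
structure Circuit (G : Type*) where
  label : G → GateLabel G
  acyclic : ∀ g, ¬ Relation.TransGen (fun a b => (label a).Refers b) g g

namespace Circuit

variable {G : Type*} (C : Circuit G)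

/-- `C.DDep a b`: gate `a` directly depends on gate `b`. This is also the edge relation of the
graph of `C`. -/
def DDep (a b : G) : Prop := (C.label a).Refers b

/-- A sink gate: no gate depends on it. -/
def IsSink (g : G) : Prop := ∀ h, ¬ Relation.TransGen C.DDep h g

/-- The circuit is evaluated: all constant gates are sink gates. -/
def IsEvaluated : Prop := ∀ g b, C.label g = .const b → C.IsSink g

/-- The source gates: all variable gates, and all constant gates that are not sink gates. -/
def src : Set G :=
  {g | C.label g = .var ∨ ((∃ b, C.label g = .const b) ∧ ¬ C.IsSink g)}

theorem wellFounded_dep [Finite G] : WellFounded (fun b a => C.DDep a b) := by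
  have : Std.Irrefl (Relation.TransGen (fun b a => C.DDep a b)) :=
    ⟨fun g h => C.acyclic g (Relation.transGen_swap.mp h)⟩
  exact (Finite.wellFounded_of_trans_of_irrefl
    (Relation.TransGen (fun b a => C.DDep a b))).mono fun _ _ h => Relation.TransGen.single h

end Circuit

/-- The new label of an and-gate with arguments `l`, `r` whose new labels are given. -/
def evalAnd {G : Type*} (l r : G) : GateLabel G → GateLabel G → GateLabel G
  | .const false, _ => .const false
  | _, .const false => .const false
  | .const true, .const true => .const true
  | .const true, _ => .id r
  | _, .const true => .id l
  | _, _ => .and l r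

/-- The new label of an or-gate with arguments `l`, `r` whose new labels are given. -/
def evalOr {G : Type*} (l r : G) : GateLabel G → GateLabel G → GateLabel G
  | .const true, _ => .const true
  | _, .const true => .const true
  | .const false, .const false => .const false
  | .const false, _ => .id r
  | _, .const false => .id l
  | _, _ => .or l r

/-- The new label of an id-gate with argument `g` whose new label is given. -/
def evalId {G : Type*} (g : G) : GateLabel G → GateLabel G
  | .const b => .const b
  | _ => .id g

/-- One step of the evaluation: the new label of a gate with label `L`, given the new labels
`γ` of the gates to which `L` refers. -/
def GateLabel.evalWith {G : Type*} :
    (L : GateLabel G) → (γ : ∀ h, L.Refers h → GateLabel G) → GateLabel G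
  | .const b, _ => .const b
  | .var, _ => .var
  | .and l r, γ => evalAnd l r (γ l (Or.inl rfl)) (γ r (Or.inr rfl))
  | .or l r, γ => evalOr l r (γ l (Or.inl rfl)) (γ r (Or.inr rfl))
  | .id g, γ => evalId g (γ g rfl)

/-- The gate labeling of the evaluation of a finite circuit. -/
noncomputable def Circuit.evalLabel {G : Type*} [Finite G] (C : Circuit G) : G → GateLabel G :=
  C.wellFounded_dep.fix fun g ih => (C.label g).evalWith fun h hh => ih h hh

theorem Circuit.evalLabel_eq {G : Type*} [Finite G] (C : Circuit G) (g : G) :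
    C.evalLabel g = match C.label g with
      | .const b => .const b
      | .var => .var
      | .and l r => evalAnd l r (C.evalLabel l) (C.evalLabel r)
      | .or l r => evalOr l r (C.evalLabel l) (C.evalLabel r)
      | .id h => evalId h (C.evalLabel h) := by
  have h : C.evalLabel g = (C.label g).evalWith fun h _ => C.evalLabel h :=
    C.wellFounded_dep.fix_eq _ g
  rw [h]
  cases C.label g <;> rfl

/-! ## Transducer circuits -/

/-- A transducer circuit: a circuit with an ordering `inputs` of its variable gates and an
ordering `outputs` of some of its gates. -/
structure Transducer (G : Type*) extends Circuit G where
  inputs : List G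
  inputs_nodup : inputs.Nodup
  mem_inputs : ∀ g, g ∈ inputs ↔ label g = .var
  outputs : List G
  outputs_nodup : outputs.Nodup

/-- The constant circuit that represents the Boolean sequence `s`. -/
def constTransducer {m : ℕ} (s : Fin m → Bool) : Transducer (Fin m) where
  label i := .const (s i)
  acyclic g h := by
    obtain ⟨_, h, _⟩ := Relation.TransGen.head'_iff.mp h
    exact h
  inputs := []
  inputs_nodup := List.nodup_nil
  mem_inputs g := by simp
  outputs := List.finRange m
  outputs_nodup := List.nodup_finRange m

open Classical in
/-- The labeling of the composition of `T` with `D`: the `i`-th input gate of `D` becomes an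
id-gate that refers to the `i`-th output gate of `T`, all other labels are kept. -/
noncomputable def compLabel {G H : Type*} (T : Transducer G) (D : Transducer H)
    (h : T.outputs.length = D.inputs.length) : G ⊕ H → GateLabel (G ⊕ H)
  | .inl g => (T.label g).map Sum.inl
  | .inr d =>
      if hd : d ∈ D.inputs then
        .id (Sum.inl (T.outputs[D.inputs.idxOf d]'(h ▸ List.idxOf_lt_length_iff.mpr hd)))
      else (D.label d).map Sum.inr

theorem compLabel_inl {G H : Type*} (T : Transducer G) (D : Transducer H)
    (h : T.outputs.length = D.inputs.length) (g : G) :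
    compLabel T D h (.inl g) = (T.label g).map Sum.inl := rfl

theorem compLabel_inr_of_mem {G H : Type*} (T : Transducer G) (D : Transducer H)
    (h : T.outputs.length = D.inputs.length) {d : H} (hd : d ∈ D.inputs) :
    ∃ g, compLabel T D h (.inr d) = .id (Sum.inl g) :=
  ⟨_, dif_pos hd⟩

theorem compLabel_inr_of_notMem {G H : Type*} (T : Transducer G) (D : Transducer H)
    (h : T.outputs.length = D.inputs.length) {d : H} (hd : d ∉ D.inputs) :
    compLabel T D h (.inr d) = (D.label d).map Sum.inr :=
  dif_neg hd

theorem GateLabel.map_eq_var {G H : Type*} {f : G → H} {L : GateLabel G} :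
    L.map f = .var ↔ L = .var := by
  cases L <;> simp [GateLabel.map]

theorem GateLabel.refers_map {G H : Type*} {f : G → H} {L : GateLabel G} {x : H}
    (h : (L.map f).Refers x) : ∃ y, L.Refers y ∧ x = f y :=
  match L, h with
  | .and _ _, .inl h => ⟨_, Or.inl rfl, h⟩
  | .and _ _, .inr h => ⟨_, Or.inr rfl, h⟩
  | .or _ _, .inl h => ⟨_, Or.inl rfl, h⟩
  | .or _ _, .inr h => ⟨_, Or.inr rfl, h⟩
  | .id _, h => ⟨_, rfl, h⟩

theorem compLabel_acyclic {G H : Type*} (T : Transducer G) (D : Transducer H)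
    (h : T.outputs.length = D.inputs.length) (g : G ⊕ H) :
    ¬ Relation.TransGen (fun a b => (compLabel T D h a).Refers b) g g := by
  have hl : ∀ a x, (compLabel T D h (.inl a)).Refers x → ∃ b, T.DDep a b ∧ x = .inl b :=
    fun a x hx => GateLabel.refers_map hx
  have hr : ∀ a b, (compLabel T D h (.inr a)).Refers (.inr b) → D.DDep a b := by
    intro a b hx
    by_cases hd : a ∈ D.inputs
    · obtain ⟨g, e⟩ := compLabel_inr_of_mem T D h hd
      rw [e] at hx
      exact (Sum.inr_ne_inl hx).elim
    · rw [compLabel_inr_of_notMem T D h hd] at hx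
      obtain ⟨y, hy, e⟩ := GateLabel.refers_map hx
      rw [Sum.inr.inj e]
      exact hy
  have key_l : ∀ x y, Relation.TransGen (fun a b => (compLabel T D h a).Refers b) x y →
      ∀ a, x = .inl a → ∃ b, y = .inl b ∧ Relation.TransGen T.DDep a b := by
    intro x y hxy
    induction hxy with
    | single hx =>
      rintro a rfl
      obtain ⟨b, hb, e⟩ := hl _ _ hx
      exact ⟨b, e, .single hb⟩
    | tail _ hx ih =>
      rintro a rfl
      obtain ⟨b, rfl, hab⟩ := ih a rfl
      obtain ⟨c, hc, e⟩ := hl _ _ hx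
      exact ⟨c, e, hab.tail hc⟩
  have key_r : ∀ x y, Relation.TransGen (fun a b => (compLabel T D h a).Refers b) x y →
      ∀ a b, x = .inr a → y = .inr b → Relation.TransGen D.DDep a b := by
    intro x y hxy
    induction hxy with
    | single hx =>
      rintro a b rfl rfl
      exact .single (hr _ _ hx)
    | @tail y z _ hx ih =>
      rintro a b rfl rfl
      rcases y with c | c
      · obtain ⟨_, _, e⟩ := hl _ _ hx
        simp at e
      · exact (ih a c rfl rfl).tail (hr _ _ hx)
  intro hg
  rcases g with a | a
  · obtain ⟨b, e, hab⟩ := key_l _ _ hg a rfl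
    rw [← Sum.inl.inj e] at hab
    exact T.acyclic a hab
  · exact D.acyclic a (key_r _ _ hg a a rfl rfl)

/-- The composition of `T` with `D`: the outputs of `T` are fed into the inputs of `D`. -/
noncomputable def Transducer.comp {G H : Type*} (T : Transducer G) (D : Transducer H)
    (h : T.outputs.length = D.inputs.length) : Transducer (G ⊕ H) where
  label := compLabel T D h
  acyclic := compLabel_acyclic T D h
  inputs := T.inputs.map Sum.inl
  inputs_nodup := T.inputs_nodup.map Sum.inl_injective
  mem_inputs x := by
    rcases x with g | d
    · rw [compLabel_inl, GateLabel.map_eq_var, ← T.mem_inputs]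
      simp
    · by_cases hd : d ∈ D.inputs
      · obtain ⟨g, e⟩ := compLabel_inr_of_mem T D h hd
        simp [e]
      · rw [compLabel_inr_of_notMem T D h hd, GateLabel.map_eq_var, ← D.mem_inputs]
        simp [hd]
  outputs := D.outputs.map Sum.inr
  outputs_nodup := D.outputs_nodup.map Sum.inr_injective

/-- `T.Maps s t`: the function represented by `T` is defined at the sequence `s` (that is, `s` has
the length of the input of `T`), and its value is `t`. In other words, evaluating the composition
of the constant circuit for `s` with `T` turns the output gates into constant gates with the
values `t`, in this order. -/
def Transducer.Maps {G : Type*} [Finite G] (T : Transducer G) {m k : ℕ} (s : Fin m → Bool)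
    (t : Fin k → Bool) : Prop :=
  ∃ h : (constTransducer s).outputs.length = T.inputs.length,
    ((constTransducer s).comp T h).outputs.map ((constTransducer s).comp T h).evalLabel =
      List.ofFn fun i => GateLabel.const (t i)

/-! ## Planarity -/

/-- A planar embedding of the directed graph with vertex set `V` and edge relation `E` (without
loops and antiparallel edges): vertices are distinct points of the plane, edges are simple arcs
between their end points that do not pass through other vertices, and arcs of different edges meet
in vertices only. -/
structure PlanarEmbedding {V : Type*} (E : V → V → Prop) where
  pos : V → ℂ
  pos_injective : Function.Injective pos
  arc : ∀ a b, E a b → Path (pos a) (pos b)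
  arc_injective : ∀ a b (h : E a b), Function.Injective (arc a b h)
  arc_vertex : ∀ a b (h : E a b) t v, arc a b h t = pos v → v = a ∨ v = b
  arc_arc : ∀ a b (h : E a b) a' b' (h' : E a' b') t t',
    arc a b h t = arc a' b' h' t' → (a = a' ∧ b = b') ∨ ∃ v, arc a b h t = pos v

namespace PlanarEmbedding

variable {V : Type*} {E : V → V → Prop} (D : PlanarEmbedding E)

/-- The points of the plane that are covered by vertices and edges. -/
def carrier : Set ℂ :=
  Set.range D.pos ∪ {z | ∃ a b, ∃ h : E a b, z ∈ Set.range (D.arc a b h)}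

/-- The outer face: the unbounded connected component of the complement. -/
def outerFace : Set ℂ :=
  {z | z ∈ D.carrierᶜ ∧ ¬ Bornology.IsBounded (connectedComponentIn D.carrierᶜ z)}

/-- The vertex `v` is located on the outer face. -/
def OnOuterFace (v : V) : Prop := D.pos v ∈ closure D.outerFace

/-- The vertices of the list `L` appear on the outer face in this counter-clockwise order: they can
be joined, inside the outer face, with the points at the increasing angles `θ k`
on a circle around the embedded graph, by simple arcs that meet at most in their initial points.
(A vertex that occurs more than once in `L`, such as a gate that is an input and an output, has
one arc for each occurrence, so two of its arcs do share their initial point.) -/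
def CcwOnOuterFace (L : List V) : Prop :=
  ∃ (R : ℝ) (θ : Fin L.length → ℝ)
    (ray : ∀ k : Fin L.length, Path (D.pos (L.get k)) (R * Complex.exp (θ k * Complex.I))),
    0 < R ∧ D.carrier ⊆ Metric.ball 0 R ∧
    StrictMono θ ∧ (∀ j k, θ k < θ j + 2 * Real.pi) ∧
    (∀ k, Function.Injective (ray k)) ∧
    (∀ k t, t ≠ 0 → ray k t ∈ D.outerFace) ∧
    (∀ k t, t ≠ 1 → ray k t ∈ Metric.ball (0 : ℂ) R) ∧
    ∀ j k, j ≠ k → ∀ t u, ray j t = ray k u → t = 0 ∧ u = 0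

end PlanarEmbedding

/-- A one-input-face planar transducer circuit: its graph has a planar embedding with all source
gates on the outer face, such that the input gates appear in counter-clockwise order and the
output gates in clockwise order on the outer face, without interleaving: going around
counter-clockwise one meets first the inputs, from first to last, and then the outputs, from last
to first. -/
def Transducer.IsOneInputFacePlanar {G : Type*} (T : Transducer G) : Prop :=
  ∃ D : PlanarEmbedding T.DDep,
    (∀ g ∈ T.src, D.OnOuterFace g) ∧ D.CcwOnOuterFace (T.inputs ++ T.outputs.reverse)

/-! ## Logspace-computable functions -/

/-- What the head on the read-only input tape can see: an end marker or an input symbol. -/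
inductive InputCell (A : Type) where
  | leftEnd
  | symbol (a : A)
  | rightEnd

/-- Head movements. -/
inductive Move where
  | left
  | stay
  | right

/-- The head position after a move on a tape with cells `0, 1, 2, …`. -/
def Move.apply : Move → ℕ → ℕ
  | .left, i => i - 1
  | .stay, i => i
  | .right, i => i + 1

/-- A deterministic Turing machine with a two-way read-only input tape, finitely many work tapes,
and a write-only output tape. A transition depends on the state and the scanned cells; it gives
the new state, the move of the input head, for each work tape the symbol to write and the head
move, and possibly a symbol that is appended to the output; `none` means halting. -/
structure TuringMachine (A B : Type) where
  tapes : ℕ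
  State : Type
  finite_state : Finite State
  Work : Type
  finite_work : Finite Work
  blank : Work
  start : State
  δ : State → InputCell A → (Fin tapes → Work) →
    Option (State × Move × (Fin tapes → Work × Move) × Option B)

namespace TuringMachine

variable {A B : Type} (M : TuringMachine A B)

/-- A configuration (on a fixed input word). -/
structure Config where
  state : M.State
  inputHead : ℕ
  work : Fin M.tapes → ℕ → M.Work
  head : Fin M.tapes → ℕ
  output : List B

/-- The cell at position `i` of the input tape: cell `0` holds the left end marker, cells
`1, …, |x|` the input word `x`, and the next cell holds the right end marker. -/
def inputCell (x : List A) : ℕ → InputCell A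
  | 0 => .leftEnd
  | i + 1 => match x[i]? with
    | some a => .symbol a
    | none => .rightEnd

/-- The initial configuration. -/
def initial : M.Config where
  state := M.start
  inputHead := 0
  work := fun _ _ => M.blank
  head := fun _ => 0
  output := []

/-- The successor configuration on input `x`, if there is one. The input head cannot move beyond
the end markers. -/
def step (x : List A) (c : M.Config) : Option M.Config :=
  (M.δ c.state (inputCell x c.inputHead) fun i => c.work i (c.head i)).map
    fun (q, m, w, o) =>
      { state := q
        inputHead := min (m.apply c.inputHead) (x.length + 1)
        work := fun i => Function.update (c.work i) (c.head i) (w i).1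
        head := fun i => (w i).2.apply (c.head i)
        output := c.output ++ o.toList }

/-- The machine reaches the configuration `c` on input `x`. -/
def Reaches (x : List A) (c : M.Config) : Prop :=
  Relation.ReflTransGen (fun c c' => M.step x c = some c') M.initial c

/-- On input `x`, the machine halts with output `y`. -/
def Outputs (x : List A) (y : List B) : Prop :=
  ∃ c, M.Reaches x c ∧ M.step x c = none ∧ c.output = y

/-- On input `x`, the machine uses at most the first `k + 1` cells of each work tape. -/
def UsesSpace (x : List A) (k : ℕ) : Prop :=
  ∀ c, M.Reaches x c → ∀ i, c.head i ≤ k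

end TuringMachine

/-- The function `f` is computable in logarithmic space, when its arguments are presented by words
as specified by `rep` (an argument may have several presentations) and its values are
written in the encoding `enc`. -/
def LogspaceComputable {A B : Type} {α β : Type*} (rep : α → List A → Prop) (enc : β → List B)
    (f : α → β) : Prop :=
  ∃ (M : TuringMachine A B) (K : ℕ), ∀ a x, rep a x →
    M.Outputs x (enc (f a)) ∧ M.UsesSpace x (K * (Nat.log 2 x.length + 1))

/-! ## Arguments of the circuit construction and encodings -/

/-- The arguments of the circuit construction for a path of length `n`: an atomic proposition, a
unary operator, or a binary operator with the value sequence of its left or of its right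
argument. -/
inductive CirArg (P : Type*) (n : ℕ) where
  | atom (p : P)
  | unary (op : UnOp)
  | left (s : Fin n → Bool) (op : BinOp)
  | right (op : BinOp) (s : Fin n → Bool)

/-- The alphabet of the encodings. -/
inductive Sym where
  | zero | one | tick | state | prop | atom | left | right
  | strongNext | weakNext | strongYesterday | weakYesterday
  | or | and | until | release | since | trigger
  | boundedUntil | boundedRelease | boundedSince | boundedTrigger
  | gate | var | id | inputs | outputs | endNat

/-- A word over `{0, 1}`. -/
def codeBits (w : List Bool) : List Sym := w.map fun b => if b then .one else .zero

/-- A number in unary notation. -/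
def codeNat (k : ℕ) : List Sym := List.replicate k .tick ++ [.endNat]

def UnOp.code : UnOp → List Sym
  | .strongNext => [.strongNext]
  | .weakNext => [.weakNext]
  | .strongYesterday => [.strongYesterday]
  | .weakYesterday => [.weakYesterday]

/-- The code of a binary operator; bounds are written in unary. -/
def BinOp.code : BinOp → List Sym
  | .or => [.or]
  | .and => [.and]
  | .until => [.until]
  | .release => [.release]
  | .since => [.since]
  | .trigger => [.trigger]
  | .boundedUntil b => .boundedUntil :: codeNat b
  | .boundedRelease b => .boundedRelease :: codeNat b
  | .boundedSince b => .boundedSince :: codeNat b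
  | .boundedTrigger b => .boundedTrigger :: codeNat b

/-- The code of an argument, where `name p` is the name of the proposition `p`. -/
def CirArg.code {P : Type*} (name : P → List Bool) {n : ℕ} : CirArg P n → List Sym
  | .atom p => .atom :: codeBits (name p)
  | .unary op => op.code
  | .left s op => .left :: (codeBits (List.ofFn s) ++ op.code)
  | .right op s => .right :: (op.code ++ codeBits (List.ofFn s))

/-- The code of a state, given by a list of the propositions that are true in it. -/
def codeState {P : Type*} (name : P → List Bool) (l : List P) : List Sym :=
  .state :: l.flatMap fun p => .prop :: codeBits (name p)

/-- A path (of any length) together with an argument of the circuit construction for it. -/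
structure CirInput (P : Type*) where
  n : ℕ
  path : Fin n → Set P
  arg : CirArg P n

/-- `x.Presented name w`: the word `w` lists the states of the path of `x`, each one as a list, in
any order, of the names of the propositions that are true in it, followed by the argument. -/
def CirInput.Presented {P : Type*} (name : P → List Bool) (x : CirInput P) (w : List Sym) : Prop :=
  ∃ l : Fin x.n → List P, (∀ i, x.path i = {p | p ∈ l i}) ∧
    w = (List.ofFn l).flatMap (codeState name) ++ x.arg.code name

/-- The code of the label of a gate in a circuit with gates `0, …, N - 1`. -/
def GateLabel.code {N : ℕ} : GateLabel (Fin N) → List Sym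
  | .const false => [.zero]
  | .const true => [.one]
  | .var => [.var]
  | .and l r => .and :: (codeNat l ++ codeNat r)
  | .or l r => .or :: (codeNat l ++ codeNat r)
  | .id g => .id :: codeNat g

/-- A transducer circuit whose gates are the numbers `0, …, N - 1`. -/
structure NumberedTransducer where
  N : ℕ
  circuit : Transducer (Fin N)

/-- The code of a transducer circuit: the list of its gate labels, of its inputs and of its
outputs. Gates are written in unary, which costs only a polynomial in the number of gates. -/
def NumberedTransducer.code (T : NumberedTransducer) : List Sym :=
  ((List.finRange T.N).flatMap fun g => .gate :: (T.circuit.label g).code) ++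
    .inputs :: (T.circuit.inputs.flatMap fun g => codeNat g) ++
    .outputs :: (T.circuit.outputs.flatMap fun g => codeNat g)

end PathCheck

open PathCheck

/-! All the circuits have one shape, the grid. There is one column per position of the path, the
inputs form the bottom row, and a gate in a higher row refers to the gate below it, to the neighbor
of that gate in the next (for past operators: previous) column, or to both. Constant gates occur
only as outputs. No gate refers to them, so the circuit is evaluated and only the inputs have to lie
on the outer face. In the straight-line drawing every edge goes down by one row and either stays in
its column or leans to one fixed side, so edges do not cross. Inputs are at the bottom and outputs
at the top; vertical rays connect them to a surrounding circle in the required cyclic order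
(`GridSpec.isOneInputFacePlanar`).

For correctness, all binary operators are treated at once by means of a decisive value: true for or,
Until, Since, and false for their duals. A temporal operator takes its decisive value at `i` iff
some position `j` in its range has the decisive value of the right argument `ψ`, and all positions
from `i` to just before `j` have the decisive value of the left argument `φ`
(`BinOp.holds_temporal`).

If `φ` is known, row `d` of the grid computes this for distances up to `d`: a gate combines the gate
below with its neighbor exactly in those columns where `φ` is decisive
(`GridSpec.gridValue_eq_not_conj`, `binarySpec_left_maps`). If `ψ` is known, the nearest `j` is the
best one, because a farther one only adds conditions on `φ`. So the value is a constant if `ψ` is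
decisive at `i` or nowhere in the range. Otherwise it is the conjunction (for the duals:
disjunction) of `φ` over the positions from `i` to just before the nearest `j`, which is again the
value of a grid, with and-gates and or-gates exchanged (`binarySpec_right_maps`).

For the space bound, numbers up to the length of the input word plus one are held in registers in
bijective base two, which takes logarithmically many cells. While programs on such registers are
compiled to Turing machines (`Exec.machine`). The numbers and properties computable in this way are
closed under bounded counting, hence under bounded quantifiers, comparison and truncated
subtraction, and words can be written in bounded loops. All parameters of the grid circuit can be
read off the input word by such means (`computesData_wordData`), and the code of the circuit is
written from them (`ComputesData.word`, `GridData.Describes.word_eq`). -/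

namespace PathCheck

/-! ## Structured programs for logspace machines -/

namespace Logspace

/-- Tests on the scanned input cell or on the scanned cells of two work tapes. -/
inductive Cond (A : Type) where
  | input (f : InputCell A → Bool)
  | cells (r s : ℕ) (f : Option Bool → Option Bool → Bool)

/-- The truth value of a test, given the scanned cells. -/
def Cond.eval {A : Type} (a : InputCell A) (w : ℕ → Option Bool) : Cond A → Bool
  | .input f => f a
  | .cells r s f => f (w r) (w s)

/-- While programs that act on the input tape, the work tapes `0, 1, 2, …` (with cells that hold
a bit or are blank), and the output tape. -/
inductive Prog (A B : Type) where
  | moveInput (m : Move)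
  | write (r : ℕ) (f : Option Bool → Option Bool) (m : Move)
  | emit (b : B)
  | seq (p q : Prog A B)
  | ite (c : Cond A) (p q : Prog A B)
  | loop (c : Cond A) (p : Prog A B)

/-- The contents of all tapes. -/
structure Tapes (B : Type) where
  inputHead : ℕ
  work : ℕ → ℕ → Option Bool
  head : ℕ → ℕ
  output : List B

/-- The effect of a single machine step on the tapes. -/
inductive Action (B : Type) where
  | idle
  | moveInput (m : Move)
  | write (r : ℕ) (o : Option Bool) (m : Move)
  | emit (b : B)

variable {A B : Type}

/-- The scanned cells of the work tapes. -/
def Tapes.scan (T : Tapes B) : ℕ → Option Bool := fun r => T.work r (T.head r)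

/-- Performing an action. -/
def Action.apply (x : List A) (T : Tapes B) : Action B → Tapes B
  | .idle => T
  | .moveInput m => { T with inputHead := min (m.apply T.inputHead) (x.length + 1) }
  | .write r o m =>
      { T with
        work := Function.update T.work r (Function.update (T.work r) (T.head r) o)
        head := Function.update T.head r (m.apply (T.head r)) }
  | .emit b => { T with output := T.output ++ [b] }

/-- The value of a test on the current tapes. -/
def Cond.holds (x : List A) (T : Tapes B) (c : Cond A) : Bool :=
  c.eval (TuringMachine.inputCell x T.inputHead) T.scan

/-- Big-step semantics of programs on input `x`, with work heads that do not leave the cells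
`0, …, k`. -/
inductive Exec (x : List A) (k : ℕ) : Prog A B → Tapes B → Tapes B → Prop
  | moveInput (m T) : Exec x k (.moveInput m) T ((Action.moveInput m).apply x T)
  | write (r f m T) (h : m.apply (T.head r) ≤ k) :
      Exec x k (.write r f m) T ((Action.write r (f (T.scan r)) m).apply x T)
  | emit (b T) : Exec x k (.emit b) T ((Action.emit b).apply x T)
  | seq {p q T T' T''} : Exec x k p T T' → Exec x k q T' T'' → Exec x k (.seq p q) T T''
  | ite_true {c p q T T'} : c.holds x T = true → Exec x k p T T' → Exec x k (.ite c p q) T T'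
  | ite_false {c p q T T'} : c.holds x T = false → Exec x k q T T' → Exec x k (.ite c p q) T T'
  | loop_true {c p T T' T''} : c.holds x T = true → Exec x k p T T' →
      Exec x k (.loop c p) T' T'' → Exec x k (.loop c p) T T''
  | loop_false {c p T} : c.holds x T = false → Exec x k (.loop c p) T T

/-- The control states of a program. -/
def Prog.Label : Prog A B → Type
  | .moveInput _ => Unit
  | .write _ _ _ => Unit
  | .emit _ => Unit
  | .seq p q => p.Label ⊕ q.Label
  | .ite _ p q => Option (p.Label ⊕ q.Label)
  | .loop _ p => Option p.Label

theorem Prog.finite_label : ∀ p : Prog A B, Finite p.Label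
  | .moveInput _ => inferInstanceAs (Finite Unit)
  | .write _ _ _ => inferInstanceAs (Finite Unit)
  | .emit _ => inferInstanceAs (Finite Unit)
  | .seq p q => by
      have := p.finite_label
      have := q.finite_label
      exact inferInstanceAs (Finite (p.Label ⊕ q.Label))
  | .ite _ p q => by
      have := p.finite_label
      have := q.finite_label
      exact inferInstanceAs (Finite (Option (p.Label ⊕ q.Label)))
  | .loop _ p => by
      have := p.finite_label
      exact inferInstanceAs (Finite (Option p.Label))

/-- The control state in which a program starts. -/
def Prog.entry : (p : Prog A B) → p.Label
  | .moveInput _ => ()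
  | .write _ _ _ => ()
  | .emit _ => ()
  | .seq p _ => Sum.inl p.entry
  | .ite _ _ _ => (none : Option (_ ⊕ _))
  | .loop _ p => (none : Option p.Label)

/-- The next control state (`none` at the end of the program) and the action. -/
def Prog.next (a : InputCell A) (w : ℕ → Option Bool) :
    (p : Prog A B) → p.Label → Option p.Label × Action B
  | .moveInput m, _ => (none, .moveInput m)
  | .write r f m, _ => (none, .write r (f (w r)) m)
  | .emit b, _ => (none, .emit b)
  | .seq p q, .inl l =>
      ((p.next a w l).1.elim (some (Sum.inr q.entry)) fun l' => some (Sum.inl l'),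
        (p.next a w l).2)
  | .seq _ q, .inr l => ((q.next a w l).1.map Sum.inr, (q.next a w l).2)
  | .ite c p q, none =>
      (some (some (if c.eval a w then Sum.inl p.entry else Sum.inr q.entry)), .idle)
  | .ite _ p _, some (.inl l) => ((p.next a w l).1.map fun l' => some (Sum.inl l'),
      (p.next a w l).2)
  | .ite _ _ q, some (.inr l) => ((q.next a w l).1.map fun l' => some (Sum.inr l'),
      (q.next a w l).2)
  | .loop c p, none => (if c.eval a w then some (some p.entry) else none, .idle)
  | .loop _ p, some l => (some (p.next a w l).1, (p.next a w l).2)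

/-- A bound on the work tapes that a program uses. -/
def Prog.width : Prog A B → ℕ
  | .moveInput _ => 0
  | .write r _ _ => r + 1
  | .emit _ => 0
  | .seq p q => max p.width q.width
  | .ite (.input _) p q => max p.width q.width
  | .ite (.cells r s _) p q => max (max (r + 1) (s + 1)) (max p.width q.width)
  | .loop (.input _) p => p.width
  | .loop (.cells r s _) p => max (max (r + 1) (s + 1)) p.width

/-- Only finitely many tapes influence a program. This lets a program for the tapes `0, 1, 2, …` run
on a machine with `width` tapes. -/
theorem Prog.next_congr (a : InputCell A) (w w' : ℕ → Option Bool) :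
    ∀ (p : Prog A B) (l : p.Label), (∀ r < p.width, w r = w' r) →
      p.next a w l = p.next a w' l := by
  intro p
  induction p with
  | moveInput m => intros; rfl
  | write r f m =>
    intro l h
    have := h r (by simp [Prog.width])
    simp [Prog.next, this]
  | emit b => intros; rfl
  | seq p q ihp ihq =>
    intro l h
    simp only [Prog.width, lt_max_iff] at h
    rcases l with l | l
    · simp only [Prog.next]; rw [ihp l fun r hr => h r (.inl hr)]
    · simp only [Prog.next]; rw [ihq l fun r hr => h r (.inr hr)]
  | ite c p q ihp ihq =>
    intro l h
    have hp : ∀ r < p.width, w r = w' r := by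
      intro r hr; apply h; cases c <;> simp [Prog.width, hr]
    have hq : ∀ r < q.width, w r = w' r := by
      intro r hr; apply h; cases c <;> simp [Prog.width, hr]
    rcases l with _ | l | l
    · cases c with
      | input f => rfl
      | cells r s f =>
        have h1 := h r (by simp [Prog.width])
        have h2 := h s (by simp [Prog.width])
        simp only [Prog.next, Cond.eval, h1, h2]
        rfl
    · simp only [Prog.next]; rw [ihp l hp]
    · simp only [Prog.next]; rw [ihq l hq]
  | loop c p ihp =>
    intro l h
    have hp : ∀ r < p.width, w r = w' r := by
      intro r hr; apply h; cases c <;> simp [Prog.width, hr]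
    rcases l with _ | l
    · cases c with
      | input f => rfl
      | cells r s f =>
        have h1 := h r (by simp [Prog.width])
        have h2 := h s (by simp [Prog.width])
        simp only [Prog.next, Cond.eval, h1, h2]
        rfl
    · simp only [Prog.next]; rw [ihp l hp]

/-- The heads are within their bounds. -/
def Tapes.Bounded (x : List A) (k : ℕ) (T : Tapes B) : Prop :=
  T.inputHead ≤ x.length + 1 ∧ ∀ r, T.head r ≤ k

/-- Small-step semantics with bounded heads. -/
def Prog.Steps (x : List A) (k : ℕ) (p : Prog A B) (c c' : Option p.Label × Tapes B) : Prop :=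
  c.2.Bounded x k ∧ c'.2.Bounded x k ∧ ∃ l, c.1 = some l ∧
    c' = ((p.next (TuringMachine.inputCell x c.2.inputHead) c.2.scan l).1,
      (p.next (TuringMachine.inputCell x c.2.inputHead) c.2.scan l).2.apply x c.2)

theorem Exec.bounded {x : List A} {k : ℕ} {p : Prog A B} {T T' : Tapes B} (h : Exec x k p T T')
    (hT : T.Bounded x k) : T'.Bounded x k := by
  induction h with
  | moveInput m T => exact ⟨min_le_right _ _, hT.2⟩
  | write r f m T h =>
    refine ⟨hT.1, fun s => ?_⟩
    by_cases hs : s = r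
    · subst hs; simpa [Action.apply] using h
    · simpa [Action.apply, hs] using hT.2 s
  | emit b T => exact hT
  | seq _ _ ih1 ih2 => exact ih2 (ih1 hT)
  | ite_true _ _ ih => exact ih hT
  | ite_false _ _ ih => exact ih hT
  | loop_true _ _ _ ih1 ih2 => exact ih2 (ih1 hT)
  | loop_false _ => exact hT

/-- The run of a composite program is glued from the runs of its parts, carried over along the
inclusions of control states. The end of the first part of `seq` becomes the entry of the second
part, the end of a branch is the end of `ite`, and the end of a loop body is the test state of the
loop. -/
theorem Exec.steps {x : List A} {k : ℕ} {p : Prog A B} {T T' : Tapes B} (h : Exec x k p T T')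
    (hT : T.Bounded x k) :
    Relation.ReflTransGen (p.Steps x k) (some p.entry, T) (none, T') := by
  induction h with
  | moveInput m T =>
    exact .single ⟨hT, (Exec.moveInput m T).bounded hT, (), rfl, rfl⟩
  | write r f m T h =>
    exact .single ⟨hT, (Exec.write r f m T h).bounded hT, (), rfl, rfl⟩
  | emit b T =>
    exact .single ⟨hT, (Exec.emit (k := k) b T).bounded hT, (), rfl, rfl⟩
  | @seq p q T T' T'' h1 h2 ih1 ih2 =>
    have e1 := (ih1 hT).lift (p := (Prog.seq p q).Steps x k)
      (fun c : Option p.Label × Tapes B =>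
        ((c.1.elim (some (Sum.inr q.entry)) fun l' => some (Sum.inl l'), c.2) :
          Option (Prog.seq p q).Label × Tapes B)) (by
        rintro ⟨_, T⟩ c' ⟨b1, b2, l, rfl, rfl⟩
        exact ⟨b1, b2, Sum.inl l, rfl, rfl⟩)
    have e2 := (ih2 (h1.bounded hT)).lift (p := (Prog.seq p q).Steps x k)
      (fun c : Option q.Label × Tapes B =>
        ((c.1.map Sum.inr, c.2) : Option (Prog.seq p q).Label × Tapes B)) (by
        rintro ⟨_, T⟩ c' ⟨b1, b2, l, rfl, rfl⟩
        exact ⟨b1, b2, Sum.inr l, rfl, rfl⟩)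
    exact e1.trans e2
  | @ite_true c p q T T' hc h1 ih =>
    have e1 := (ih hT).lift (p := (Prog.ite c p q).Steps x k)
      (fun c' : Option p.Label × Tapes B =>
        ((c'.1.map fun l' => some (Sum.inl l'), c'.2) :
          Option (Prog.ite c p q).Label × Tapes B)) (by
        rintro ⟨_, T⟩ c' ⟨b1, b2, l, rfl, rfl⟩
        exact ⟨b1, b2, some (Sum.inl l), rfl, rfl⟩)
    refine .head ⟨hT, hT, none, rfl, ?_⟩ e1
    have : c.eval (TuringMachine.inputCell x T.inputHead) T.scan = true := hc
    simp [Prog.next, this, Action.apply]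
    rfl
  | @ite_false c p q T T' hc h1 ih =>
    have e1 := (ih hT).lift (p := (Prog.ite c p q).Steps x k)
      (fun c' : Option q.Label × Tapes B =>
        ((c'.1.map fun l' => some (Sum.inr l'), c'.2) :
          Option (Prog.ite c p q).Label × Tapes B)) (by
        rintro ⟨_, T⟩ c' ⟨b1, b2, l, rfl, rfl⟩
        exact ⟨b1, b2, some (Sum.inr l), rfl, rfl⟩)
    refine .head ⟨hT, hT, none, rfl, ?_⟩ e1
    have : c.eval (TuringMachine.inputCell x T.inputHead) T.scan = false := hc
    simp [Prog.next, this, Action.apply]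
    rfl
  | @loop_true c p T T' T'' hc h1 h2 ih1 ih2 =>
    have e1 := (ih1 hT).lift (p := (Prog.loop c p).Steps x k)
      (fun c' : Option p.Label × Tapes B =>
        ((some c'.1, c'.2) : Option (Prog.loop c p).Label × Tapes B)) (by
        rintro ⟨_, T⟩ c' ⟨b1, b2, l, rfl, rfl⟩
        exact ⟨b1, b2, some l, rfl, rfl⟩)
    refine .head ⟨hT, hT, none, rfl, ?_⟩ (e1.trans (ih2 (h1.bounded hT)))
    have : c.eval (TuringMachine.inputCell x T.inputHead) T.scan = true := hc
    simp [Prog.next, this, Action.apply]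
  | @loop_false c p T hc =>
    refine .single ⟨hT, hT, none, rfl, ?_⟩
    have : c.eval (TuringMachine.inputCell x T.inputHead) T.scan = false := hc
    simp [Prog.next, this, Action.apply]

/-! ### The machine of a program -/

/-- The move of the input head. -/
def Action.inputMove : Action B → Move
  | .moveInput m => m
  | _ => .stay

/-- The symbol written on and the head move of the work tape `r`, which scans `o`. -/
def Action.workMove (r : ℕ) (o : Option Bool) : Action B → Option Bool × Move
  | .write s o' m => if r = s then (o', m) else (o, .stay)
  | _ => (o, .stay)

/-- The emitted symbol. -/
def Action.emitted : Action B → Option B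
  | .emit b => some b
  | _ => none

/-- The contents of the first work tapes, extended by blanks. -/
def extend {k : ℕ} (w : Fin k → Option Bool) (r : ℕ) : Option Bool :=
  if h : r < k then w ⟨r, h⟩ else none

/-- The Turing machine that runs a program. -/
def Prog.machine (p : Prog A B) : TuringMachine A B where
  tapes := p.width
  State := Option p.Label
  finite_state := by have := p.finite_label; infer_instance
  Work := Option Bool
  finite_work := inferInstance
  blank := none
  start := some p.entry
  δ q a w := q.map fun l =>
    ((p.next a (extend w) l).1, (p.next a (extend w) l).2.inputMove,
      fun i => (p.next a (extend w) l).2.workMove i (w i), (p.next a (extend w) l).2.emitted)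

/-- The machine configuration given by a control state and tapes. -/
def Prog.config (p : Prog A B) (c : Option p.Label × Tapes B) : p.machine.Config where
  state := c.1
  inputHead := c.2.inputHead
  work i := c.2.work i
  head i := c.2.head i
  output := c.2.output

/-- The tapes from `width` on are forgotten by `config`, which is harmless by `Prog.next_congr`. As
the input head is within its bounds, the clamping in `step` has no effect while the head stays. -/
theorem Prog.step_config {x : List A} {k : ℕ} {p : Prog A B} {c c' : Option p.Label × Tapes B}
    (h : p.Steps x k c c') : p.machine.step x (p.config c) = some (p.config c') := by
  obtain ⟨q, T⟩ := c
  obtain ⟨⟨hb, -⟩, -, l, rfl, rfl⟩ := h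
  have hb' : min T.inputHead (x.length + 1) = T.inputHead := min_eq_left hb
  have e : p.next (TuringMachine.inputCell x T.inputHead)
      (extend fun i : Fin p.width => T.work i (T.head i)) l =
      p.next (TuringMachine.inputCell x T.inputHead) T.scan l := by
    refine p.next_congr _ _ _ l fun r hr => ?_
    simp [extend, hr, Tapes.scan]
  have e' : (p.machine).step x (p.config (some l, T)) = some
      { state := (p.next (TuringMachine.inputCell x T.inputHead) T.scan l).1
        inputHead := min ((p.next (TuringMachine.inputCell x T.inputHead)
          T.scan l).2.inputMove.apply T.inputHead) (x.length + 1)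
        work := fun i => Function.update (T.work i) (T.head i)
          ((p.next (TuringMachine.inputCell x T.inputHead) T.scan l).2.workMove i
            (T.work i (T.head i))).1
        head := fun i => ((p.next (TuringMachine.inputCell x T.inputHead) T.scan l).2.workMove i
            (T.work i (T.head i))).2.apply (T.head i)
        output := T.output ++
          (p.next (TuringMachine.inputCell x T.inputHead) T.scan l).2.emitted.toList } := by
    rw [← e]; rfl
  rw [e']
  generalize p.next (TuringMachine.inputCell x T.inputHead) T.scan l = r
  obtain ⟨q, a⟩ := r
  have hu : ∀ i : Fin p.width, Function.update (T.work i) (T.head i) (T.work i (T.head i)) =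
      T.work i := fun i => Function.update_eq_self _ _
  cases a with
  | idle =>
    simp only [Action.apply, Action.inputMove, Action.workMove, Action.emitted, Prog.config,
      Move.apply, hb', Option.toList_none, List.append_nil]
    congr 2
    exact funext hu
  | moveInput m =>
    simp only [Action.apply, Action.inputMove, Action.workMove, Action.emitted, Prog.config,
      Option.toList_none, List.append_nil]
    congr 2
    exact funext hu
  | emit b =>
    simp only [Action.apply, Action.inputMove, Action.workMove, Action.emitted, Prog.config,
      Move.apply, hb', Option.toList_some]
    congr 2
    exact funext hu
  | write r o m =>
    simp only [Action.apply, Action.inputMove, Action.workMove, Action.emitted, Prog.config,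
      Move.apply, hb', Option.toList_none, List.append_nil]
    congr 2
    · funext i
      by_cases h : (i : ℕ) = r
      · subst h
        simp only [if_true, Function.update_self]
        rfl
      · simp only [if_neg h, Function.update_of_ne h]
        exact hu i
    · funext i
      by_cases h : (i : ℕ) = r
      · subst h; simp
      · simp [h]

/-- The initial tapes. -/
def Tapes.init : Tapes B where
  inputHead := 0
  work _ _ := none
  head _ := 0
  output := []

/-- A deterministic run that halts passes through every reachable configuration, so a property
checked along this run holds for all of them. -/
theorem reaches_of_chain {C : Type*} {f : C → Option C} {Q : C → Prop} {a z c : C}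
    (h : Relation.ReflTransGen (fun u v => f u = some v ∧ Q v) a z) (hz : f z = none) (ha : Q a)
    (hc : Relation.ReflTransGen (fun u v => f u = some v) a c) : Q c := by
  induction h using Relation.ReflTransGen.head_induction_on with
  | refl =>
    rcases hc.cases_head with rfl | ⟨b, hb, -⟩
    · exact ha
    · simp [hz] at hb
  | head huv _ ih =>
    rcases hc.cases_head with rfl | ⟨b, hb, hbc⟩
    · exact ha
    · rw [huv.1] at hb
      cases hb
      exact ih huv.2 hbc

theorem Exec.machine {x : List A} {k : ℕ} {p : Prog A B} {T' : Tapes B}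
    (h : Exec x k p Tapes.init T') :
    p.machine.Outputs x T'.output ∧ p.machine.UsesSpace x k := by
  have h0 : (Tapes.init : Tapes B).Bounded x k := ⟨Nat.zero_le _, fun _ => Nat.zero_le _⟩
  have hs := h.steps h0
  have chain : Relation.ReflTransGen (fun u v : p.machine.Config =>
      p.machine.step x u = some v ∧ ∀ i, v.head i ≤ k)
      (p.config (some p.entry, Tapes.init)) (p.config (none, T')) := by
    refine hs.lift p.config ?_
    intro c c' hc
    exact ⟨p.step_config hc, fun i => hc.2.1.2 i⟩
  have hhalt : p.machine.step x (p.config (none, T')) = none := rfl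
  refine ⟨⟨p.config (none, T'), ?_, hhalt, rfl⟩, ?_⟩
  · exact Relation.ReflTransGen.mono (fun _ _ h => h.1) _ _ chain
  · intro c hc
    exact reaches_of_chain chain hhalt (fun _ => Nat.zero_le _) hc

end Logspace

end PathCheck

namespace PathCheck

namespace Logspace

/-! ## Registers that hold numbers in bijective base two -/

/-- The successor of a number in bijective base two, with the least significant digit first. The
bits `false` and `true` stand for the digits one and two. -/
def succDigits : List Bool → List Bool
  | [] => [false]
  | false :: l => true :: l
  | true :: l => false :: succDigits l

/-- The value of a number in bijective base two. -/
def ofDigits : List Bool → ℕ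
  | [] => 0
  | b :: l => (if b then 2 else 1) + 2 * ofDigits l

theorem ofDigits_succDigits (l : List Bool) : ofDigits (succDigits l) = ofDigits l + 1 := by
  induction l with
  | nil => rfl
  | cons b l ih => cases b <;> simp [succDigits, ofDigits, ih] <;> omega

/-- Each digit is at least one, so the value is at least `1 + 2 + ⋯ + 2 ^ (l.length - 1)`. -/
theorem two_pow_length_le (l : List Bool) : 2 ^ l.length ≤ ofDigits l + 1 := by
  induction l with
  | nil => simp [ofDigits]
  | cons b l ih => cases b <;> simp [ofDigits, pow_succ] <;> omega

/-- The digits of a number. -/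
def digits (m : ℕ) : List Bool := succDigits^[m] []

theorem digits_zero : digits 0 = [] := rfl

theorem digits_succ (m : ℕ) : digits (m + 1) = succDigits (digits m) :=
  Function.iterate_succ_apply' _ _ _

theorem ofDigits_digits (m : ℕ) : ofDigits (digits m) = m := by
  induction m with
  | zero => rfl
  | succ m ih => rw [digits_succ, ofDigits_succDigits, ih]

theorem digits_injective : Function.Injective digits :=
  Function.LeftInverse.injective ofDigits_digits

theorem length_digits_le (m : ℕ) : (digits m).length ≤ Nat.log 2 (m + 1) := by
  have := two_pow_length_le (digits m)
  rw [ofDigits_digits] at this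
  exact Nat.le_log_of_pow_le (by norm_num) this

/-- A work tape that holds the given digits after a blank cell. -/
def tape (l : List Bool) : ℕ → Option Bool
  | 0 => none
  | i + 1 => l[i]?

theorem tape_append_cons (p l : List Bool) (a : Bool) :
    tape (p ++ a :: l) (p.length + 1) = some a := by
  simp [tape]

theorem tape_end (p : List Bool) : tape p (p.length + 1) = none := by
  simp [tape]

theorem update_tape_cons (p l : List Bool) (a b : Bool) :
    Function.update (tape (p ++ a :: l)) (p.length + 1) (some b) = tape (p ++ b :: l) := by
  funext i
  rcases i with _ | i
  · simp [tape]
  · by_cases h : i = p.length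
    · subst h; simp [tape]
    · rw [Function.update_of_ne (by omega)]
      simp only [tape, List.getElem?_append]
      split
      · rfl
      · obtain ⟨j, hj⟩ : ∃ j, i - p.length = j + 1 := ⟨i - p.length - 1, by omega⟩
        simp [hj]

theorem update_tape_end (p : List Bool) (o : Bool) :
    Function.update (tape p) (p.length + 1) (some o) = tape (p ++ [o]) := by
  funext i
  rcases i with _ | i
  · simp [tape]
  · by_cases h : i = p.length
    · subst h; simp [tape]
    · rw [Function.update_of_ne (by omega)]
      simp only [tape, List.getElem?_append]
      split
      · rfl
      · obtain ⟨j, hj⟩ : ∃ j, i - p.length = j + 1 := ⟨i - p.length - 1, by omega⟩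
        simp [hj]
        omega

theorem update_tape_erase (p : List Bool) (o : Bool) :
    Function.update (tape (p ++ [o])) (p.length + 1) none = tape p := by
  rw [← update_tape_end, Function.update_idem, ← tape_end p, Function.update_eq_self]

variable {A B : Type}

/-- Replacing the contents and the head position of a work tape. -/
def Tapes.set (T : Tapes B) (r : ℕ) (l : List Bool) (h : ℕ) : Tapes B :=
  { T with work := Function.update T.work r (tape l), head := Function.update T.head r h }

theorem Tapes.set_comm (T : Tapes B) {r s : ℕ} (hrs : r ≠ s) (l l' : List Bool) (h h' : ℕ) :
    (T.set r l h).set s l' h' = (T.set s l' h').set r l h := by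
  simp [Tapes.set, Function.update_comm hrs]

@[simp] theorem Tapes.scan_set (T : Tapes B) (r : ℕ) (l : List Bool) (h : ℕ) :
    (T.set r l h).scan r = tape l h := by
  simp [Tapes.set, Tapes.scan]

theorem Tapes.scan_set_of_ne (T : Tapes B) {r s : ℕ} (hrs : s ≠ r) (l : List Bool) (h : ℕ) :
    (T.set r l h).scan s = T.scan s := by
  simp [Tapes.set, Tapes.scan, hrs]

variable {x : List A} {k : ℕ}

theorem exec_write_set (T : Tapes B) (r : ℕ) {l l' : List Bool} {h : ℕ}
    {f : Option Bool → Option Bool} {m : Move} {h' : ℕ}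
    (hl : Function.update (tape l) h (f (tape l h)) = tape l') (hm : m.apply h = h')
    (hk : h' ≤ k) : Exec x k (.write r f m : Prog A B) (T.set r l h) (T.set r l' h') := by
  subst hm
  have := Exec.write (x := x) (k := k) r f m (T.set r l h) (by simpa [Tapes.set] using hk)
  convert this using 1
  rw [Tapes.scan_set]
  simp [Action.apply, Tapes.set, hl]

/-- Moving the head of a work tape. -/
def moveWork (r : ℕ) (m : Move) : Prog A B := .write r (fun o => o) m

theorem exec_moveWork (T : Tapes B) (r : ℕ) (l : List Bool) {h : ℕ} {m : Move} {h' : ℕ}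
    (hm : m.apply h = h') (hk : h' ≤ k) :
    Exec x k (moveWork r m : Prog A B) (T.set r l h) (T.set r l h') :=
  exec_write_set T r (Function.update_eq_self _ _) hm hk

theorem holds_cells_self (T : Tapes B) (r : ℕ) (l : List Bool) (h : ℕ)
    (f : Option Bool → Option Bool → Bool) :
    (Cond.cells r r f).holds x (T.set r l h) = f (tape l h) (tape l h) := by
  simp [Cond.holds, Cond.eval]

/-- Moving the head of a work tape back to the first cell. -/
def rewind (r : ℕ) : Prog A B :=
  .seq (moveWork r .left) (.loop (.cells r r fun a _ => a.isSome) (moveWork r .left))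

theorem exec_rewind_loop (T : Tapes B) (r : ℕ) (l : List Bool) (h : ℕ) (hl : h ≤ l.length)
    (hk : h ≤ k) : Exec x k (.loop (.cells r r fun a _ => a.isSome) (moveWork r .left) : Prog A B)
      (T.set r l h) (T.set r l 0) := by
  induction h with
  | zero => exact .loop_false (by simp [holds_cells_self, tape])
  | succ h ih =>
    refine .loop_true ?_ (exec_moveWork T r l rfl (by simp [Move.apply]; omega)) (ih (by omega) (by omega))
    simp [holds_cells_self, tape]
    omega

/-- The head may scan the blank behind the last digit, where the loop would stop at once; hence the
unconditional first move to the left. The loop then ends at the blank cell `0`. -/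
theorem exec_rewind (T : Tapes B) (r : ℕ) (l : List Bool) (h : ℕ) (hl : h ≤ l.length + 1)
    (hk : h ≤ k) : Exec x k (rewind r : Prog A B) (T.set r l h) (T.set r l 0) := by
  refine .seq (exec_moveWork T r l (h' := h - 1) rfl (by omega)) ?_
  exact exec_rewind_loop T r l _ (by omega) (by omega)

/-- The carry phase of the increment of a register. -/
def carry (r : ℕ) : Prog A B :=
  .seq (.loop (.cells r r fun a _ => a == some true) (.write r (fun _ => some false) .right))
    (.write r (fun a => some a.isSome) .stay)

/-- Digits two become one as long as there is a carry. The final write turns a digit one into two,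
or the blank behind the last digit into a new digit one; both cases are covered by `some a.isSome`.
The induction moves the processed digits into the prefix `p`. The final head position is left open
because `rewind` does not need it. -/
theorem exec_carry (T : Tapes B) (r : ℕ) (p l : List Bool)
    (hk : (p ++ succDigits l).length ≤ k) :
    ∃ h, h ≤ (p ++ succDigits l).length ∧
      Exec x k (carry r : Prog A B) (T.set r (p ++ l) (p.length + 1))
        (T.set r (p ++ succDigits l) h) := by
  induction l generalizing p with
  | nil =>
    refine ⟨p.length + 1, by simp [succDigits], .seq (.loop_false ?_) (exec_write_set T r ?_ rfl ?_)⟩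
    · simp [holds_cells_self, tape]
    · simpa [tape, succDigits] using update_tape_end p false
    · simpa [Move.apply, succDigits] using hk
  | cons b l ih =>
    cases b with
    | false =>
      simp only [succDigits, List.length_append, List.length_cons] at hk ⊢
      refine ⟨p.length + 1, by omega, .seq (.loop_false ?_) (exec_write_set T r ?_ rfl ?_)⟩
      · simp [holds_cells_self, tape]
      · rw [tape_append_cons, update_tape_cons]; rfl
      · simp; omega
    | true =>
      have e : p ++ succDigits (true :: l) = (p ++ [false]) ++ succDigits l := by
        simp [succDigits]
      rw [e] at hk ⊢
      obtain ⟨h, hh, ex⟩ := ih (p ++ [false]) hk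
      refine ⟨h, hh, ?_⟩
      -- Taking the sequence apart exposes the remaining loop, to which one more iteration is
      -- prepended.
      rcases ex with _ | _ | _ | ⟨ex1, ex2⟩
      refine .seq (.loop_true ?_ (exec_write_set T r (l' := (p ++ [false]) ++ l)
        (h' := (p ++ [false]).length + 1) ?_ ?_ ?_) ex1) ex2
      · simp [holds_cells_self, tape]
      · simpa using update_tape_cons p l true false
      · simp [Move.apply]
      · simp only [List.length_append] at hk ⊢
        have : 1 ≤ (succDigits l).length := by
          rcases l with _ | ⟨_ | _, l⟩ <;> simp [succDigits]
        simp at hk ⊢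
        omega

theorem length_succDigits_pos (l : List Bool) : 1 ≤ (succDigits l).length := by
  rcases l with _ | ⟨_ | _, l⟩ <;> simp [succDigits]

/-- Incrementing a register. -/
def inc (r : ℕ) : Prog A B := .seq (moveWork r .right) (.seq (carry r) (rewind r))

theorem exec_inc_set (T : Tapes B) (r : ℕ) (l : List Bool) (hk : (succDigits l).length ≤ k) :
    Exec x k (inc r : Prog A B) (T.set r l 0) (T.set r (succDigits l) 0) := by
  have h1 := length_succDigits_pos l
  obtain ⟨h, hh, ex⟩ := exec_carry (x := x) (k := k) T r [] l (by simpa using hk)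
  simp only [List.nil_append] at hh ex
  exact .seq (exec_moveWork T r l rfl (by simp [Move.apply]; omega))
    (.seq ex (exec_rewind T r _ h (by omega) (by omega)))

/-- Setting a register to zero. -/
def clear (r : ℕ) : Prog A B :=
  .seq (.seq (moveWork r .right) (.loop (.cells r r fun a _ => a.isSome) (moveWork r .right)))
    (.seq (moveWork r .left) (.loop (.cells r r fun a _ => a.isSome) (.write r (fun _ => none) .left)))

theorem exec_to_end (T : Tapes B) (r : ℕ) (p l : List Bool) (hk : (p ++ l).length + 1 ≤ k) :
    Exec x k (.loop (.cells r r fun a _ => a.isSome) (moveWork r .right) : Prog A B)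
      (T.set r (p ++ l) (p.length + 1)) (T.set r (p ++ l) ((p ++ l).length + 1)) := by
  induction l generalizing p with
  | nil =>
    simp only [List.append_nil]
    exact .loop_false (by simp [holds_cells_self, tape])
  | cons b l ih =>
    have e : p ++ b :: l = (p ++ [b]) ++ l := by simp
    refine .loop_true (by simp [holds_cells_self, tape])
      (exec_moveWork T r _ (h' := (p ++ [b]).length + 1) (by simp [Move.apply]) ?_) ?_
    · simp at hk ⊢; omega
    · rw [e] at hk ⊢
      exact ih _ hk

/-- Digits are erased from the end, so the tape holds an initial segment of the original digits at
any time. -/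
theorem exec_erase (T : Tapes B) (r : ℕ) (l : List Bool) (hk : l.length ≤ k) :
    Exec x k (.loop (.cells r r fun a _ => a.isSome) (.write r (fun _ => none) .left) : Prog A B)
      (T.set r l l.length) (T.set r [] 0) := by
  induction l using List.reverseRecOn with
  | nil => exact .loop_false (by simp [holds_cells_self, tape])
  | append_singleton l b ih =>
    simp only [List.length_append, List.length_singleton] at hk ⊢
    exact .loop_true (by simp [holds_cells_self, tape])
      (exec_write_set T r (update_tape_erase l b) rfl (by simp [Move.apply]; omega))
      (ih (by omega))

theorem exec_clear_set (T : Tapes B) (r : ℕ) (l : List Bool) (hk : l.length + 1 ≤ k) :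
    Exec x k (clear r : Prog A B) (T.set r l 0) (T.set r [] 0) := by
  refine .seq (.seq (exec_moveWork T r l rfl (by simp [Move.apply]; omega))
    (exec_to_end T r [] l hk)) (.seq (exec_moveWork T r l rfl ?_) (exec_erase T r l (by omega)))
  simp [Move.apply]; omega

/-- The scan loop of a comparison. -/
def compareLoop (r s : ℕ) : Prog A B :=
  .loop (.cells r s fun a b => a == b && a.isSome)
    (.seq (moveWork r .right) (moveWork s .right))

/-- Comparing two registers: afterwards, the scanned cells agree iff the registers do. -/
def compare (r s : ℕ) : Prog A B :=
  .seq (moveWork r .right) (.seq (moveWork s .right) (compareLoop r s))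

theorem exec_moveWork_fst (T : Tapes B) {r s : ℕ} (hrs : r ≠ s) (l l' : List Bool) {h g : ℕ}
    {m : Move} {h' : ℕ} (hm : m.apply h = h') (hk : h' ≤ k) :
    Exec x k (moveWork r m : Prog A B) ((T.set r l h).set s l' g) ((T.set r l h').set s l' g) := by
  rw [Tapes.set_comm _ hrs, Tapes.set_comm _ hrs]
  exact exec_moveWork _ _ _ hm hk

theorem holds_cells (T : Tapes B) {r s : ℕ} (hrs : r ≠ s) (l l' : List Bool) (h h' : ℕ)
    (f : Option Bool → Option Bool → Bool) :
    (Cond.cells r s f).holds x ((T.set r l h).set s l' h') = f (tape l h) (tape l' h') := by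
  simp [Cond.holds, Cond.eval, Tapes.scan_set_of_ne _ hrs]

/-- The heads advance in step over equal digits. They stop where the cells differ or are both blank,
and the scanned cells agree in the second case only, when both words have ended after equal digits.
-/
theorem exec_compareLoop (T : Tapes B) {r s : ℕ} (hrs : r ≠ s) (p l l' : List Bool)
    (hk : (p ++ l).length + 1 ≤ k) (hk' : (p ++ l').length + 1 ≤ k) :
    ∃ h, h ≤ (p ++ l).length + 1 ∧ h ≤ (p ++ l').length + 1 ∧
      (tape (p ++ l) h = tape (p ++ l') h ↔ l = l') ∧
      Exec x k (compareLoop r s : Prog A B)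
        ((T.set r (p ++ l) (p.length + 1)).set s (p ++ l') (p.length + 1))
        ((T.set r (p ++ l) h).set s (p ++ l') h) := by
  -- The loop stops at once unless both words continue with the same digit.
  have halt_early : ∀ p l l' : List Bool, ¬ (∃ a m m', l = a :: m ∧ l' = a :: m') →
      ∃ h, h ≤ (p ++ l).length + 1 ∧ h ≤ (p ++ l').length + 1 ∧
        (tape (p ++ l) h = tape (p ++ l') h ↔ l = l') ∧
        Exec x k (compareLoop r s : Prog A B)
          ((T.set r (p ++ l) (p.length + 1)).set s (p ++ l') (p.length + 1))
          ((T.set r (p ++ l) h).set s (p ++ l') h) := by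
    intro p l l' hne
    refine ⟨p.length + 1, by simp, by simp, ?_, .loop_false ?_⟩
    · rcases l with _ | ⟨a, l⟩ <;> rcases l' with _ | ⟨a', l'⟩ <;> simp [tape]
      rintro rfl
      exact absurd ⟨a, l, l', rfl, rfl⟩ hne
    · rw [holds_cells _ hrs]
      rcases l with _ | ⟨a, l⟩ <;> rcases l' with _ | ⟨a', l'⟩ <;> simp [tape]
      rintro rfl
      exact absurd ⟨a, l, l', rfl, rfl⟩ hne
  induction l generalizing p l' with
  | nil => exact halt_early _ _ _ (by simp)
  | cons a l ih =>
    by_cases hne : ∃ b m m', a :: l = b :: m ∧ l' = b :: m'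
    · obtain ⟨b, m, m', h, rfl⟩ := hne
      obtain ⟨rfl, rfl⟩ := List.cons.inj h
      have e : ∀ m, p ++ a :: m = (p ++ [a]) ++ m := by simp
      rw [e l] at hk
      rw [e m'] at hk'
      obtain ⟨h, h1, h2, h3, ex⟩ := ih (p ++ [a]) m' hk hk'
      rw [e l, e m']
      refine ⟨h, h1, h2, by rw [h3]; simp, ?_⟩
      have hp : p.length + 1 + 1 = (p ++ [a]).length + 1 := by simp
      refine .loop_true ?_ (.seq (exec_moveWork_fst T hrs _ _ hp ?_)
        (exec_moveWork _ s _ hp ?_)) ex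
      · rw [holds_cells _ hrs]; simp [tape]
      · simp at hk ⊢; omega
      · simp at hk ⊢; omega
    · exact halt_early _ _ _ hne

theorem exec_compare (T : Tapes B) {r s : ℕ} (hrs : r ≠ s) (l l' : List Bool)
    (hk : l.length + 1 ≤ k) (hk' : l'.length + 1 ≤ k) :
    ∃ h, h ≤ l.length + 1 ∧ h ≤ l'.length + 1 ∧ (tape l h = tape l' h ↔ l = l') ∧
      Exec x k (compare r s : Prog A B) ((T.set r l 0).set s l' 0)
        ((T.set r l h).set s l' h) := by
  obtain ⟨h, h1, h2, h3, ex⟩ := exec_compareLoop (x := x) T hrs [] l l' hk hk'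
  refine ⟨h, h1, h2, h3, .seq (exec_moveWork_fst T hrs _ _ rfl ?_)
    (.seq (exec_moveWork _ s _ rfl ?_) ex)⟩ <;> simp [Move.apply] <;> omega

theorem exec_rewind_both (T : Tapes B) {r s : ℕ} (hrs : r ≠ s) (l l' : List Bool) {h : ℕ}
    (hl : h ≤ l.length + 1) (hl' : h ≤ l'.length + 1) (hk : h ≤ k) :
    Exec x k (.seq (rewind r) (rewind s) : Prog A B) ((T.set r l h).set s l' h)
      ((T.set r l 0).set s l' 0) := by
  refine .seq (T' := (T.set r l 0).set s l' h) ?_ (exec_rewind _ s l' h hl' hk)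
  rw [Tapes.set_comm _ hrs, Tapes.set_comm _ hrs]
  exact exec_rewind _ r l h hl hk

/-! ### Programs on registers -/

/-- The tapes that represent the given register values. -/
def embed (σ : ℕ → ℕ) (h : ℕ) (o : List B) : Tapes B where
  inputHead := h
  work r := tape (digits (σ r))
  head _ := 0
  output := o

theorem embed_set (σ : ℕ → ℕ) (h : ℕ) (o : List B) (r m : ℕ) :
    (embed σ h o).set r (digits m) 0 = embed (Function.update σ r m) h o := by
  simp only [Tapes.set, embed, Function.update_eq_self_iff.mpr]
  congr 1
  · funext s
    by_cases hs : s = r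
    · subst hs; simp
    · simp [hs]

theorem embed_set_self (σ : ℕ → ℕ) (h : ℕ) (o : List B) (r : ℕ) :
    (embed σ h o).set r (digits (σ r)) 0 = embed σ h o := by
  rw [embed_set, Function.update_eq_self]

/-- Registers up to `n` fit into the work space `k`. -/
def Fits (n k : ℕ) : Prop := ∀ m ≤ n, (digits m).length + 1 ≤ k

variable {n : ℕ}

theorem exec_inc (hk : Fits n k) {σ : ℕ → ℕ} {h : ℕ} {o : List B} {r : ℕ} (hr : σ r + 1 ≤ n) :
    Exec x k (inc r : Prog A B) (embed σ h o) (embed (Function.update σ r (σ r + 1)) h o) := by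
  rw [← embed_set, ← embed_set_self σ h o r, digits_succ, embed_set_self]
  have := exec_inc_set (x := x) (k := k) (embed σ h o) r (digits (σ r)) (by
    rw [← digits_succ]; have := hk _ hr; omega)
  rwa [embed_set_self] at this

theorem exec_clear (hk : Fits n k) {σ : ℕ → ℕ} {h : ℕ} {o : List B} {r : ℕ} (hr : σ r ≤ n) :
    Exec x k (clear r : Prog A B) (embed σ h o) (embed (Function.update σ r 0) h o) := by
  have := exec_clear_set (x := x) (k := k) (embed σ h o) r (digits (σ r)) (hk _ hr)
  rwa [embed_set_self, ← digits_zero, embed_set] at this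

/-- Branching on the equality of two registers. -/
def ifEq (r s : ℕ) (p q : Prog A B) : Prog A B :=
  .seq (compare r s) (.ite (.cells r s fun a b => a == b)
    (.seq (.seq (rewind r) (rewind s)) p) (.seq (.seq (rewind r) (rewind s)) q))

/-- The comparison leaves the heads somewhere on the digits, so the tapes `T` are not of the form
`embed`. Only two facts about them matter: the scanned cells reveal the result, and rewinding
restores the registers. -/
theorem exec_compare_embed (hk : Fits n k) {σ : ℕ → ℕ} (h : ℕ) (o : List B) {r s : ℕ}
    (hrs : r ≠ s) (hr : σ r ≤ n) (hs : σ s ≤ n) :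
    ∃ T : Tapes B, Exec x k (compare r s) (embed σ h o) T ∧
      Exec x k (.seq (rewind r) (rewind s)) T (embed σ h o) ∧
      ((Cond.cells r s fun a b => a == b).holds x T = true ↔ σ r = σ s) ∧
      ((Cond.cells r s fun a b => a != b).holds x T = true ↔ σ r ≠ σ s) := by
  obtain ⟨g, h1, h2, h3, ex⟩ := exec_compare (x := x) (k := k) (embed σ h o) hrs (digits (σ r))
    (digits (σ s)) (hk _ hr) (hk _ hs)
  have ex' := exec_rewind_both (x := x) (k := k) (embed σ h o) hrs (digits (σ r))
    (digits (σ s)) h1 h2 (h1.trans (hk _ hr))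
  rw [embed_set_self, embed_set_self] at ex ex'
  rw [digits_injective.eq_iff] at h3
  exact ⟨_, ex, ex', by simpa [holds_cells _ hrs] using h3,
    by simpa [holds_cells _ hrs] using not_congr h3⟩

theorem exec_ifEq_pos (hk : Fits n k) {σ : ℕ → ℕ} {h : ℕ} {o : List B} {r s : ℕ} (hrs : r ≠ s)
    (hr : σ r ≤ n) (he : σ r = σ s) {p q : Prog A B} {T' : Tapes B}
    (hp : Exec x k p (embed σ h o) T') : Exec x k (ifEq r s p q) (embed σ h o) T' := by
  obtain ⟨T, e1, e2, e3, -⟩ := exec_compare_embed (x := x) hk h o hrs hr (he ▸ hr)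
  exact .seq e1 (.ite_true (e3.mpr he) (.seq e2 hp))

theorem exec_ifEq_neg (hk : Fits n k) {σ : ℕ → ℕ} {h : ℕ} {o : List B} {r s : ℕ} (hrs : r ≠ s)
    (hr : σ r ≤ n) (hs : σ s ≤ n) (he : σ r ≠ σ s) {p q : Prog A B} {T' : Tapes B}
    (hq : Exec x k q (embed σ h o) T') : Exec x k (ifEq r s p q) (embed σ h o) T' := by
  obtain ⟨T, e1, e2, e3, -⟩ := exec_compare_embed (x := x) hk h o hrs hr hs
  exact .seq e1 (.ite_false (by rw [← Bool.not_eq_true, e3]; exact he) (.seq e2 hq))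

/-- Repeating a program until two registers agree. -/
def untilEq (r s : ℕ) (p : Prog A B) : Prog A B :=
  .seq (compare r s) (.seq (.loop (.cells r s fun a b => a != b)
    (.seq (.seq (rewind r) (rewind s)) (.seq p (compare r s)))) (.seq (rewind r) (rewind s)))

theorem exec_untilEq_done (hk : Fits n k) {σ : ℕ → ℕ} {h : ℕ} {o : List B} {r s : ℕ}
    (hrs : r ≠ s) (hr : σ r ≤ n) (he : σ r = σ s) {p : Prog A B} :
    Exec x k (untilEq r s p) (embed σ h o) (embed σ h o) := by
  obtain ⟨T, e1, e2, -, e4⟩ := exec_compare_embed (x := x) hk h o hrs hr (he ▸ hr)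
  exact .seq e1 (.seq (.loop_false (by rw [← Bool.not_eq_true, e4]; simpa using he)) e2)

/-- The execution from `T'` starts with a comparison, which is also the last part of the loop body.
Reading it as such prepends one iteration. -/
theorem exec_untilEq_step (hk : Fits n k) {σ : ℕ → ℕ} {h : ℕ} {o : List B} {r s : ℕ}
    (hrs : r ≠ s) (hr : σ r ≤ n) (hs : σ s ≤ n) (he : σ r ≠ σ s) {p : Prog A B}
    {T' T'' : Tapes B} (hp : Exec x k p (embed σ h o) T')
    (hl : Exec x k (untilEq r s p) T' T'') : Exec x k (untilEq r s p) (embed σ h o) T'' := by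
  obtain ⟨T, e1, e2, -, e4⟩ := exec_compare_embed (x := x) hk h o hrs hr hs
  rcases hl with _ | _ | _ | ⟨f1, _ | _ | _ | ⟨f2, f3⟩⟩
  exact .seq e1 (.seq (.loop_true (e4.mpr he) (.seq e2 (.seq hp f1)) f2) f3)

/-- Branching on whether a register is zero. -/
def ifZero (r : ℕ) (p q : Prog A B) : Prog A B :=
  .seq (moveWork r .right) (.ite (.cells r r fun a _ => a.isNone)
    (.seq (moveWork r .left) p) (.seq (moveWork r .left) q))

/-- Zero is the only number without digits, so it suffices to look at cell `1`. -/
theorem exec_ifZero (hk : Fits n k) {σ : ℕ → ℕ} {h : ℕ} {o : List B} {r : ℕ}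
    {p q : Prog A B} {T' : Tapes B} (hp : σ r = 0 → Exec x k p (embed σ h o) T')
    (hq : σ r ≠ 0 → Exec x k q (embed σ h o) T') :
    Exec x k (ifZero r p q) (embed σ h o) T' := by
  have h1 : 1 ≤ k := le_trans (by simp) (hk 0 (Nat.zero_le _))
  have m1 := exec_moveWork (x := x) (k := k) (embed σ h o) r (digits (σ r)) (m := .right)
    (h := 0) rfl h1
  have m2 := exec_moveWork (x := x) (k := k) (embed σ h o) r (digits (σ r)) (m := .left)
    (h := 1) rfl (Nat.zero_le _)
  rw [embed_set_self] at m1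
  change Exec x k _ _ (Tapes.set _ _ _ 0) at m2
  rw [embed_set_self] at m2
  refine .seq m1 ?_
  by_cases hz : σ r = 0
  · refine .ite_true ?_ (.seq m2 (hp hz))
    simp [holds_cells_self, hz, digits_zero, Move.apply, tape]
  · refine .ite_false ?_ (.seq m2 (hq hz))
    obtain ⟨m, hm⟩ := Nat.exists_eq_succ_of_ne_zero hz
    have := length_succDigits_pos (digits m)
    simp only [holds_cells_self, hm, Nat.succ_eq_add_one, digits_succ, Move.apply, tape]
    rw [List.getElem?_eq_getElem (by omega)]
    rfl

end Logspace

end PathCheck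

namespace PathCheck

namespace Logspace

variable {A : Type} {x : List A} {k n : ℕ}

/-! ## Closure properties of logspace computations -/

/-- `Yields x k p σ h o t o' Q`: from the registers `σ`, the program `p` reaches registers that
agree with `σ` below `t` and satisfy `Q`, with output `o'`. -/
def Yields (x : List A) (k : ℕ) (p : Prog A A) (σ : ℕ → ℕ) (h : ℕ) (o : List A) (t : ℕ)
    (o' : List A) (Q : (ℕ → ℕ) → Prop) : Prop :=
  ∃ σ' h', Exec x k p (embed σ h o) (embed σ' h' o') ∧ (∀ i < t, σ' i = σ i) ∧
    (∀ i, σ' i ≤ x.length + 1) ∧ Q σ'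

/-- The number `g x v`, which may depend on the input word `x` and on the values `v i` of the first
`d` variables, can be computed in logarithmic space. -/
structure Num (d : ℕ) (g : List A → (ℕ → ℕ) → ℕ) : Prop where
  indep : ∀ x v v', (∀ i < d, v i = v' i) → g x v = g x v'
  prog : ∀ (r : ℕ → ℕ) (t : ℕ), (∀ i < d, r i < t) → ∃ p : Prog A A,
    ∀ x k, Fits (x.length + 1) k → ∀ σ h o v, (∀ i, σ i ≤ x.length + 1) →
      (∀ i < d, v i = σ (r i)) → Yields x k p σ h o t o fun σ' => σ' t = g x v

open Classical in
/-- The property `P x v` can be decided in logarithmic space. -/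
def Pred (d : ℕ) (P : List A → (ℕ → ℕ) → Prop) : Prop :=
  Num d fun x v => if P x v then 1 else 0

/-- The word `f x v` can be written in logarithmic space. -/
structure Emit (d : ℕ) (f : List A → (ℕ → ℕ) → List A) : Prop where
  indep : ∀ x v v', (∀ i < d, v i = v' i) → f x v = f x v'
  prog : ∀ (r : ℕ → ℕ) (t : ℕ), (∀ i < d, r i < t) → ∃ p : Prog A A,
    ∀ x k, Fits (x.length + 1) k → ∀ σ h o v, (∀ i, σ i ≤ x.length + 1) →
      (∀ i < d, v i = σ (r i)) → Yields x k p σ h o t (o ++ f x v) fun _ => True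

/-- Intermediate results sit in registers from `t` on. For their sake `p` may have to preserve more
registers, namely those below `t'`, than the composition promises to preserve. -/
theorem Yields.seq {p q : Prog A A} {σ : ℕ → ℕ} {h : ℕ} {o o' o'' : List A} {t t' : ℕ}
    {Q Q' : (ℕ → ℕ) → Prop} (hp : Yields x k p σ h o t' o' Q) (ht : t ≤ t')
    (hq : ∀ σ' h', (∀ i < t', σ' i = σ i) → (∀ i, σ' i ≤ x.length + 1) → Q σ' →
      Yields x k q σ' h' o' t o'' Q') : Yields x k (.seq p q) σ h o t o'' Q' := by
  obtain ⟨σ', h', e, a, b, c⟩ := hp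
  obtain ⟨σ'', h'', e', a', b', c'⟩ := hq σ' h' a b c
  exact ⟨σ'', h'', .seq e e', fun i hi => (a' i hi).trans (a i (hi.trans_le ht)), b', c'⟩

theorem update_le {σ : ℕ → ℕ} (hσ : ∀ i, σ i ≤ n) {r m : ℕ} (hm : m ≤ n) (i : ℕ) :
    Function.update σ r m i ≤ n := by
  by_cases h : i = r
  · subst h; simpa using hm
  · simpa [h] using hσ i

theorem yields_clear (hk : Fits (x.length + 1) k) {σ : ℕ → ℕ} (h : ℕ) (o : List A)
    (hσ : ∀ i, σ i ≤ x.length + 1) {r t : ℕ} (hr : t ≤ r) :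
    Yields x k (clear r) σ h o t o fun σ' => σ' = Function.update σ r 0 :=
  ⟨_, h, exec_clear hk (hσ r), fun i hi => by simp [show i ≠ r by omega],
    update_le hσ (Nat.zero_le _), rfl⟩

theorem yields_inc (hk : Fits (x.length + 1) k) {σ : ℕ → ℕ} (h : ℕ) (o : List A)
    (hσ : ∀ i, σ i ≤ x.length + 1) {r t : ℕ} (hr : t ≤ r) (hs : σ r + 1 ≤ x.length + 1) :
    Yields x k (inc r) σ h o t o fun σ' => σ' = Function.update σ r (σ r + 1) :=
  ⟨_, h, exec_inc hk hs, fun i hi => by simp [show i ≠ r by omega], update_le hσ hs, rfl⟩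

/-- A program without effect. -/
def skip : Prog A A := .moveInput .stay

theorem yields_skip {σ : ℕ → ℕ} (h : ℕ) (o : List A) (hσ : ∀ i, σ i ≤ x.length + 1) (t : ℕ) :
    Yields x k skip σ h o t o fun σ' => σ' = σ :=
  ⟨σ, _, Exec.moveInput .stay (embed σ h o), fun _ _ => rfl, hσ, rfl⟩

/-- The loop rule for counting from `0` to `m` in register `i`. The invariant may speak of the
registers, the input head and the output; the induction is on the number of remaining rounds. -/
theorem exec_untilEq (hk : Fits n k) {i b : ℕ} (hib : i ≠ b) {p : Prog A A}
    (I : ℕ → (ℕ → ℕ) → ℕ → List A → Prop) {m : ℕ}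
    (hI : ∀ j σ h o, I j σ h o → σ i = j ∧ σ b = m ∧ m ≤ n)
    (step : ∀ j < m, ∀ σ h o, I j σ h o →
      ∃ σ' h' o', Exec x k p (embed σ h o) (embed σ' h' o') ∧ I (j + 1) σ' h' o')
    {σ : ℕ → ℕ} {h : ℕ} {o : List A} (h0 : I 0 σ h o) :
    ∃ σ' h' o', Exec x k (untilEq i b p) (embed σ h o) (embed σ' h' o') ∧ I m σ' h' o' := by
  have key : ∀ c j σ h o, j + c = m → I j σ h o →
      ∃ σ' h' o', Exec x k (untilEq i b p) (embed σ h o) (embed σ' h' o') ∧ I m σ' h' o' := by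
    intro c
    induction c with
    | zero =>
      intro j σ h o hj hJ
      obtain ⟨h1, h2, h3⟩ := hI _ _ _ _ hJ
      obtain rfl : j = m := hj
      exact ⟨σ, h, o, exec_untilEq_done hk hib (by omega) (by omega), hJ⟩
    | succ c ih =>
      intro j σ h o hj hJ
      obtain ⟨h1, h2, h3⟩ := hI _ _ _ _ hJ
      obtain ⟨σ', h', o', e, hJ'⟩ := step j (by omega) _ _ _ hJ
      obtain ⟨σ'', h'', o'', e', hJ''⟩ := ih (j + 1) σ' h' o' (by omega) hJ'
      exact ⟨σ'', h'', o'', exec_untilEq_step hk hib (by omega) (by omega) (by omega) e e', hJ''⟩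
  exact key m 0 σ h o (by omega) h0

/-- Copying register `s` to register `t`. -/
def copy (s t : ℕ) : Prog A A := .seq (clear t) (untilEq t s (inc t))

theorem yields_copy (hk : Fits (x.length + 1) k) {σ : ℕ → ℕ} (h : ℕ) (o : List A)
    (hσ : ∀ i, σ i ≤ x.length + 1) {s r t : ℕ} (hsr : s ≠ r) (hr : t ≤ r) :
    Yields x k (copy s r) σ h o t o fun σ' => σ' = Function.update σ r (σ s) := by
  refine (yields_clear hk h o hσ hr).seq le_rfl ?_
  rintro _ h' - hσ' rfl
  obtain ⟨σ'', h'', o'', e, rfl, rfl⟩ := exec_untilEq (x := x) hk hsr.symm (p := inc r)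
    (m := σ s) (fun j σ' _ o' => σ' = Function.update σ r j ∧ o' = o)
    (by rintro j _ _ _ ⟨rfl, rfl⟩; exact ⟨by simp, by simp [hsr], hσ s⟩)
    (by
      rintro j hj _ h₁ _ ⟨rfl, rfl⟩
      refine ⟨_, h₁, _, exec_inc hk ?_, ?_, rfl⟩
      · have := hσ s; simp; omega
      · simp) (h := h') ⟨rfl, rfl⟩
  exact ⟨_, h'', e, fun i hi => by simp [show i ≠ r by omega], update_le hσ (hσ s), rfl⟩

theorem Num.mono {d d' : ℕ} {g : List A → (ℕ → ℕ) → ℕ} (hg : Num d g) (h : d ≤ d') : Num d' g where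
  indep x v v' hv := hg.indep x v v' fun i hi => hv i (hi.trans_le h)
  prog r t hr := by
    obtain ⟨p, hp⟩ := hg.prog r t fun i hi => hr i (hi.trans_le h)
    exact ⟨p, fun x k hk σ h' o v hσ hv => hp x k hk σ h' o v hσ fun i hi => hv i (hi.trans_le h)⟩

theorem Num.update {d : ℕ} {g : List A → (ℕ → ℕ) → ℕ} (hg : Num d g) (x : List A) (v : ℕ → ℕ)
    (j : ℕ) : g x (Function.update v d j) = g x v :=
  hg.indep _ _ _ fun i hi => by simp [hi.ne]

theorem Num.var {d i : ℕ} (hi : i < d) : Num (A := A) d fun _ v => v i where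
  indep _ _ _ h := h i hi
  prog r t hr := by
    refine ⟨copy (r i) t, fun x k hk σ h o v hσ hv => ?_⟩
    obtain ⟨σ', h', e, a, b, rfl⟩ := yields_copy hk h o hσ (hr i hi).ne le_rfl
    exact ⟨_, h', e, a, b, by simp [hv i hi]⟩

theorem Num.zero {d : ℕ} : Num (A := A) d fun _ _ => 0 where
  indep _ _ _ _ := rfl
  prog r t hr := by
    refine ⟨clear t, fun x k hk σ h o v hσ hv => ?_⟩
    obtain ⟨σ', h', e, a, b, rfl⟩ := yields_clear hk h o hσ le_rfl
    exact ⟨_, h', e, a, b, by simp⟩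

theorem Num.one {d : ℕ} : Num (A := A) d fun _ _ => 1 where
  indep _ _ _ _ := rfl
  prog r t hr := by
    refine ⟨.seq (clear t) (inc t), fun x k hk σ h o v hσ hv => ?_⟩
    refine (yields_clear hk h o hσ le_rfl).seq le_rfl ?_
    rintro _ h' - hσ' rfl
    obtain ⟨σ', h', e, a, b, rfl⟩ := yields_inc hk h' o hσ' (r := t) le_rfl (by simp)
    exact ⟨_, h', e, a, b, by simp⟩

/-- Moving the input head to the left end marker. -/
def home : Prog A A :=
  .loop (.input fun a => match a with | .leftEnd => false | _ => true) (.moveInput .left)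

theorem exec_moveInput {m : Move} {h h' : ℕ} (e : min (m.apply h) (x.length + 1) = h') (σ : ℕ → ℕ)
    (o : List A) : Exec x k (.moveInput m) (embed σ h o) (embed σ h' o) := by
  subst e; exact Exec.moveInput _ _

theorem exec_home (σ : ℕ → ℕ) (h : ℕ) (o : List A) :
    Exec x k home (embed σ h o) (embed σ 0 o) := by
  induction h using Nat.strong_induction_on with
  | _ h ih =>
  rcases h with _ | h
  · exact .loop_false rfl
  · have hlt : min h (x.length + 1) < h + 1 := by omega
    refine .loop_true ?_ (exec_moveInput (h' := min h (x.length + 1)) (by simp [Move.apply]) _ _)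
      (ih _ hlt)
    simp only [Cond.holds, Cond.eval, embed, TuringMachine.inputCell]
    cases x[h]? <;> rfl

/-- The length of the input word plus one. -/
theorem Num.top {d : ℕ} : Num (A := A) d fun x _ => x.length + 1 where
  indep _ _ _ _ := rfl
  prog r t hr := by
    refine ⟨.seq (clear t) (.seq home (.loop (.input fun a => match a with
      | .rightEnd => false | _ => true) (.seq (.moveInput .right) (inc t)))),
      fun x k hk σ h o v hσ hv => ?_⟩
    refine (yields_clear hk h o hσ le_rfl).seq le_rfl ?_
    rintro _ h' - hσ' rfl
    -- The head position and the register `t` grow in parallel; the right end marker is in cell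
    -- `x.length + 1`.
    have key : ∀ c j, j + c = x.length + 1 → Exec x k (.loop (.input fun a => match a with
        | .rightEnd => false | _ => true) (.seq (.moveInput .right) (inc t)))
        (embed (Function.update σ t j) j o)
        (embed (Function.update σ t (x.length + 1)) (x.length + 1) o) := by
      intro c
      induction c with
      | zero =>
        intro j hj
        obtain rfl : j = x.length + 1 := hj
        refine .loop_false ?_
        simp [Cond.holds, Cond.eval, embed, TuringMachine.inputCell]
      | succ c ih =>
        intro j hj
        have e := exec_inc (x := x) (B := A) hk (σ := Function.update σ t j) (h := j + 1) (o := o)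
          (r := t) (by simp; omega)
        simp only [Function.update_self, Function.update_idem] at e
        refine .loop_true ?_ (.seq (exec_moveInput (h' := j + 1) ?_ _ o) e) (ih (j + 1) (by omega))
        · rcases j with _ | j
          · rfl
          · simp [Cond.holds, Cond.eval, embed, TuringMachine.inputCell,
              List.getElem?_eq_getElem (show j < x.length by omega)]
        · simp [Move.apply]; omega
    exact ⟨_, _, .seq (exec_home _ _ _) (key (x.length + 1) 0 (by omega)),
      fun i hi => by simp [show i ≠ t by omega], update_le hσ le_rfl, by simp⟩

-- Register `t` first receives the result of the test and is then reused for the value of the chosen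
-- branch.
open Classical in
theorem Num.ite {d : ℕ} {P : List A → (ℕ → ℕ) → Prop} {f g : List A → (ℕ → ℕ) → ℕ}
    (hP : Pred d P) (hf : Num d f) (hg : Num d g) :
    Num d fun x v => if P x v then f x v else g x v where
  indep x v v' h := by
    have := hP.indep x v v' h
    rw [hf.indep x v v' h, hg.indep x v v' h]
    by_cases h1 : P x v <;> by_cases h2 : P x v' <;> simp_all
  prog r t hr := by
    obtain ⟨p, hp⟩ := hP.prog r t hr
    obtain ⟨q, hq⟩ := hf.prog r t hr
    obtain ⟨q', hq'⟩ := hg.prog r t hr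
    refine ⟨.seq p (ifZero t q' q), fun x k hk σ h o v hσ hv => ?_⟩
    refine (hp x k hk σ h o v hσ hv).seq le_rfl ?_
    rintro σ' h' ha hσ' ht
    have hv' : ∀ i < d, v i = σ' (r i) := fun i hi => by rw [ha _ (hr i hi), hv i hi]
    by_cases hx : P x v
    · obtain ⟨σ'', h'', e, a, b, c⟩ := hq x k hk σ' h' o v hσ' hv'
      exact ⟨σ'', h'', exec_ifZero hk (by simp [ht, hx]) (fun _ => e), a, b, by simp [hx, c]⟩
    · obtain ⟨σ'', h'', e, a, b, c⟩ := hq' x k hk σ' h' o v hσ' hv'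
      exact ⟨σ'', h'', exec_ifZero hk (fun _ => e) (by simp [ht, hx]), a, b, by simp [hx, c]⟩

open Classical in
theorem indicator_congr {P Q : Prop} (h : P ↔ Q) :
    (if P then 1 else 0 : ℕ) = if Q then 1 else 0 := by
  obtain rfl := propext h
  rfl

theorem Pred.iff {d : ℕ} {P Q : List A → (ℕ → ℕ) → Prop} (hP : Pred d P)
    (h : ∀ x v, P x v ↔ Q x v) : Pred d Q := by
  have : P = Q := by funext x v; exact propext (h x v)
  exact this ▸ hP

theorem Pred.not {d : ℕ} {P : List A → (ℕ → ℕ) → Prop} (hP : Pred d P) :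
    Pred d fun x v => ¬ P x v := by
  have := Num.ite hP .zero .one
  unfold Pred
  convert this using 3 with x v
  by_cases h : P x v <;> simp [h]

theorem Pred.and {d : ℕ} {P Q : List A → (ℕ → ℕ) → Prop} (hP : Pred d P) (hQ : Pred d Q) :
    Pred d fun x v => P x v ∧ Q x v := by
  have := Num.ite hP hQ .zero
  unfold Pred
  convert this using 3 with x v
  by_cases h : P x v <;> by_cases h' : Q x v <;> simp [h, h']

theorem Pred.or {d : ℕ} {P Q : List A → (ℕ → ℕ) → Prop} (hP : Pred d P) (hQ : Pred d Q) :
    Pred d fun x v => P x v ∨ Q x v :=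
  (hP.not.and hQ.not).not.iff fun x v => by tauto

/-- The two values are kept in the scratch registers `t + 1` and `t + 2`; register `t` receives the
result. -/
theorem Pred.eq {d : ℕ} {f g : List A → (ℕ → ℕ) → ℕ} (hf : Num d f) (hg : Num d g) :
    Pred d fun x v => f x v = g x v where
  indep x v v' h := indicator_congr (by simp only [hf.indep x v v' h, hg.indep x v v' h])
  prog r t hr := by
    obtain ⟨p, hp⟩ := hf.prog r (t + 1) fun i hi => (hr i hi).trans (by omega)
    obtain ⟨q, hq⟩ := hg.prog r (t + 2) fun i hi => (hr i hi).trans (by omega)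
    refine ⟨.seq p (.seq q (.seq (clear t) (ifEq (t + 1) (t + 2) (inc t) skip))),
      fun x k hk σ h o v hσ hv => ?_⟩
    refine (hp x k hk σ h o v hσ hv).seq (t' := t + 1) (by omega) ?_
    rintro σ₁ h₁ a₁ hσ₁ e₁
    refine (hq x k hk σ₁ h₁ o v hσ₁ fun i hi => ?_).seq (t' := t + 2) (by omega) ?_
    · rw [a₁ _ ((hr i hi).trans (by omega)), hv i hi]
    rintro σ₂ h₂ a₂ hσ₂ e₂
    refine (yields_clear hk h₂ o hσ₂ le_rfl).seq le_rfl ?_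
    rintro σ₃ h₃ a₃ hσ₃ e₃
    have f1 : σ₃ (t + 1) = f x v := by rw [e₃, ← e₁, ← a₂ _ (by omega)]; simp
    have f2 : σ₃ (t + 2) = g x v := by rw [e₃, ← e₂]; simp
    have f3 : σ₃ t = 0 := by simp [e₃]
    by_cases he : f x v = g x v
    · obtain ⟨σ', h', e, a, b, rfl⟩ := yields_inc hk h₃ o hσ₃ (r := t) le_rfl (by simp [f3])
      exact ⟨_, h', exec_ifEq_pos hk (by omega) (hσ₃ _) (by rw [f1, f2, he]) e, a, b, by simp [he, f3]⟩
    · obtain ⟨σ', h', e, a, b, rfl⟩ := yields_skip (x := x) (k := k) h₃ o hσ₃ t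
      exact ⟨_, h', exec_ifEq_neg hk (by omega) (hσ₃ _) (hσ₃ _) (by rwa [f1, f2]) e, a, b,
        by simp [he, f3]⟩

/-- Testing the symbol at a position of the input word. -/
theorem Pred.symbol {d : ℕ} {g : List A → (ℕ → ℕ) → ℕ} (hg : Num d g) (f : Option A → Bool) :
    Pred d fun x v => f x[g x v]? = Bool.true where
  indep x v v' h := indicator_congr (by simp only [hg.indep x v v' h])
  prog r t hr := by
    obtain ⟨p, hp⟩ := hg.prog r (t + 1) fun i hi => (hr i hi).trans (by omega)
    refine ⟨.seq p (.seq (clear t) (.seq (clear (t + 2)) (.seq (.seq home (.moveInput .right))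
      (.seq (untilEq (t + 2) (t + 1) (.seq (inc (t + 2)) (.moveInput .right)))
        (.ite (.input fun a => match a with | .symbol a => f (some a) | _ => f none)
          (inc t) skip))))), fun x k hk σ h o v hσ hv => ?_⟩
    refine (hp x k hk σ h o v hσ hv).seq (t' := t + 1) (by omega) ?_
    rintro σ₁ h₁ a₁ hσ₁ e₁
    refine (yields_clear hk h₁ o hσ₁ le_rfl).seq le_rfl ?_
    rintro σ₂ h₂ a₂ hσ₂ e₂
    refine (yields_clear hk h₂ o hσ₂ (r := t + 2) (t := t) (by omega)).seq le_rfl ?_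
    rintro σ₃ h₃ a₃ hσ₃ e₃
    have f1 : σ₃ (t + 1) = g x v := by rw [e₃, e₂]; simp [e₁]
    have f2 : σ₃ (t + 2) = 0 := by rw [e₃]; simp
    have f3 : σ₃ t = 0 := by rw [e₃, e₂]; simp
    -- The input word starts in cell `1`, hence the head position `j + 1`. The head cannot leave the
    -- right end marker, so every position beyond the word is seen as `none`.
    obtain ⟨σ₄, h₄, o₄, ex, rfl, rfl, rfl⟩ := exec_untilEq (x := x) hk
      (p := .seq (inc (t + 2)) (.moveInput .right)) (i := t + 2) (b := t + 1)
      (by omega) (m := g x v) (fun j σ' h' o' => σ' = Function.update σ₃ (t + 2) j ∧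
        h' = min (j + 1) (x.length + 1) ∧ o' = o)
      (by rintro j _ _ _ ⟨rfl, rfl, rfl⟩; exact ⟨by simp, by simp [f1], f1 ▸ hσ₃ _⟩)
      (by
        rintro j hj _ _ _ ⟨rfl, rfl, rfl⟩
        have := hσ₃ (t + 1)
        refine ⟨_, _, _, .seq (exec_inc hk ?_) (exec_moveInput rfl _ _), ?_, ?_, rfl⟩
        · simp; omega
        · simp
        · simp [Move.apply]; omega) (σ := σ₃) (h := min 1 (x.length + 1)) (o := o)
      ⟨by rw [← f2, Function.update_eq_self], rfl, rfl⟩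
    have hσ₄ : ∀ i, Function.update σ₃ (t + 2) (g x v) i ≤ x.length + 1 :=
      update_le hσ₃ (f1 ▸ hσ₃ _)
    have hcell : (Cond.input fun a => match a with
        | .symbol a => f (some a) | _ => f none).holds x
        (embed (Function.update σ₃ (t + 2) (g x v)) (min (g x v + 1) (x.length + 1)) o₄) =
        f x[g x v]? := by
      simp only [Cond.holds, Cond.eval, embed]
      rw [Nat.add_min_add_right]
      simp only [TuringMachine.inputCell]
      rcases lt_or_ge (g x v) x.length with hlt | hge
      · simp [min_eq_left hlt.le, hlt]
      · simp [hge]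
    by_cases he : f x[g x v]? = Bool.true
    · obtain ⟨σ', h', e, a, b, rfl⟩ := yields_inc hk (min (g x v + 1) (x.length + 1)) o₄ hσ₄
        (r := t) (t := t) le_rfl (by simp [f3])
      refine ⟨_, h', .seq (.seq (exec_home _ _ _) (exec_moveInput rfl _ _)) (.seq ex
        (.ite_true (hcell.trans he) e)), fun i hi => ?_, b, by simp [he, f3]⟩
      rw [a i hi, Function.update_of_ne (by omega)]
    · obtain ⟨σ', h', e, a, b, rfl⟩ := yields_skip (x := x) (k := k)
        (min (g x v + 1) (x.length + 1)) o₄ hσ₄ t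
      refine ⟨_, h', .seq (.seq (exec_home _ _ _) (exec_moveInput rfl _ _)) (.seq ex
        (.ite_false (hcell.trans (by simpa using he)) e)), fun i hi => ?_, b, by simp [he, f3]⟩
      rw [a i hi, Function.update_of_ne (by omega)]

open Classical in
/-- Bounded counting. -/
theorem Num.count {d : ℕ} {b : List A → (ℕ → ℕ) → ℕ} {P : List A → (ℕ → ℕ) → Prop}
    (hb : Num d b) (hP : Pred (d + 1) P) :
    Num d fun x v => Nat.count (fun j => P x (Function.update v d j)) (b x v) where
  indep x v v' h := by
    rw [hb.indep x v v' h]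
    congr 1
    funext j
    have := hP.indep x (Function.update v d j) (Function.update v' d j) fun i hi => by
      by_cases hid : i = d
      · simp [hid]
      · simp [hid, h i (by omega)]
    by_cases h1 : P x (Function.update v d j) <;> by_cases h2 : P x (Function.update v' d j) <;>
      simp_all
  prog r t hr := by
    obtain ⟨p, hp⟩ := hb.prog r t hr
    -- The counted variable `d` lives in the loop counter `t + 1`. The bound is in `t`, the count in
    -- `t + 2`, and the result of the test in `t + 3`.
    obtain ⟨q, hq⟩ := hP.prog (Function.update r d (t + 1)) (t + 3) fun i hi => by
      by_cases hid : i = d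
      · simp [hid]
      · have := hr i (by omega); simp [hid]; omega
    refine ⟨.seq p (.seq (clear (t + 1)) (.seq (clear (t + 2)) (.seq (untilEq (t + 1) t
      (.seq q (.seq (ifZero (t + 3) skip (inc (t + 2))) (inc (t + 1))))) (copy (t + 2) t)))),
      fun x k hk σ h o v hσ hv => ?_⟩
    refine (hp x k hk σ h o v hσ hv).seq le_rfl ?_
    rintro σ₁ h₁ a₁ hσ₁ e₁
    refine (yields_clear hk h₁ o hσ₁ (r := t + 1) (t := t) (by omega)).seq le_rfl ?_
    rintro σ₂ h₂ a₂ hσ₂ e₂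
    refine (yields_clear hk h₂ o hσ₂ (r := t + 2) (t := t) (by omega)).seq le_rfl ?_
    rintro σ₃ h₃ a₃ hσ₃ e₃
    have hm : b x v ≤ x.length + 1 := e₁ ▸ hσ₁ t
    obtain ⟨σ₄, h₄, o₄, ex, b1, b2, b3, b4, b5, rfl⟩ := exec_untilEq (x := x) hk
      (p := .seq q (.seq (ifZero (t + 3) skip (inc (t + 2))) (inc (t + 1))))
      (i := t + 1) (b := t) (by omega) (m := b x v)
      (fun j σ' h' o' => σ' (t + 1) = j ∧ σ' t = b x v ∧
        σ' (t + 2) = Nat.count (fun j => P x (Function.update v d j)) j ∧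
        (∀ i < t, σ' i = σ₃ i) ∧ (∀ i, σ' i ≤ x.length + 1) ∧ o' = o)
      (fun j σ' _ _ hI => ⟨hI.1, hI.2.1, hm⟩)
      (by
        rintro j hj σ' h' o' ⟨c1, c2, c3, c4, c5, rfl⟩
        have hv' : ∀ i < d + 1, Function.update v d j i =
            σ' (Function.update r d (t + 1) i) := by
          intro i hi
          by_cases hid : i = d
          · simp [hid, c1]
          · have hid' : i < d := by omega
            have hrt := hr i hid'
            simp [hid, c4 _ hrt, a₃ _ hrt, a₂ _ hrt, a₁ _ hrt, hv i hid']
        obtain ⟨σ₅, h₅, ex₁, d1, d2, d3⟩ := hq x k hk σ' h' o' (Function.update v d j) c5 hv'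
        have hcnt : Nat.count (fun j => P x (Function.update v d j)) j ≤ j :=
          Nat.count_le _
        obtain ⟨σ₆, h₆, ex₂, g1, g2, g3⟩ : Yields x k (ifZero (t + 3) skip (inc (t + 2)))
            σ₅ h₅ o' (t + 2) o' fun τ => τ (t + 2) =
              Nat.count (fun j => P x (Function.update v d j)) (j + 1) := by
          by_cases hx : P x (Function.update v d j)
          · obtain ⟨σ₆, h₆, e, g1, g2, rfl⟩ := yields_inc hk h₅ o' d2 (r := t + 2) (t := t + 2)
              le_rfl (by rw [d1 _ (by omega), c3]; omega)
            refine ⟨_, h₆, exec_ifZero hk (by simp [d3, hx]) (fun _ => e), g1, g2, ?_⟩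
            simp [Nat.count_succ, hx, d1, c3]
          · obtain ⟨σ₆, h₆, e, g1, g2, rfl⟩ := yields_skip (x := x) (k := k) h₅ o' d2 (t + 2)
            refine ⟨_, h₆, exec_ifZero hk (fun _ => e) (by simp [d3, hx]), g1, g2, ?_⟩
            simp [Nat.count_succ, hx, d1, c3]
        have hj1 : σ₆ (t + 1) = j := by rw [g1 _ (by omega), d1 _ (by omega), c1]
        obtain ⟨σ₇, h₇, ex₃, k1, k2, rfl⟩ := yields_inc hk h₆ o' g2 (r := t + 1) (t := t + 1)
          le_rfl (by omega)
        refine ⟨_, h₇, o', .seq ex₁ (.seq ex₂ ex₃), by simp [hj1], ?_, by simpa using g3, ?_, k2, rfl⟩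
        · rw [k1 _ (by omega), g1 _ (by omega), d1 _ (by omega), c2]
        · intro i hi
          rw [k1 _ (by omega), g1 _ (by omega), d1 _ (by omega), c4 i hi])
      (σ := σ₃) (h := h₃) (o := o)
      ⟨by simp [e₃, e₂], by simp [e₃, e₂, e₁], by simp [e₃], fun _ _ => rfl, hσ₃, rfl⟩
    obtain ⟨σ₅, h₅, ex', d1, d2, rfl⟩ := yields_copy hk h₄ o₄ b5 (s := t + 2) (r := t) (t := t)
      (by omega) le_rfl
    refine ⟨_, h₅, .seq ex ex', fun i hi => ?_, d2, by simp [b3]⟩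
    rw [d1 i hi, b4 i hi]

theorem Emit.nil {d : ℕ} : Emit (A := A) d fun _ _ => [] where
  indep _ _ _ _ := rfl
  prog _ t _ := ⟨skip, fun x k _ σ h o _ hσ _ => by
    obtain ⟨σ', h', e, a, b, c⟩ := yields_skip (x := x) (k := k) h o hσ t
    exact ⟨σ', h', by simpa using e, a, b, trivial⟩⟩

theorem Emit.symbol {d : ℕ} (s : A) : Emit d fun _ _ => [s] where
  indep _ _ _ _ := rfl
  prog _ _ _ := ⟨.emit s, fun _ _ _ σ h o _ hσ _ =>
    ⟨σ, h, Exec.emit s (embed σ h o), fun _ _ => rfl, hσ, trivial⟩⟩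

theorem Emit.append {d : ℕ} {f g : List A → (ℕ → ℕ) → List A} (hf : Emit d f) (hg : Emit d g) :
    Emit d fun x v => f x v ++ g x v where
  indep x v v' h := by rw [hf.indep x v v' h, hg.indep x v v' h]
  prog r t hr := by
    obtain ⟨p, hp⟩ := hf.prog r t hr
    obtain ⟨q, hq⟩ := hg.prog r t hr
    refine ⟨.seq p q, fun x k hk σ h o v hσ hv => (hp x k hk σ h o v hσ hv).seq le_rfl ?_⟩
    rintro σ' h' a hσ' -
    rw [← List.append_assoc]
    exact hq x k hk σ' h' _ v hσ' fun i hi => by rw [a _ (hr i hi), hv i hi]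

open Classical in
theorem Emit.ite {d : ℕ} {P : List A → (ℕ → ℕ) → Prop} {f g : List A → (ℕ → ℕ) → List A}
    (hP : Pred d P) (hf : Emit d f) (hg : Emit d g) :
    Emit d fun x v => if P x v then f x v else g x v where
  indep x v v' h := by
    have := hP.indep x v v' h
    rw [hf.indep x v v' h, hg.indep x v v' h]
    by_cases h1 : P x v <;> by_cases h2 : P x v' <;> simp_all
  prog r t hr := by
    obtain ⟨p, hp⟩ := hP.prog r t hr
    obtain ⟨q, hq⟩ := hf.prog r t hr
    obtain ⟨q', hq'⟩ := hg.prog r t hr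
    refine ⟨.seq p (ifZero t q' q), fun x k hk σ h o v hσ hv => ?_⟩
    refine (hp x k hk σ h o v hσ hv).seq le_rfl ?_
    rintro σ' h' ha hσ' ht
    have hv' : ∀ i < d, v i = σ' (r i) := fun i hi => by rw [ha _ (hr i hi), hv i hi]
    by_cases hx : P x v
    · obtain ⟨σ'', h'', e, a, b, c⟩ := hq x k hk σ' h' o v hσ' hv'
      exact ⟨σ'', h'', exec_ifZero hk (by simp [ht, hx]) (fun _ => by simpa [hx] using e), a, b,
        trivial⟩
    · obtain ⟨σ'', h'', e, a, b, c⟩ := hq' x k hk σ' h' o v hσ' hv'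
      exact ⟨σ'', h'', exec_ifZero hk (fun _ => by simpa [hx] using e) (by simp [ht, hx]), a, b,
        trivial⟩

/-- Writing in a bounded loop. -/
theorem Emit.loop {d : ℕ} {b : List A → (ℕ → ℕ) → ℕ} {f : List A → (ℕ → ℕ) → List A}
    (hb : Num d b) (hf : Emit (d + 1) f) :
    Emit d fun x v => (List.range (b x v)).flatMap fun j => f x (Function.update v d j) where
  indep x v v' h := by
    rw [hb.indep x v v' h]
    congr 1
    funext j
    refine hf.indep x _ _ fun i hi => ?_
    by_cases hid : i = d
    · simp [hid]
    · simp [hid, h i (by omega)]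
  prog r t hr := by
    obtain ⟨p, hp⟩ := hb.prog r t hr
    obtain ⟨q, hq⟩ := hf.prog (Function.update r d (t + 1)) (t + 2) fun i hi => by
      by_cases hid : i = d
      · simp [hid]
      · have := hr i (by omega); simp [hid]; omega
    refine ⟨.seq p (.seq (clear (t + 1)) (untilEq (t + 1) t (.seq q (inc (t + 1))))),
      fun x k hk σ h o v hσ hv => ?_⟩
    refine (hp x k hk σ h o v hσ hv).seq le_rfl ?_
    rintro σ₁ h₁ a₁ hσ₁ e₁
    refine (yields_clear hk h₁ o hσ₁ (r := t + 1) (t := t) (by omega)).seq le_rfl ?_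
    rintro σ₂ h₂ a₂ hσ₂ e₂
    have hm : b x v ≤ x.length + 1 := e₁ ▸ hσ₁ t
    obtain ⟨σ₄, h₄, o₄, ex, b1, b2, b4, b5, rfl⟩ := exec_untilEq (x := x) hk
      (p := .seq q (inc (t + 1))) (i := t + 1) (b := t) (by omega) (m := b x v)
      (fun j σ' h' o' => σ' (t + 1) = j ∧ σ' t = b x v ∧ (∀ i < t, σ' i = σ₂ i) ∧
        (∀ i, σ' i ≤ x.length + 1) ∧
        o' = o ++ (List.range j).flatMap fun j => f x (Function.update v d j))
      (fun j σ' _ _ hI => ⟨hI.1, hI.2.1, hm⟩)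
      (by
        rintro j hj σ' h' _ ⟨c1, c2, c4, c5, rfl⟩
        have hv' : ∀ i < d + 1, Function.update v d j i =
            σ' (Function.update r d (t + 1) i) := by
          intro i hi
          by_cases hid : i = d
          · simp [hid, c1]
          · have hid' : i < d := by omega
            have hrt := hr i hid'
            simp [hid, c4 _ hrt, a₂ _ hrt, a₁ _ hrt, hv i hid']
        obtain ⟨σ₆, h₆, ex₁, d1, d2, d3⟩ := hq x k hk σ' h' (o ++ (List.range j).flatMap
          fun j => f x (Function.update v d j)) (Function.update v d j) c5 hv'
        have hj1 : σ₆ (t + 1) = j := by rw [d1 _ (by omega), c1]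
        obtain ⟨σ₇, h₇, ex₃, k1, k2, rfl⟩ := yields_inc hk h₆ _ d2 (r := t + 1) (t := t + 1)
          le_rfl (by omega)
        refine ⟨_, h₇, _, .seq ex₁ ex₃, by simp [hj1], ?_, ?_, k2, ?_⟩
        · rw [k1 _ (by omega), d1 _ (by omega), c2]
        · intro i hi
          rw [k1 _ (by omega), d1 _ (by omega), c4 i hi]
        · simp [List.range_succ])
      (σ := σ₂) (h := h₂) (o := o)
      ⟨by simp [e₂], by simp [e₂, e₁], fun _ _ => rfl, hσ₂, by simp⟩
    exact ⟨_, h₄, ex, b4, b5, trivial⟩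

/-- For positive `n`, `n + 2 ≤ 4 * n`, so numbers up to `n + 1` have at most `Nat.log 2 n + 2`
digits. The factor `4` also covers `n = 0` and the head position behind the last digit. -/
theorem fits_log (n : ℕ) : Fits (n + 1) (4 * (Nat.log 2 n + 1)) := by
  intro m hm
  have h1 := length_digits_le m
  have h2 : Nat.log 2 (m + 1) ≤ Nat.log 2 n + 2 := by
    rcases Nat.eq_zero_or_pos n with rfl | hn
    · have : Nat.log 2 (m + 1) ≤ Nat.log 2 2 := Nat.log_mono_right (by omega)
      have e : Nat.log 2 2 = 1 := by norm_num
      omega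
    · have : Nat.log 2 (m + 1) ≤ Nat.log 2 (n * 2 * 2) := Nat.log_mono_right (by omega)
      rw [Nat.log_mul_base (by norm_num) (by omega), Nat.log_mul_base (by norm_num) (by omega)] at this
      omega
  omega

/-- A word that can be written in logarithmic space is the output of a logspace machine. -/
theorem Emit.machine {f : List A → (ℕ → ℕ) → List A} (hf : Emit 0 f) :
    ∃ (M : TuringMachine A A) (K : ℕ), ∀ x, M.Outputs x (f x fun _ => 0) ∧
      M.UsesSpace x (K * (Nat.log 2 x.length + 1)) := by
  obtain ⟨p, hp⟩ := hf.prog (fun _ => 0) 0 (by simp)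
  refine ⟨p.machine, 4, fun x => ?_⟩
  obtain ⟨σ', h', e, -⟩ := hp x _ (fits_log x.length) (fun _ => 0) 0 [] (fun _ => 0) (by simp)
    (by simp)
  have hi : (embed (fun _ => 0) 0 [] : Tapes A) = Tapes.init := by
    simp only [embed, Tapes.init, digits_zero]
    congr
    funext r i
    cases i <;> rfl
  rw [hi] at e
  simpa [embed] using e.machine

end Logspace

end PathCheck

namespace PathCheck

/-! ## Evaluation of transducer circuits on constant inputs -/

section Evaluation

variable {G : Type*} [Finite G] (T : Transducer G) {m : ℕ} (s : Fin m → Bool)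
  (h : (constTransducer s).outputs.length = T.inputs.length)

theorem evalLabel_inl (i : Fin m) :
    ((constTransducer s).comp T h).evalLabel (.inl i) = .const (s i) := by
  rw [Circuit.evalLabel_eq]
  rfl

/-- Inputs do not repeat, so `idxOf` finds the `k`-th input gate at index `k`. -/
theorem evalLabel_input (k : ℕ) (hk : k < T.inputs.length) (hm : k < m) :
    ((constTransducer s).comp T h).evalLabel (.inr T.inputs[k]) = .const (s ⟨k, hm⟩) := by
  have hl : ((constTransducer s).comp T h).label (.inr T.inputs[k]) = .id (.inl ⟨k, hm⟩) := by
    have e : ((constTransducer s).comp T h).label (.inr T.inputs[k]) =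
      compLabel (constTransducer s) T h (.inr T.inputs[k]) := rfl
    rw [e, compLabel, dif_pos (List.getElem_mem hk)]
    congr 2
    have : (constTransducer s).outputs = List.finRange m := rfl
    simp only [this, List.getElem_finRange]
    classical
    ext
    rw [Fin.val_cast]
    exact T.inputs_nodup.idxOf_getElem k hk
  rw [Circuit.evalLabel_eq, hl]
  simp only [evalLabel_inl, evalId]

variable {T}

theorem comp_label_inr {G : Type*} {T : Transducer G}
    (h : (constTransducer s).outputs.length = T.inputs.length) {g : G} (hg : T.label g ≠ .var) :
    ((constTransducer s).comp T h).label (.inr g) = (T.label g).map .inr :=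
  compLabel_inr_of_notMem _ _ h fun hm => hg ((T.mem_inputs g).mp hm)

theorem evalLabel_const {g : G} {b : Bool} (hg : T.label g = .const b) :
    ((constTransducer s).comp T h).evalLabel (.inr g) = .const b := by
  rw [Circuit.evalLabel_eq, comp_label_inr _ _ (by simp [hg]), hg]
  rfl

theorem evalLabel_id {g g' : G} {b : Bool} (hg : T.label g = .id g')
    (hb : ((constTransducer s).comp T h).evalLabel (.inr g') = .const b) :
    ((constTransducer s).comp T h).evalLabel (.inr g) = .const b := by
  rw [Circuit.evalLabel_eq, comp_label_inr _ _ (by simp [hg]), hg]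
  simp only [GateLabel.map, hb, evalId]

theorem evalLabel_and {g l r : G} {b c : Bool} (hg : T.label g = .and l r)
    (hb : ((constTransducer s).comp T h).evalLabel (.inr l) = .const b)
    (hc : ((constTransducer s).comp T h).evalLabel (.inr r) = .const c) :
    ((constTransducer s).comp T h).evalLabel (.inr g) = .const (b && c) := by
  rw [Circuit.evalLabel_eq, comp_label_inr _ _ (by simp [hg]), hg]
  simp only [GateLabel.map, hb, hc]
  cases b <;> cases c <;> rfl

theorem evalLabel_or {g l r : G} {b c : Bool} (hg : T.label g = .or l r)
    (hb : ((constTransducer s).comp T h).evalLabel (.inr l) = .const b)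
    (hc : ((constTransducer s).comp T h).evalLabel (.inr r) = .const c) :
    ((constTransducer s).comp T h).evalLabel (.inr g) = .const (b || c) := by
  rw [Circuit.evalLabel_eq, comp_label_inr _ _ (by simp [hg]), hg]
  simp only [GateLabel.map, hb, hc]
  cases b <;> cases c <;> rfl

end Evaluation

/-! ## Grid circuits -/

/-- The position after `i`, or before `i` in case of `past`. -/
def neighbor {n : ℕ} (past : Bool) (i : Fin n) : Option (Fin n) :=
  if past then (if 0 < (i : ℕ) then some ⟨i - 1, by omega⟩ else none)
  else if h : (i : ℕ) + 1 < n then some ⟨i + 1, h⟩ else none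

theorem neighbor_eq_some {n : ℕ} {past : Bool} {i j : Fin n} :
    neighbor past i = some j ↔ if past then (j : ℕ) + 1 = i else (i : ℕ) + 1 = j := by
  cases past
  · by_cases h : (i : ℕ) + 1 < n
    · simp [neighbor, h, Fin.ext_iff]
    · simp [neighbor, h]
      omega
  · by_cases h : 0 < (i : ℕ)
    · simp [neighbor, h, Fin.ext_iff]
      omega
    · simp [neighbor, h]
      omega

/-- The parameters of a grid circuit with `n` columns. The lowest row consists of the inputs. A gate
in a higher row refers to the gate below it or to the neighbor of the gate below it (or to both,
where `mask` holds). There is a constant gate for each column. In each column, the output is the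
constant gate or the topmost gate of the grid. -/
structure GridSpec (n : ℕ) where
  rows : ℕ
  past : Bool
  diag : Bool
  conj : Bool
  mask : Fin n → Bool
  useConst : Fin n → Bool
  value : Fin n → Bool
  rows_pos : ∀ i, useConst i = false → 0 < rows

namespace GridSpec

variable {n : ℕ} (S : GridSpec n)

/-- The coordinates of the gates. The last row contains the constant gates. -/
abbrev Coord : Type := Fin (S.rows + 1) × Fin n

/-- The label of a gate above the row `r`. -/
def cell (r : Fin (S.rows + 1)) (i : Fin n) : GateLabel S.Coord :=
  match neighbor S.past i with
  | none => .id (r, i)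
  | some j =>
    if S.diag then .id (r, j)
    else if S.mask i then (if S.conj then .and (r, i) (r, j) else .or (r, i) (r, j))
    else .id (r, i)

/-- The gate labels in terms of coordinates. -/
def gridLabel : S.Coord → GateLabel S.Coord
  | (d, i) =>
    if (d : ℕ) = S.rows then .const (S.value i)
    else if (d : ℕ) = 0 then .var
    else S.cell ⟨d - 1, by omega⟩ i

theorem refers_cell {r : Fin (S.rows + 1)} {i : Fin n} {c : S.Coord}
    (h : (S.cell r i).Refers c) : c.1 = r ∧ (c.2 = i ∨ neighbor S.past i = some c.2) := by
  unfold cell at h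
  split at h
  · cases h; simp
  · rename_i j hj
    split at h
    · cases h; simp [hj]
    · split at h
      · split at h
        · rcases h with rfl | rfl <;> simp [hj]
        · rcases h with rfl | rfl <;> simp [hj]
      · cases h; simp

/-- Dependencies go down by exactly one row and never touch the row of constants. Acyclicity, being
evaluated and the planar drawing all rest on this. -/
theorem refers_gridLabel {a b : S.Coord} (h : (S.gridLabel a).Refers b) :
    (b.1 : ℕ) + 1 = a.1 ∧ (a.1 : ℕ) < S.rows ∧
      (b.2 = a.2 ∨ neighbor S.past a.2 = some b.2) := by
  obtain ⟨d, i⟩ := a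
  simp only [gridLabel] at h
  split at h
  · exact h.elim
  · split at h
    · exact h.elim
    · obtain ⟨h1, h2⟩ := S.refers_cell h
      refine ⟨?_, by simp; omega, h2⟩
      rw [h1]; simp; omega

/-- The number of the gate with the given coordinates. -/
abbrev number : S.Coord ≃ Fin ((S.rows + 1) * n) := finProdFinEquiv

theorem _root_.PathCheck.GateLabel.refers_map_equiv {G H : Type*} (e : G ≃ H) (L : GateLabel G)
    (x : H) : (L.map e).Refers x ↔ L.Refers (e.symm x) := by
  cases L <;> simp [GateLabel.map, GateLabel.Refers, Equiv.symm_apply_eq]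

/-- The gate labels. -/
def numberedLabel (g : Fin ((S.rows + 1) * n)) : GateLabel (Fin ((S.rows + 1) * n)) :=
  (S.gridLabel (S.number.symm g)).map S.number

theorem refers_numberedLabel {a b : Fin ((S.rows + 1) * n)} (h : (S.numberedLabel a).Refers b) :
    (S.gridLabel (S.number.symm a)).Refers (S.number.symm b) :=
  (GateLabel.refers_map_equiv _ _ _).mp h

/-- The coordinates of the output gate of a column. -/
def outCoord (i : Fin n) : S.Coord :=
  if S.useConst i then (Fin.last _, i) else (⟨S.rows - 1, by omega⟩, i)

theorem outCoord_snd (i : Fin n) : (S.outCoord i).2 = i := by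
  unfold outCoord; split <;> rfl

/-- The grid circuit. -/
def transducer : Transducer (Fin ((S.rows + 1) * n)) where
  label := S.numberedLabel
  acyclic g h := by
    have : ∀ a b, Relation.TransGen (fun a b => (S.numberedLabel a).Refers b) a b →
        (S.number.symm b).1 < (S.number.symm a).1 := by
      intro a b hab
      induction hab with
      | single h =>
        have := (S.refers_gridLabel (S.refers_numberedLabel h)).1
        rw [Fin.lt_def]; omega
      | tail _ h ih =>
        have := (S.refers_gridLabel (S.refers_numberedLabel h)).1
        rw [Fin.lt_def] at ih ⊢; omega
    exact lt_irrefl _ (this g g h)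
  inputs := if S.rows = 0 then [] else (List.finRange n).map fun i => S.number (0, i)
  inputs_nodup := by
    split
    · exact List.nodup_nil
    · exact (List.nodup_finRange n).map fun i j h => (Prod.ext_iff.mp (S.number.injective h)).2
  mem_inputs g := by
    obtain ⟨⟨d, i⟩, rfl⟩ := S.number.surjective g
    simp only [numberedLabel, Equiv.symm_apply_apply, GateLabel.map_eq_var, gridLabel]
    by_cases h0 : S.rows = 0
    · have : (d : ℕ) = S.rows := by omega
      simp [h0, this]
    · simp only [h0, if_false, List.mem_map, List.mem_finRange, true_and,
        EmbeddingLike.apply_eq_iff_eq, Prod.mk.injEq]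
      by_cases hd : (d : ℕ) = S.rows
      · simp only [hd, if_true, reduceCtorEq, iff_false]
        rintro ⟨_, rfl, -⟩
        exact h0 (by simpa using hd.symm)
      · by_cases hd0 : (d : ℕ) = 0
        · simp [hd0, Ne.symm h0, Fin.ext_iff]
        · simp only [hd, hd0, if_false]
          constructor
          · rintro ⟨_, rfl, -⟩; simp at hd0
          · intro h
            unfold cell at h
            split at h
            · cases h
            · split at h
              · cases h
              · split at h
                · split at h <;> cases h
                · cases h
  outputs := (List.finRange n).map fun i => S.number (S.outCoord i)
  outputs_nodup := by
    refine (List.nodup_finRange n).map fun i j h => ?_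
    have := (Prod.ext_iff.mp (S.number.injective h)).2
    rwa [outCoord_snd, outCoord_snd] at this

theorem transducer_label (c : S.Coord) :
    S.transducer.label (S.number c) = (S.gridLabel c).map S.number := by
  change S.numberedLabel _ = _
  rw [numberedLabel, Equiv.symm_apply_apply]

theorem refers_of_dDep {a b : Fin ((S.rows + 1) * n)} (h : S.transducer.DDep a b) :
    ((S.number.symm b).1 : ℕ) + 1 = (S.number.symm a).1 ∧
      ((S.number.symm a).1 : ℕ) < S.rows ∧
      ((S.number.symm b).2 = (S.number.symm a).2 ∨
        neighbor S.past (S.number.symm a).2 = some (S.number.symm b).2) :=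
  S.refers_gridLabel (S.refers_numberedLabel h)

/-- A gate that another gate refers to lies below the row of constants, and its label is not a
constant. -/
theorem isEvaluated : S.transducer.IsEvaluated := by
  intro g b hg a ha
  obtain ⟨c, -, hc⟩ := Relation.TransGen.tail'_iff.mp ha
  have h := S.refers_of_dDep hc
  obtain ⟨⟨d, i⟩, rfl⟩ := S.number.surjective g
  simp only [Equiv.symm_apply_apply] at h
  rw [transducer_label] at hg
  simp only [gridLabel] at hg
  rw [if_neg (by omega)] at hg
  split at hg
  · simp [GateLabel.map] at hg
  · unfold cell at hg
    split at hg
    · cases hg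
    · split at hg
      · cases hg
      · split at hg
        · split at hg <;> cases hg
        · cases hg

/-- The value of the grid gate in row `d` and column `i`. -/
def gridValue (s : Fin n → Bool) : ℕ → Fin n → Bool
  | 0, i => s i
  | d + 1, i =>
    match neighbor S.past i with
    | none => gridValue s d i
    | some j =>
      if S.diag then gridValue s d j
      else if S.mask i then
        (if S.conj then gridValue s d i && gridValue s d j else gridValue s d i || gridValue s d j)
      else gridValue s d i

theorem evalLabel_value {m : ℕ} (s : Fin m → Bool)
    (h : (constTransducer s).outputs.length = S.transducer.inputs.length) (i : Fin n) :
    ((constTransducer s).comp S.transducer h).evalLabel (.inr (S.number (Fin.last _, i))) =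
      .const (S.value i) := by
  apply evalLabel_const
  rw [transducer_label]
  simp [gridLabel, GateLabel.map]

theorem evalLabel_grid (s : Fin n → Bool)
    (h : (constTransducer s).outputs.length = S.transducer.inputs.length) (d : ℕ)
    (hd : d < S.rows) (i : Fin n) :
    ((constTransducer s).comp S.transducer h).evalLabel
      (.inr (S.number (⟨d, by omega⟩, i))) = .const (S.gridValue s d i) := by
  induction d generalizing i with
  | zero =>
    have hr : S.rows ≠ 0 := by omega
    have hin : S.transducer.inputs = (List.finRange n).map fun i => S.number (0, i) := if_neg hr
    have hi : (i : ℕ) < S.transducer.inputs.length := by simp [hin]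
    have := evalLabel_input S.transducer s h i hi i.2
    simp only [hin, List.getElem_map, List.getElem_finRange] at this
    exact this
  | succ d ih =>
    have hl : S.transducer.label (S.number (⟨d + 1, by omega⟩, i)) =
        (S.cell ⟨d, by omega⟩ i).map S.number := by
      rw [transducer_label]
      simp [gridLabel, hd.ne]
    have ih' := ih (by omega)
    unfold cell at hl
    rw [gridValue]
    cases hn : neighbor S.past i with
    | none =>
      rw [hn] at hl
      exact evalLabel_id s h hl (ih' i)
    | some j =>
      rw [hn] at hl
      dsimp only at hl ⊢
      split_ifs at hl ⊢
      · exact evalLabel_id s h hl (ih' j)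
      · exact evalLabel_and s h hl (ih' i) (ih' j)
      · exact evalLabel_or s h hl (ih' i) (ih' j)
      · exact evalLabel_id s h hl (ih' i)

theorem maps_of_rows_ne_zero (hr : S.rows ≠ 0) (s t : Fin n → Bool)
    (ht : ∀ i, t i = if S.useConst i then S.value i else S.gridValue s (S.rows - 1) i) :
    S.transducer.Maps s t := by
  have h : (constTransducer s).outputs.length = S.transducer.inputs.length := by
    have hin : S.transducer.inputs = (List.finRange n).map fun i => S.number (0, i) := if_neg hr
    simp [hin, constTransducer]
  refine ⟨h, ?_⟩
  have ho : ((constTransducer s).comp S.transducer h).outputs =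
      ((List.finRange n).map fun i => S.number (S.outCoord i)).map Sum.inr := rfl
  rw [ho, List.map_map, List.map_map, List.ofFn_eq_map]
  refine List.map_congr_left fun i _ => ?_
  simp only [Function.comp_apply, ht, outCoord]
  split
  · exact S.evalLabel_value s h i
  · exact S.evalLabel_grid s h _ (by omega) i

theorem maps_of_rows_eq_zero (hr : S.rows = 0) (s : Fin 0 → Bool) :
    S.transducer.Maps s S.value := by
  have h : (constTransducer s).outputs.length = S.transducer.inputs.length := by
    have hin : S.transducer.inputs = [] := if_pos hr
    simp [hin, constTransducer]
  refine ⟨h, ?_⟩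
  have ho : ((constTransducer s).comp S.transducer h).outputs =
      ((List.finRange n).map fun i => S.number (S.outCoord i)).map Sum.inr := rfl
  rw [ho, List.map_map, List.map_map, List.ofFn_eq_map]
  refine List.map_congr_left fun i _ => ?_
  -- Without rows there is no grid gate that could be an output.
  have hu : S.useConst i = true := by
    by_contra hu
    have := S.rows_pos i (by simpa using hu)
    omega
  simp only [Function.comp_apply, outCoord, hu, if_true]
  exact S.evalLabel_value s h i

end GridSpec

end PathCheck

namespace PathCheck

/-! ## Drawings in a horizontal strip -/

namespace PlanarEmbedding

variable {V : Type*} {E : V → V → Prop} (D : PlanarEmbedding E)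

theorem pos_mem_carrier (v : V) : D.pos v ∈ D.carrier := Or.inl ⟨v, rfl⟩

/-- A convex set is connected, so it lies in a single component of the complement, which is
unbounded with it. -/
theorem subset_outerFace {L : Set ℂ} (hL : Convex ℝ L) (hd : L ⊆ D.carrierᶜ)
    (hb : ∀ r : ℝ, ∃ z ∈ L, r < ‖z‖) : L ⊆ D.outerFace := by
  intro z hz
  refine ⟨hd hz, fun hbd => ?_⟩
  have hsub := hL.isPreconnected.subset_connectedComponentIn hz hd
  obtain ⟨r, hr⟩ := (hbd.subset hsub).exists_norm_le
  obtain ⟨w, hw, hlt⟩ := hb r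
  exact absurd (hr w hw) (not_le.mpr hlt)

variable {H : ℝ} (hc : ∀ z ∈ D.carrier, 0 ≤ z.im ∧ z.im ≤ H)

include hc

theorem below_subset_outerFace : {z : ℂ | z.im < 0} ⊆ D.outerFace := by
  refine D.subset_outerFace (convex_halfSpace_im_lt 0) ?_ fun r => ?_
  · intro z hz hzc
    exact absurd (hc z hzc).1 (not_le.mpr hz)
  · refine ⟨⟨0, -(|r| + 1)⟩, ?_, ?_⟩
    · simp only [Set.mem_ofPred_eq]
      have := abs_nonneg r
      linarith
    · refine lt_of_lt_of_le ?_ (Complex.abs_im_le_norm _)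
      have := le_abs_self r
      have := abs_nonneg r
      simp only
      rw [abs_neg, abs_of_pos (by linarith)]
      linarith

theorem above_subset_outerFace : {z : ℂ | H < z.im} ⊆ D.outerFace := by
  refine D.subset_outerFace (convex_halfSpace_im_gt H) ?_ fun r => ?_
  · intro z hz hzc
    exact absurd (hc z hzc).2 (not_le.mpr hz)
  · refine ⟨⟨0, |H| + |r| + 1⟩, ?_, ?_⟩
    · simp only [Set.mem_ofPred_eq]
      have := abs_nonneg r
      have := le_abs_self H
      linarith
    · refine lt_of_lt_of_le ?_ (Complex.abs_im_le_norm _)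
      have := le_abs_self r
      have := abs_nonneg H
      have := abs_nonneg r
      simp only
      rw [abs_of_pos (by linarith)]
      linarith

/-- Points of the bottom line are limits of points in the open half-plane below the drawing. -/
theorem onOuterFace_of_im_eq_zero {v : V} (hv : (D.pos v).im = 0) : D.OnOuterFace v := by
  refine closure_mono (D.below_subset_outerFace hc) ?_
  have : (D.pos v) ∈ {z : ℂ | z.im ≤ 0} := hv.le
  rwa [← Complex.closure_setOfPred_im_lt] at this

omit hc

end PlanarEmbedding

/-- The angle at which the vertical ray from a point `z` downwards or upwards meets the circle with
radius `R`. -/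
noncomputable def rayAngle (R : ℝ) (z : ℂ) (up : Bool) : ℝ :=
  2 * Real.pi + if up then Real.arccos (z.re / R) else -Real.arccos (z.re / R)

theorem div_mem_Ioo {R : ℝ} {z : ℂ} (hz : ‖z‖ < R) : z.re / R ∈ Set.Ioo (-1) 1 := by
  have hR : 0 < R := (norm_nonneg z).trans_lt hz
  have h := abs_lt.mp ((Complex.abs_re_le_norm z).trans_lt hz)
  constructor
  · rw [lt_div_iff₀ hR]; linarith
  · rw [div_lt_iff₀ hR]; linarith

/-- All angles lie in an open interval of length `2 * Real.pi`, so together they go around the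
circle less than once. -/
theorem rayAngle_mem_Ioo {R : ℝ} {z : ℂ} (hz : ‖z‖ < R) (up : Bool) :
    rayAngle R z up ∈ Set.Ioo Real.pi (3 * Real.pi) := by
  have h := div_mem_Ioo hz
  have h1 : 0 < Real.arccos (z.re / R) := Real.arccos_pos.mpr h.2
  have h2 : Real.arccos (z.re / R) < Real.pi := by
    rw [← Real.arccos_neg_one]
    exact Real.strictAntiOn_arccos (by simp) ⟨h.1.le, h.2.le⟩ h.1
  have := Real.pi_pos
  cases up <;> constructor <;> simp only [rayAngle, if_true, if_false, Bool.false_eq_true] <;> linarith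

/-- The end point of the ray. -/
noncomputable def rayEnd (R : ℝ) (z : ℂ) (up : Bool) : ℂ :=
  R * Complex.exp (rayAngle R z up * Complex.I)

theorem norm_rayEnd {R : ℝ} (hR : 0 ≤ R) (z : ℂ) (up : Bool) : ‖rayEnd R z up‖ = R := by
  rw [rayEnd, norm_mul, Complex.norm_exp_ofReal_mul_I, Complex.norm_real, mul_one,
    Real.norm_of_nonneg hR]

theorem rayEnd_re {R : ℝ} {z : ℂ} (hz : ‖z‖ < R) (up : Bool) : (rayEnd R z up).re = z.re := by
  have hR : 0 < R := (norm_nonneg z).trans_lt hz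
  have h := div_mem_Ioo hz
  rw [rayEnd, Complex.re_ofReal_mul, Complex.exp_ofReal_mul_I_re]
  have : Real.cos (rayAngle R z up) = z.re / R := by
    rw [rayAngle, add_comm, Real.cos_add_two_pi]
    cases up <;> simp [Real.cos_arccos h.1.le h.2.le]
  rw [this]
  field_simp

/-- The end point has the same real part as `z` but a larger norm, and its imaginary part is
positive. -/
theorem rayEnd_im_true {R : ℝ} {z : ℂ} (hz : ‖z‖ < R) : z.im < (rayEnd R z true).im := by
  have hR : 0 < R := (norm_nonneg z).trans_lt hz
  have h := div_mem_Ioo hz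
  have h1 : 0 < (rayEnd R z true).im := by
    rw [rayEnd, Complex.im_ofReal_mul, Complex.exp_ofReal_mul_I_im, rayAngle, add_comm,
      Real.sin_add_two_pi]
    refine mul_pos hR (Real.sin_pos_of_pos_of_lt_pi ?_ ?_)
    · simpa using Real.arccos_pos.mpr h.2
    · have := (rayAngle_mem_Ioo hz true).2
      simp only [rayAngle, if_true] at this ⊢
      linarith
  have h2 : ‖rayEnd R z true‖ ^ 2 = R ^ 2 := by rw [norm_rayEnd hR.le]
  have h3 : ‖z‖ ^ 2 < R ^ 2 := by gcongr
  rw [Complex.sq_norm, Complex.normSq_apply] at h2 h3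
  rw [rayEnd_re hz] at h2
  exact lt_of_pow_lt_pow_left₀ 2 h1.le (by nlinarith)

theorem rayEnd_im_false {R : ℝ} {z : ℂ} (hz : ‖z‖ < R) : (rayEnd R z false).im < 0 := by
  have hR : 0 < R := (norm_nonneg z).trans_lt hz
  have h := div_mem_Ioo hz
  rw [rayEnd, Complex.im_ofReal_mul, Complex.exp_ofReal_mul_I_im, rayAngle, add_comm,
    Real.sin_add_two_pi]
  refine mul_neg_of_pos_of_neg hR ?_
  simp only [Bool.false_eq_true, if_false, Real.sin_neg, neg_lt_zero]
  refine Real.sin_pos_of_pos_of_lt_pi (Real.arccos_pos.mpr h.2) ?_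
  have := (rayAngle_mem_Ioo hz false).1
  simp only [rayAngle, Bool.false_eq_true, if_false] at this
  linarith

/-- Counter-clockwise, the lower half of the circle is passed from left to right and the upper half
from right to left. -/
theorem rayAngle_lt_of_re_lt {R : ℝ} {z w : ℂ} (hz : ‖z‖ < R) (hw : ‖w‖ < R) (h : z.re < w.re) :
    rayAngle R z false < rayAngle R w false ∧ rayAngle R w true < rayAngle R z true := by
  have hR : 0 < R := (norm_nonneg z).trans_lt hz
  have h1 := div_mem_Ioo hz
  have h2 := div_mem_Ioo hw
  have := Real.strictAntiOn_arccos ⟨h1.1.le, h1.2.le⟩ ⟨h2.1.le, h2.2.le⟩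
    (div_lt_div_of_pos_right h hR)
  simp only [rayAngle, if_true, Bool.false_eq_true, if_false]
  constructor <;> linarith

theorem rayAngle_false_lt_true {R : ℝ} {z w : ℂ} (hz : ‖z‖ < R) (hw : ‖w‖ < R) :
    rayAngle R z false < rayAngle R w true := by
  have h1 := Real.arccos_pos.mpr (div_mem_Ioo hz).2
  have h2 := Real.arccos_pos.mpr (div_mem_Ioo hw).2
  simp only [rayAngle, if_true, Bool.false_eq_true, if_false]
  linarith

theorem segment_re (a b : ℂ) (t : unitInterval) :
    (Path.segment a b t).re = a.re + t * (b.re - a.re) := by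
  simp [Path.segment, AffineMap.lineMap_apply]
  ring

theorem segment_im (a b : ℂ) (t : unitInterval) :
    (Path.segment a b t).im = a.im + t * (b.im - a.im) := by
  simp [Path.segment, AffineMap.lineMap_apply]
  ring

theorem norm_segment_lt {a b : ℂ} {R : ℝ} (ha : ‖a‖ < R) (hb : ‖b‖ ≤ R) {t : unitInterval}
    (ht : t ≠ 1) : ‖Path.segment a b t‖ < R := by
  have h1 : (t : ℝ) < 1 := lt_of_le_of_ne t.2.2 fun h => ht (Subtype.ext h)
  have h0 : (0 : ℝ) ≤ t := t.2.1
  have e : Path.segment a b t = (1 - (t : ℝ)) • a + (t : ℝ) • b := by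
    simp [Path.segment, AffineMap.lineMap_apply]
    ring
  calc ‖Path.segment a b t‖ ≤ ‖(1 - (t : ℝ)) • a‖ + ‖(t : ℝ) • b‖ := e ▸ norm_add_le _ _
    _ = (1 - t) * ‖a‖ + t * ‖b‖ := by
      rw [norm_smul, norm_smul, Real.norm_of_nonneg h0, Real.norm_of_nonneg (by linarith)]
    _ < R := by nlinarith

/-- Vertices at the bottom or at the top of a drawing appear on the outer face in the order of the
angles of their vertical rays. -/
theorem PlanarEmbedding.ccwOnOuterFace_of_rays {V : Type*} {E : V → V → Prop}
    (D : PlanarEmbedding E) {H R : ℝ} (hH : 0 ≤ H)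
    (hc : ∀ z ∈ D.carrier, 0 ≤ z.im ∧ z.im ≤ H) (hR : 0 < R) (hb : ∀ z ∈ D.carrier, ‖z‖ < R)
    (M : List (V × Bool)) (hM : ∀ q ∈ M, (D.pos q.1).im = if q.2 then H else 0)
    (hsort : M.Pairwise fun q q' => rayAngle R (D.pos q.1) q.2 < rayAngle R (D.pos q'.1) q'.2) :
    D.CcwOnOuterFace (M.map Prod.fst) := by
  have hlen : (M.map Prod.fst).length = M.length := List.length_map _
  let q : Fin (M.map Prod.fst).length → V × Bool := fun k => M.get (Fin.cast hlen k)
  have hq : ∀ k, (M.map Prod.fst).get k = (q k).1 := fun k => by simp [q]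
  have hqM : ∀ k, q k ∈ M := fun k => List.get_mem _ _
  have hn : ∀ k, ‖D.pos (q k).1‖ < R := fun k => hb _ (D.pos_mem_carrier _)
  have hmono : StrictMono fun k => rayAngle R (D.pos (q k).1) (q k).2 := by
    intro j k hjk
    exact List.pairwise_iff_get.mp hsort _ _ hjk
  have him : ∀ k t, t ≠ 0 →
      if (q k).2 then H < (Path.segment (D.pos (q k).1) (rayEnd R (D.pos (q k).1) (q k).2) t).im
      else (Path.segment (D.pos (q k).1) (rayEnd R (D.pos (q k).1) (q k).2) t).im < 0 := by
    intro k t ht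
    have ht0 : (0 : ℝ) < t := lt_of_le_of_ne t.2.1 fun h => ht (Subtype.ext h.symm)
    have h1 := hM _ (hqM k)
    rw [segment_im, h1]
    cases hup : (q k).2
    · have := rayEnd_im_false (hn k)
      simp only [Bool.false_eq_true, if_false]
      nlinarith
    · have := rayEnd_im_true (hn k)
      rw [h1, hup] at this
      simp only [if_true] at this ⊢
      nlinarith
  have him0 : ∀ k t, if (q k).2 then
        H ≤ (Path.segment (D.pos (q k).1) (rayEnd R (D.pos (q k).1) (q k).2) t).im
      else (Path.segment (D.pos (q k).1) (rayEnd R (D.pos (q k).1) (q k).2) t).im ≤ 0 := by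
    intro k t
    by_cases ht : t = 0
    · subst ht
      have h1 := hM _ (hqM k)
      rw [Path.source, h1]
      cases (q k).2 <;> simp
    · have := him k t ht
      split_ifs at this ⊢ <;> exact this.le
  obtain ⟨γ, hγ⟩ : ∃ γ : ∀ k, Path (D.pos ((M.map Prod.fst).get k))
      (R * Complex.exp (rayAngle R (D.pos (q k).1) (q k).2 * Complex.I)),
      ∀ k t, γ k t = Path.segment (D.pos (q k).1) (rayEnd R (D.pos (q k).1) (q k).2) t :=
    ⟨fun k => (Path.segment (D.pos (q k).1) (rayEnd R (D.pos (q k).1) (q k).2)).cast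
      (by rw [hq]) rfl, fun _ _ => rfl⟩
  refine ⟨R, fun k => rayAngle R (D.pos (q k).1) (q k).2, γ, hR,
    fun z hz => by simpa using hb z hz, hmono, ?_, ?_, ?_, ?_, ?_⟩
  · intro j k
    have h1 := rayAngle_mem_Ioo (hn j) (q j).2
    have h2 := rayAngle_mem_Ioo (hn k) (q k).2
    dsimp only
    linarith [h1.1, h2.2]
  · intro k t u h
    rw [hγ, hγ] at h
    refine Path.segment_injective_of_ne ?_ h
    intro h
    have := norm_rayEnd hR.le (D.pos (q k).1) (q k).2
    rw [← h] at this
    exact (hn k).ne this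
  · intro k t ht
    have := him k t ht
    rw [hγ]
    split_ifs at this
    · exact D.above_subset_outerFace hc this
    · exact D.below_subset_outerFace hc this
  · intro k t ht
    rw [hγ, mem_ball_zero_iff]
    exact norm_segment_lt (hn k) (norm_rayEnd hR.le _ _).le ht
  · intro j k hjk t u h
    rw [hγ, hγ] at h
    have hre := congrArg Complex.re h
    rw [segment_re, segment_re, rayEnd_re (hn j), rayEnd_re (hn k)] at hre
    -- Vertical rays that meet have the same real part. If they point in the same direction, their
    -- angles agree, which is excluded. If they point in opposite directions, one stays at heights
    -- at most `0` and the other at heights at least `H`, both strictly so after the initial point.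
    have hre' : (D.pos (q j).1).re = (D.pos (q k).1).re := by linarith
    have hne : rayAngle R (D.pos (q j).1) (q j).2 ≠ rayAngle R (D.pos (q k).1) (q k).2 :=
      fun h => hjk (hmono.injective h)
    have a1 := him j t
    have a2 := him k u
    have b1 := him0 j t
    have b2 := him0 k u
    rw [h] at a1 b1
    by_cases hj : (q j).2 = (q k).2
    · rw [rayAngle, rayAngle, hj, hre'] at hne
      exact absurd rfl hne
    · have hcases : (q j).2 = true ∧ (q k).2 = false ∨ (q j).2 = false ∧ (q k).2 = true := by
        cases h1 : (q j).2 <;> cases h2 : (q k).2 <;> simp_all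
      rcases hcases with ⟨h1, h2⟩ | ⟨h1, h2⟩
      · rw [if_pos h1] at a1 b1
        rw [if_neg (by simp [h2])] at a2 b2
        constructor <;> by_contra h0
        · linarith [a1 h0]
        · linarith [a2 h0]
      · rw [if_neg (by simp [h1])] at a1 b1
        rw [if_pos h2] at a2 b2
        constructor <;> by_contra h0
        · linarith [a1 h0]
        · linarith [a2 h0]

end PathCheck

/-! ### Straight-line drawings of grid circuits -/

namespace PathCheck

/-- Used twice for the absence of crossings: interior points of edges do not have integral heights,
and edges of different slopes would meet at a non-integral distance of their columns. -/
theorem natCast_ne_add {m m' : ℕ} {t : ℝ} (h0 : 0 < t) (h1 : t < 1) : (m : ℝ) ≠ m' + t := by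
  intro h
  have a : (m' : ℝ) < m := by linarith
  have b : (m : ℝ) < m' + 1 := by linarith
  have a' : m' < m := by exact_mod_cast a
  have b' : m < m' + 1 := by exact_mod_cast b
  omega

namespace GridSpec

variable {n : ℕ} (S : GridSpec n)

/-- The height of a gate in the drawing. -/
def height (c : S.Coord) : ℕ := if (c.1 : ℕ) = S.rows then S.rows - 1 else c.1

/-- Twice the horizontal position of a gate in the drawing. -/
def abscissa (c : S.Coord) : ℕ := 2 * c.2 + if (c.1 : ℕ) = S.rows then 1 else 0

/-- The position of a gate in the drawing. -/
noncomputable def gridPos (c : S.Coord) : ℂ := ⟨(S.abscissa c : ℝ) / 2, S.height c⟩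

/-- Constants are drawn halfway between the columns, so the parity of the doubled abscissa tells
them from grid gates. -/
theorem gridPos_injective : Function.Injective S.gridPos := by
  intro a b h
  have h1 := congrArg Complex.re h
  have h2 := congrArg Complex.im h
  simp only [gridPos] at h1 h2
  have h1' : S.abscissa a = S.abscissa b := by
    have : (S.abscissa a : ℝ) = S.abscissa b := by linarith
    exact_mod_cast this
  have h2' : S.height a = S.height b := by exact_mod_cast h2
  have ha := a.1.2
  have hb := b.1.2
  simp only [abscissa, height] at h1' h2'
  refine Prod.ext (Fin.ext ?_) (Fin.ext ?_) <;> split_ifs at h1' h2' <;> omega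

theorem gridPos_bounds (c : S.Coord) :
    0 ≤ (S.gridPos c).re ∧ (S.gridPos c).re ≤ n ∧ 0 ≤ (S.gridPos c).im ∧
      (S.gridPos c).im ≤ (S.rows - 1 : ℕ) := by
  have h1 := c.1.2
  have h2 := c.2.2
  refine ⟨?_, ?_, ?_, ?_⟩
  · simp only [gridPos]; positivity
  · simp only [gridPos]
    have : S.abscissa c ≤ 2 * n := by simp only [abscissa]; split_ifs <;> omega
    have : (S.abscissa c : ℝ) ≤ 2 * n := by exact_mod_cast this
    linarith
  · simp only [gridPos]; positivity
  · simp only [gridPos]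
    have : S.height c ≤ S.rows - 1 := by simp only [height]; split_ifs <;> omega
    exact_mod_cast this

/-- The coordinates of an edge: it goes down by one row, and by at most one column in the direction
that is given by `past`. -/
theorem edge_coordinates {a b : Fin ((S.rows + 1) * n)} (h : S.transducer.DDep a b) :
    ∃ d i : ℕ, ((S.number.symm a).1 : ℕ) = d + 1 ∧ ((S.number.symm a).2 : ℕ) = i ∧
      S.gridPos (S.number.symm a) = ⟨i, d + 1⟩ ∧ ((S.number.symm b).1 : ℕ) = d ∧
      ∃ e : ℝ, S.gridPos (S.number.symm b) = ⟨i + e, d⟩ ∧ ((S.number.symm b).2 : ℕ) = i + e ∧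
        (e = 0 ∨ e = if S.past then -1 else 1) := by
  obtain ⟨h1, h2, h3⟩ := S.refers_of_dDep h
  generalize S.number.symm a = a at *
  generalize S.number.symm b = b at *
  have ha : (a.1 : ℕ) ≠ S.rows := by omega
  have hb : (b.1 : ℕ) ≠ S.rows := by omega
  refine ⟨b.1, a.2, h1.symm, rfl, ?_, rfl, (b.2 : ℝ) - (a.2 : ℝ), ?_, by ring, ?_⟩
  · have h1' : ((a.1 : ℕ) : ℝ) = (b.1 : ℕ) + 1 := by exact_mod_cast h1.symm
    simp [gridPos, abscissa, height, ha, h1']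
  · simp [gridPos, abscissa, height, hb]
  · rcases h3 with h3 | h3
    · left; rw [h3]; ring
    · right
      rw [neighbor_eq_some] at h3
      split_ifs at h3 ⊢
      · have : ((b.2 : ℕ) : ℝ) + 1 = (a.2 : ℕ) := by exact_mod_cast h3
        linarith
      · have : ((a.2 : ℕ) : ℝ) + 1 = (b.2 : ℕ) := by exact_mod_cast h3
        linarith

/-- The straight-line drawing of the grid circuit. -/
noncomputable def embedding : PlanarEmbedding S.transducer.DDep where
  pos g := S.gridPos (S.number.symm g)
  pos_injective := S.gridPos_injective.comp S.number.symm.injective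
  arc a b _ := Path.segment _ _
  arc_injective a b h := by
    obtain ⟨d, i, -, -, ha, -, e, hb, -⟩ := S.edge_coordinates h
    refine Path.segment_injective_of_ne fun h => ?_
    have := congrArg Complex.im (ha.symm.trans (h.trans hb))
    simp at this
  arc_vertex a b h t v hv := by
    obtain ⟨d, i, -, -, ha, -, e, hb, -⟩ := S.edge_coordinates h
    have him := congrArg Complex.im hv
    rw [segment_im, ha, hb] at him
    simp only [gridPos] at him
    by_cases h0 : t = 0
    · subst h0
      rw [Path.source] at hv
      exact .inl ((S.gridPos_injective.comp S.number.symm.injective) hv).symm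
    by_cases h1 : t = 1
    · subst h1
      rw [Path.target] at hv
      exact .inr ((S.gridPos_injective.comp S.number.symm.injective) hv).symm
    have h0' : (0 : ℝ) < t := lt_of_le_of_ne t.2.1 fun h => h0 (Subtype.ext h.symm)
    have h1' : (t : ℝ) < 1 := lt_of_le_of_ne t.2.2 fun h => h1 (Subtype.ext h)
    -- The point has height `d + 1 - t` with `0 < t < 1`, whereas vertices have integral heights.
    refine absurd ?_ (natCast_ne_add (m := d + 1) (m' := S.height (S.number.symm v)) h0' h1')
    push_cast
    linarith
  arc_arc a b h a' b' h' t t' htt := by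
    by_cases h0 : t = 0
    · subst h0
      exact .inr ⟨a, Path.source _⟩
    by_cases h1 : t = 1
    · subst h1
      exact .inr ⟨b, Path.target _⟩
    left
    obtain ⟨d, i, ha1, ha2, ha, hb1, e, hb, hb2, he⟩ := S.edge_coordinates h
    obtain ⟨d', i', ha1', ha2', ha', hb1', e', hb', hb2', he'⟩ := S.edge_coordinates h'
    have him := congrArg Complex.im htt
    have hre := congrArg Complex.re htt
    rw [segment_im, segment_im, ha, hb, ha', hb'] at him
    rw [segment_re, segment_re, ha, hb, ha', hb'] at hre
    simp only at him hre
    have h0' : (0 : ℝ) < t := lt_of_le_of_ne t.2.1 fun h => h0 (Subtype.ext h.symm)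
    have h1' : (t : ℝ) < 1 := lt_of_le_of_ne t.2.2 fun h => h1 (Subtype.ext h)
    -- Heights strictly between `d` and `d + 1` occur only on edges that start in row `d + 1`.
    have hd : d = d' := by
      have hlt : (d : ℝ) < d' + 1 := by nlinarith [t'.2.1]
      have hle : (d' : ℝ) < d + 1 := by nlinarith [t'.2.2]
      have hlt' : d < d' + 1 := by exact_mod_cast hlt
      have hle' : d' < d + 1 := by exact_mod_cast hle
      omega
    subst hd
    have htt' : (t' : ℝ) = t := by linarith
    rw [htt'] at hre
    -- At their common height the edges have the abscissas `i + t * e` and `i' + t * e'`. Slanted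
    -- edges all lean to the same side, so `e ≠ e'` would make the integers `i` and `i'` differ by
    -- exactly `t`.
    have key : i = i' ∧ e = e' := by
      have hne : e ≠ e' → False := by
        intro hne
        have n1 := natCast_ne_add (m := i) (m' := i') h0' h1'
        have n2 := natCast_ne_add (m := i') (m' := i) h0' h1'
        split_ifs at he he'
        · rcases he with rfl | rfl <;> rcases he' with rfl | rfl
          · exact hne rfl
          · exact n2 (by linarith)
          · exact n1 (by linarith)
          · exact hne rfl
        · rcases he with rfl | rfl <;> rcases he' with rfl | rfl
          · exact hne rfl
          · exact n1 (by linarith)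
          · exact n2 (by linarith)
          · exact hne rfl
      have hee : e = e' := by by_contra h; exact hne h
      subst hee
      exact ⟨by have : (i : ℝ) = i' := by linarith
                exact_mod_cast this, rfl⟩
    obtain ⟨rfl, rfl⟩ := key
    constructor <;> apply S.number.symm.injective <;> refine Prod.ext (Fin.ext ?_) (Fin.ext ?_)
    · rw [ha1, ha1']
    · rw [ha2, ha2']
    · rw [hb1, hb1']
    · have : ((S.number.symm b).2 : ℝ) = (S.number.symm b').2 := by rw [hb2, hb2']
      exact_mod_cast this

theorem carrier_bounds (z : ℂ) (hz : z ∈ S.embedding.carrier) :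
    0 ≤ z.re ∧ z.re ≤ n ∧ 0 ≤ z.im ∧ z.im ≤ (S.rows - 1 : ℕ) := by
  rcases hz with ⟨v, rfl⟩ | ⟨a, b, h, t, rfl⟩
  · exact S.gridPos_bounds _
  · have h1 := S.gridPos_bounds (S.number.symm a)
    have h2 := S.gridPos_bounds (S.number.symm b)
    change 0 ≤ (Path.segment (S.gridPos (S.number.symm a)) (S.gridPos (S.number.symm b)) t).re ∧
      (Path.segment (S.gridPos (S.number.symm a)) (S.gridPos (S.number.symm b)) t).re ≤ n ∧
      0 ≤ (Path.segment (S.gridPos (S.number.symm a)) (S.gridPos (S.number.symm b)) t).im ∧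
      (Path.segment (S.gridPos (S.number.symm a)) (S.gridPos (S.number.symm b)) t).im ≤ _
    rw [segment_re, segment_im]
    have t0 := t.2.1
    have t1 := t.2.2
    refine ⟨?_, ?_, ?_, ?_⟩ <;> nlinarith

/-- Constants are drawn on the level of the topmost grid row, so all outputs are at the top. For
`S.rows = 0` the truncated subtraction makes this level `0`. -/
theorem outCoord_height (i : Fin n) : S.height (S.outCoord i) = S.rows - 1 := by
  unfold outCoord
  split
  · simp [height]
  · rename_i h
    have := S.rows_pos i (by simpa using h)
    simp only [height]
    split_ifs <;> rfl

theorem abscissa_outCoord_lt {i j : Fin n} (h : i < j) :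
    S.abscissa (S.outCoord i) < S.abscissa (S.outCoord j) := by
  have : (i : ℕ) < j := h
  simp only [abscissa, outCoord_snd]
  split_ifs <;> omega

/-- Constants are sinks, so the sources are the inputs, which are at the bottom of the drawing.
Inputs get rays downwards and outputs get rays upwards. With a single row, both are at height `0`,
and a gate that is an input and an output has one ray in each direction. -/
theorem isOneInputFacePlanar : S.transducer.IsOneInputFacePlanar := by
  have hc : ∀ z ∈ S.embedding.carrier, 0 ≤ z.im ∧ z.im ≤ ((S.rows - 1 : ℕ) : ℝ) :=
    fun z hz => (S.carrier_bounds z hz).2.2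
  have hb : ∀ z ∈ S.embedding.carrier, ‖z‖ < n + S.rows + 1 := by
    intro z hz
    obtain ⟨h1, h2, h3, h4⟩ := S.carrier_bounds z hz
    have h5 : ((S.rows - 1 : ℕ) : ℝ) ≤ S.rows := by exact_mod_cast Nat.sub_le _ _
    have := Complex.norm_le_abs_re_add_abs_im z
    rw [abs_of_nonneg h1, abs_of_nonneg h3] at this
    linarith
  have hpos : ∀ c, S.embedding.pos (S.number c) = S.gridPos c := fun c => by
    change S.gridPos (S.number.symm (S.number c)) = _
    rw [Equiv.symm_apply_apply]
  have hn : ∀ c, ‖S.gridPos c‖ < n + S.rows + 1 := fun c =>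
    hpos c ▸ hb _ (S.embedding.pos_mem_carrier _)
  have hin : ∀ g ∈ S.transducer.inputs, S.rows ≠ 0 ∧ ∃ i, g = S.number (0, i) := by
    intro g hg
    have e : S.transducer.inputs = if S.rows = 0 then [] else
      (List.finRange n).map fun i => S.number (0, i) := rfl
    rw [e] at hg
    split_ifs at hg with h0
    · simp at hg
    · obtain ⟨i, -, rfl⟩ := List.mem_map.mp hg
      exact ⟨h0, i, rfl⟩
  have hin0 : S.rows ≠ 0 → ∀ i, (S.gridPos (0, i)).im = 0 ∧ (S.gridPos (0, i)).re = i := by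
    intro h0 i
    simp [gridPos, height, abscissa, Ne.symm h0]
  refine ⟨S.embedding, fun g hg => ?_, ?_⟩
  · rcases hg with hg | ⟨⟨b, hg⟩, hs⟩
    · obtain ⟨h0, i, rfl⟩ := hin g ((S.transducer.mem_inputs g).mpr hg)
      exact S.embedding.onOuterFace_of_im_eq_zero hc (by rw [hpos]; exact (hin0 h0 i).1)
    · exact absurd (S.isEvaluated g b hg) hs
  -- The flag attached to a gate is the direction of its ray: down for inputs, up for outputs.
  · have e : S.transducer.inputs ++ S.transducer.outputs.reverse =
        (S.transducer.inputs.map (fun g => (g, false)) ++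
          S.transducer.outputs.reverse.map fun g => (g, true)).map Prod.fst := by
      simp [Function.comp_def]
    rw [e]
    refine S.embedding.ccwOnOuterFace_of_rays (H := ((S.rows - 1 : ℕ) : ℝ)) (by positivity) hc
      (by positivity) hb _ ?_ ?_
    · intro q hq
      rcases List.mem_append.mp hq with hq | hq
      · obtain ⟨g, hg, rfl⟩ := List.mem_map.mp hq
        obtain ⟨h0, i, rfl⟩ := hin g hg
        simpa [hpos] using (hin0 h0 i).1
      · obtain ⟨g, hg, rfl⟩ := List.mem_map.mp hq
        obtain ⟨i, -, rfl⟩ := List.mem_map.mp (List.mem_reverse.mp hg)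
        simp [hpos, gridPos, outCoord_height]
    · rw [List.pairwise_append]
      refine ⟨?_, ?_, ?_⟩
      · rw [List.pairwise_map]
        have e : S.transducer.inputs = if S.rows = 0 then [] else
          (List.finRange n).map fun i => S.number (0, i) := rfl
        rw [e]
        split_ifs with h0
        · exact List.Pairwise.nil
        · rw [List.pairwise_map]
          refine (List.pairwise_lt_finRange n).imp fun {i j} hij => ?_
          rw [hpos, hpos]
          refine (rayAngle_lt_of_re_lt (hn _) (hn _) ?_).1
          rw [(hin0 h0 i).2, (hin0 h0 j).2]
          exact_mod_cast hij
      · rw [List.pairwise_map, List.pairwise_reverse]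
        change ((List.finRange n).map fun i => S.number (S.outCoord i)).Pairwise _
        rw [List.pairwise_map]
        refine (List.pairwise_lt_finRange n).imp fun {i j} hij => ?_
        rw [hpos, hpos]
        refine (rayAngle_lt_of_re_lt (hn _) (hn _) ?_).2
        have := S.abscissa_outCoord_lt hij
        have : (S.abscissa (S.outCoord i) : ℝ) < S.abscissa (S.outCoord j) := by exact_mod_cast this
        simp only [gridPos]
        linarith
      · intro a ha b hb'
        obtain ⟨g, -, rfl⟩ := List.mem_map.mp ha
        obtain ⟨g', -, rfl⟩ := List.mem_map.mp hb'
        exact rayAngle_false_lt_true (hb _ (S.embedding.pos_mem_carrier _))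
          (hb _ (S.embedding.pos_mem_carrier _))

end GridSpec

end PathCheck

namespace PathCheck

/-! ## The circuits for the operators -/

/-- Yesterday, as opposed to Next. -/
def UnOp.past : UnOp → Bool
  | .strongNext => false
  | .weakNext => false
  | .strongYesterday => true
  | .weakYesterday => true

/-- The weak operators. -/
def UnOp.weak : UnOp → Bool
  | .strongNext => false
  | .weakNext => true
  | .strongYesterday => false
  | .weakYesterday => true

/-- The Boolean connectives, as opposed to the temporal operators. -/
def BinOp.connective : BinOp → Bool
  | .or => true
  | .and => true
  | _ => false

/-- The operators that refer to the past. -/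
def BinOp.past : BinOp → Bool
  | .since => true
  | .trigger => true
  | .boundedSince _ => true
  | .boundedTrigger _ => true
  | _ => false

/-- The operators of universal type. -/
def BinOp.universal : BinOp → Bool
  | .and => true
  | .release => true
  | .trigger => true
  | .boundedRelease _ => true
  | .boundedTrigger _ => true
  | _ => false

/-- The number of positions to which an operator refers. -/
def BinOp.rows (n : ℕ) : BinOp → ℕ
  | .or => 1
  | .and => 1
  | .boundedUntil b => b + 1
  | .boundedRelease b => b + 1
  | .boundedSince b => b + 1
  | .boundedTrigger b => b + 1
  | _ => n

theorem BinOp.rows_pos {n : ℕ} (op : BinOp) (hn : 0 < n) : 0 < op.rows n := by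
  cases op <;> simp [BinOp.rows, hn]

/-- The position `j` lies `e` steps after `i`, or before `i` in case of `past`. -/
def Reach {n : ℕ} (past : Bool) (e : ℕ) (i j : Fin n) : Prop :=
  if past then (j : ℕ) + e = i else (i : ℕ) + e = j

instance {n : ℕ} (past : Bool) (e : ℕ) (i j : Fin n) : Decidable (Reach past e i j) := by
  unfold Reach; infer_instance

section Reach

variable {n : ℕ} {past : Bool} {e e' : ℕ} {i j k : Fin n}

theorem reach_zero : Reach past 0 i j ↔ j = i := by
  cases past <;> simp [Reach, Fin.ext_iff, eq_comm]

theorem Reach.unique (h : Reach past e i j) (h' : Reach past e i k) : j = k := by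
  cases past <;> simp only [Reach, if_true, Bool.false_eq_true, if_false] at h h' <;>
    exact Fin.ext (by omega)

theorem Reach.exists_of_le (h : Reach past e i j) (he : e' ≤ e) : ∃ k, Reach past e' i k := by
  have := i.2
  have := j.2
  cases past <;> simp only [Reach, if_true, Bool.false_eq_true, if_false] at h ⊢
  · exact ⟨⟨i + e', by omega⟩, rfl⟩
  · exact ⟨⟨i - e', by omega⟩, by simp; omega⟩

theorem reach_succ : Reach past (e + 1) i j ↔ ∃ k, neighbor past i = some k ∧ Reach past e k j := by
  have := i.2
  have := j.2
  simp only [neighbor_eq_some]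
  cases past <;> simp only [Reach, if_true, Bool.false_eq_true, if_false]
  · exact ⟨fun h => ⟨⟨i + 1, by omega⟩, rfl, by simp; omega⟩, by rintro ⟨k, h1, h2⟩; omega⟩
  · exact ⟨fun h => ⟨⟨i - 1, by omega⟩, by simp; omega, by simp; omega⟩,
      by rintro ⟨k, h1, h2⟩; omega⟩

theorem Reach.succ_iff (h : Reach past e i k) : neighbor past k = some j ↔ Reach past (e + 1) i j := by
  simp only [neighbor_eq_some]
  cases past <;> simp only [Reach, if_true, Bool.false_eq_true, if_false] at h ⊢ <;> omega

end Reach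

/-- The circuit for an atomic proposition that is true at the positions with `s`. -/
def atomSpec {n : ℕ} (s : Fin n → Bool) : GridSpec n where
  rows := 0
  past := false
  diag := false
  conj := false
  mask _ := false
  useConst _ := true
  value := s
  rows_pos _ h := by simp at h

/-- The circuit for a unary operator. -/
def unarySpec (n : ℕ) (op : UnOp) : GridSpec n where
  rows := 2
  past := op.past
  diag := true
  conj := false
  mask _ := false
  useConst i := (neighbor op.past i).isNone
  value _ := op.weak
  rows_pos _ _ := by norm_num

/-- The circuit for a binary operator with the value sequence of the left or of the right
argument. -/
def binarySpec {n : ℕ} (left : Bool) (s : Fin n → Bool) (op : BinOp) : GridSpec n where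
  rows := op.rows n
  past := op.past
  diag := false
  conj := op.universal == left
  mask i := if left then s i != op.universal else
    (neighbor op.past i).elim false fun j => s j == op.universal
  useConst i := if op.connective then s i != op.universal else
    !left && !decide (s i = op.universal ∧
      ∃ e < op.rows n, ∃ j, Reach op.past e i j ∧ s j ≠ op.universal)
  value := s
  rows_pos i _ := op.rows_pos i.pos

/-- The value `!S.conj` is the one that a single argument forces on a gate. It spreads to a gate in
row `d` from an input at distance at most `d`, provided that all columns on the way are masked, that
is, let the value of their neighbor pass. -/
theorem GridSpec.gridValue_eq_not_conj {n : ℕ} (S : GridSpec n) (hd : S.diag = false)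
    (s : Fin n → Bool) (d : ℕ) (i : Fin n) :
    S.gridValue s d i = !S.conj ↔ ∃ e ≤ d, ∃ j, Reach S.past e i j ∧ s j = !S.conj ∧
      ∀ e' < e, ∀ k, Reach S.past e' i k → S.mask k = true := by
  induction d generalizing i with
  | zero =>
    simp only [gridValue, Nat.le_zero]
    constructor
    · exact fun h => ⟨0, rfl, i, reach_zero.mpr rfl, h, by simp⟩
    · rintro ⟨_, rfl, j, hj, h, -⟩
      rwa [← reach_zero.mp hj]
  | succ d ih =>
    have key : S.gridValue s (d + 1) i = !S.conj ↔ S.gridValue s d i = !S.conj ∨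
        S.mask i = true ∧ ∃ j, neighbor S.past i = some j ∧ S.gridValue s d j = !S.conj := by
      rw [gridValue]
      cases hn : neighbor S.past i with
      | none => simp
      | some j =>
        simp only [hd, Bool.false_eq_true, if_false]
        cases S.mask i <;> cases S.conj <;> cases S.gridValue s d i <;>
          simp
    rw [key, ih]
    constructor
    · rintro (⟨e, he, h⟩ | ⟨hm, j, hj, h⟩)
      · exact ⟨e, by omega, h⟩
      · obtain ⟨e, he, j', hr, hs, ha⟩ := (ih j).mp h
        refine ⟨e + 1, by omega, j', reach_succ.mpr ⟨j, hj, hr⟩, hs, fun e' he' k hk => ?_⟩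
        rcases e' with _ | e'
        · rwa [reach_zero.mp hk]
        · obtain ⟨j₂, hj₂, hk'⟩ := reach_succ.mp hk
          obtain rfl : j = j₂ := by simpa [hj] using hj₂
          exact ha e' (by omega) k hk'
    · rintro ⟨e, he, j, hr, hs, ha⟩
      rcases e with _ | e
      · exact .inl ⟨0, by omega, j, hr, hs, ha⟩
      · right
        refine ⟨ha 0 (by omega) i (reach_zero.mpr rfl), ?_⟩
        obtain ⟨k, hk, hr'⟩ := reach_succ.mp hr
        exact ⟨k, hk, (ih k).mpr ⟨e, by omega, j, hr', hs,
          fun e' he' k' hk' => ha (e' + 1) (by omega) k' (reach_succ.mpr ⟨k, hk, hk'⟩)⟩⟩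

/-- Unfolding of the temporal operators in terms of distances. -/
theorem BinOp.holds_temporal {n : ℕ} (op : BinOp) (hop : op.connective = false)
    (l r : Fin n → Bool) (i : Fin n) :
    (op.Holds (fun j => l j = true) (fun j => r j = true) i ↔ op.universal = false) ↔
      ∃ e < op.rows n, ∃ j, Reach op.past e i j ∧ r j = !op.universal ∧
        ∀ e' < e, ∀ k, Reach op.past e' i k → l k = !op.universal := by
  -- A witness `j` corresponds to its distance `e` from `i`, and the positions before it to the
  -- smaller distances.
  have future : ∀ (R : Fin n → Prop) (L : Fin n → Prop) (B : ℕ → Prop),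
      (∃ j, i ≤ j ∧ B (j - i : ℕ) ∧ R j ∧ ∀ k, i ≤ k → k < j → L k) ↔
      ∃ e, B e ∧ ∃ j, Reach false e i j ∧ R j ∧ ∀ e' < e, ∀ k, Reach false e' i k → L k := by
    intro R L B
    simp only [Reach, Bool.false_eq_true, if_false]
    constructor
    · rintro ⟨j, hij, hB, hR, hL⟩
      have hij' : (i : ℕ) ≤ j := hij
      refine ⟨j - i, hB, j, by omega, hR, fun e' he' k hk => hL k ?_ ?_⟩
      · rw [Fin.le_def]; omega
      · rw [Fin.lt_def]; omega
    · rintro ⟨e, hB, j, hj, hR, hL⟩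
      refine ⟨j, by rw [Fin.le_def]; omega, by rwa [show (j - i : ℕ) = e by omega], hR,
        fun k hik hkj => hL (k - i) ?_ k ?_⟩
      · rw [Fin.lt_def] at hkj; rw [Fin.le_def] at hik; omega
      · rw [Fin.le_def] at hik; omega
  have past : ∀ (R : Fin n → Prop) (L : Fin n → Prop) (B : ℕ → Prop),
      (∃ j, j ≤ i ∧ B (i - j : ℕ) ∧ R j ∧ ∀ k, k ≤ i → j < k → L k) ↔
      ∃ e, B e ∧ ∃ j, Reach true e i j ∧ R j ∧ ∀ e' < e, ∀ k, Reach true e' i k → L k := by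
    intro R L B
    simp only [Reach, if_true]
    constructor
    · rintro ⟨j, hij, hB, hR, hL⟩
      have hij' : (j : ℕ) ≤ i := hij
      refine ⟨i - j, hB, j, by omega, hR, fun e' he' k hk => hL k ?_ ?_⟩
      · rw [Fin.le_def]; omega
      · rw [Fin.lt_def]; omega
    · rintro ⟨e, hB, j, hj, hR, hL⟩
      refine ⟨j, by rw [Fin.le_def]; omega, by rwa [show (i - j : ℕ) = e by omega], hR,
        fun k hik hkj => hL (i - k) ?_ k ?_⟩
      · rw [Fin.lt_def] at hkj; rw [Fin.le_def] at hik; omega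
      · rw [Fin.le_def] at hik; omega
  have := i.2
  cases op <;> simp only [BinOp.connective, Bool.true_eq_false] at hop <;>
    simp only [BinOp.Holds, BinOp.universal, BinOp.past, BinOp.rows, Bool.not_true, Bool.not_false,
      iff_true, iff_false, Bool.true_eq_false] <;>
    -- An operator of universal type fails iff its existential dual holds for the negated arguments.
    (try push Not) <;>
    first
      -- For the unbounded operators the range consists of all distances below `n`, which is no
      -- restriction.
      | (rw [← future _ _ (· < n)]; refine exists_congr fun j => ?_)
      | (rw [← past _ _ (· < n)]; refine exists_congr fun j => ?_)
      | (rename_i b; rw [← future _ _ (· < b + 1)]; refine exists_congr fun j => ?_)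
      | (rename_i b; rw [← past _ _ (· < b + 1)]; refine exists_congr fun j => ?_)
  all_goals
    have := j.2
    try simp only [ne_eq, Bool.not_eq_true]
    refine and_congr_right fun hij => ?_
    rw [Fin.le_def] at hij
    first
      | exact ⟨fun h => ⟨by omega, h⟩, fun h => h.2⟩
      | exact and_congr_left fun _ => by omega

/-- The value `!op.universal` is the absorbing one: true for or, false for and. -/
theorem BinOp.holds_connective {n : ℕ} (op : BinOp) (hop : op.connective = true)
    (l r : Fin n → Bool) (i : Fin n) :
    (op.Holds (fun j => l j = true) (fun j => r j = true) i ↔ op.universal = false) ↔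
      l i = !op.universal ∨ r i = !op.universal := by
  cases op <;> simp only [BinOp.connective, Bool.false_eq_true] at hop
  · simp [BinOp.Holds, BinOp.universal]
  · simp only [BinOp.Holds, BinOp.universal]
    cases l i <;> cases r i <;> simp

/-- Due to this, correctness has to be examined only for the decisive value of an operator. -/
theorem eq_of_eq_not_iff {a b c : Bool} (h : a = !c ↔ b = !c) : a = b := by
  cases a <;> cases b <;> cases c <;> simp_all

theorem eq_not_iff_of_iff {a u : Bool} {p : Prop} (h : a = true ↔ p) :
    a = !u ↔ (p ↔ u = false) := by
  rw [← h]; cases a <;> cases u <;> simp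

/-- A grid without rows has no inputs, which fits the sequence `s` only if `n = 0`. -/
theorem GridSpec.maps {n : ℕ} (S : GridSpec n) (s t : Fin n → Bool) (hr : S.rows = 0 → n = 0)
    (ht : ∀ i, t i = if S.useConst i then S.value i else S.gridValue s (S.rows - 1) i) :
    S.transducer.Maps s t := by
  by_cases h : S.rows = 0
  · obtain rfl := hr h
    have := S.maps_of_rows_eq_zero h s
    rwa [show t = S.value from funext fun i => i.elim0]
  · exact S.maps_of_rows_ne_zero h s t ht

theorem atomSpec_maps {n : ℕ} (s : Fin n → Bool) (t : Fin 0 → Bool) :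
    (atomSpec s).transducer.Maps t s :=
  (atomSpec s).maps_of_rows_eq_zero rfl t

/-- The gate in the upper row copies the input of the neighboring column. Where there is no
neighbor, the output is the constant that distinguishes weak from strong operators. -/
theorem unarySpec_maps {n : ℕ} (op : UnOp) (s t : Fin n → Bool)
    (ht : ∀ i, t i = true ↔ op.Holds (fun j => s j = true) i) :
    (unarySpec n op).transducer.Maps s t := by
  refine GridSpec.maps _ s t (by simp [unarySpec]) fun i => ?_
  rw [Bool.eq_iff_iff, ht]
  have hn := fun j => neighbor_eq_some (past := op.past) (i := i) (j := j)
  simp only [unarySpec, Nat.reduceSub, GridSpec.gridValue, if_true]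
  cases h : neighbor op.past i with
  | none =>
    rw [h] at hn
    have hn' : ∀ j : Fin n, ¬ (if op.past then (j : ℕ) + 1 = i else (i : ℕ) + 1 = j) :=
      fun j hj => by simpa using (hn j).mpr hj
    cases op <;> simp only [UnOp.past, if_true, Bool.false_eq_true, if_false] at hn' <;>
      simp only [UnOp.Holds, UnOp.weak, Option.isNone_none, if_true, Bool.false_eq_true, iff_false,
        iff_true]
    · rintro ⟨j, hj, -⟩; exact hn' j hj.symm
    · intro j hj; exact absurd hj.symm (hn' j)
    · rintro ⟨j, hj, -⟩; exact hn' j hj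
    · intro j hj; exact absurd hj (hn' j)
  | some j =>
    have hj := (hn j).mp h
    simp only [Option.isNone_some, Bool.false_eq_true, if_false]
    cases op <;> simp only [UnOp.past, if_true, Bool.false_eq_true, if_false] at hj <;>
      simp only [UnOp.Holds]
    · constructor
      · rintro ⟨k, hk, hs⟩; rwa [show j = k from Fin.ext (by omega)]
      · exact fun hs => ⟨j, hj.symm, hs⟩
    · constructor
      · exact fun hs => hs j hj.symm
      · intro hs k hk; rwa [show k = j from Fin.ext (by omega)]
    · constructor
      · rintro ⟨k, hk, hs⟩; rwa [show j = k from Fin.ext (by omega)]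
      · exact fun hs => ⟨j, hj, hs⟩
    · constructor
      · exact fun hs => hs j hj
      · intro hs k hk; rwa [show k = j from Fin.ext (by omega)]

/-- Where the known argument has the absorbing value, the output is this constant; elsewhere the
input gate itself is the output. -/
theorem binarySpec_connective_maps {n : ℕ} (left : Bool) (op : BinOp) (hop : op.connective = true)
    (s r t : Fin n → Bool)
    (ht : ∀ i, t i = !op.universal ↔ s i = !op.universal ∨ r i = !op.universal) :
    (binarySpec left s op).transducer.Maps r t := by
  refine GridSpec.maps _ r t (fun h => ?_) fun i => eq_of_eq_not_iff (c := op.universal) ?_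
  · cases op <;> simp [BinOp.connective, binarySpec, BinOp.rows] at hop h
  · have hr : op.rows n = 1 := by cases op <;> simp [BinOp.connective, BinOp.rows] at hop ⊢
    rw [ht]
    simp only [binarySpec, hop, if_true, hr, Nat.sub_self, GridSpec.gridValue]
    cases s i <;> cases op.universal <;> simp

/-- Columns are masked where the known left argument allows the search for a witness to go on. The
top row, with number `op.rows n - 1`, covers exactly the distances in the range of the operator. -/
theorem binarySpec_left_maps {n : ℕ} (op : BinOp) (l r t : Fin n → Bool)
    (ht : ∀ i, t i = true ↔ op.Holds (fun j => l j = true) (fun j => r j = true) i) :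
    (binarySpec true l op).transducer.Maps r t := by
  by_cases hop : op.connective = true
  · exact binarySpec_connective_maps true op hop l r t fun i => by
      rw [eq_not_iff_of_iff (ht i), op.holds_connective hop]
  rw [Bool.not_eq_true] at hop
  refine GridSpec.maps _ r t (fun h => ?_) fun i => eq_of_eq_not_iff (c := op.universal) ?_
  · by_contra hn
    exact (op.rows_pos (Nat.pos_of_ne_zero hn)).ne' h
  · rw [eq_not_iff_of_iff (ht i), op.holds_temporal hop]
    have hu : (binarySpec true l op).useConst i = false := by simp [binarySpec, hop]
    have hc : (binarySpec true l op).conj = op.universal := by simp [binarySpec]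
    rw [hu, if_neg Bool.false_ne_true]
    have key := (binarySpec true l op).gridValue_eq_not_conj rfl r
      ((binarySpec true l op).rows - 1) i
    rw [hc] at key
    rw [key]
    have hpos := op.rows_pos i.pos
    refine exists_congr fun e => and_congr ?_ ?_
    · simp only [binarySpec]; omega
    · refine exists_congr fun j => and_congr_right fun _ => and_congr_right fun _ => ?_
      simp only [binarySpec, if_true]
      refine forall_congr' fun e' => forall_congr' fun _ => forall_congr' fun k =>
        forall_congr' fun _ => ?_
      cases l k <;> cases op.universal <;> simp

/-- The nearest position where the known right argument is decisive is the best witness, since a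
farther one only adds conditions on the left argument. The output is a constant if this position is
`i` itself or does not exist in the range; it equals `r i` in both cases, which explains the choice
of `value`. Otherwise the output combines the left argument over the positions from `i` to just
before the witness, by gates of the opposite type. So a column is masked if its neighbor exists and
is not a witness. -/
theorem binarySpec_right_maps {n : ℕ} (op : BinOp) (l r t : Fin n → Bool)
    (ht : ∀ i, t i = true ↔ op.Holds (fun j => l j = true) (fun j => r j = true) i) :
    (binarySpec false r op).transducer.Maps l t := by
  by_cases hop : op.connective = true
  · exact binarySpec_connective_maps false op hop r l t fun i => by
      rw [eq_not_iff_of_iff (ht i), op.holds_connective hop, or_comm]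
  rw [Bool.not_eq_true] at hop
  refine GridSpec.maps _ l t (fun h => ?_) fun i => eq_of_eq_not_iff (c := op.universal) ?_
  · by_contra hn
    exact (op.rows_pos (Nat.pos_of_ne_zero hn)).ne' h
  rw [eq_not_iff_of_iff (ht i), op.holds_temporal hop]
  have hpos := op.rows_pos i.pos
  have hv : (binarySpec false r op).value i = r i := rfl
  by_cases hri : r i = op.universal
  swap
  · have hu : (binarySpec false r op).useConst i = true := by simp [binarySpec, hop, hri]
    have hri' : r i = !op.universal := by
      revert hri; cases r i <;> cases op.universal <;> simp
    rw [hu, if_pos rfl, hv]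
    exact iff_of_true ⟨0, hpos, i, reach_zero.mpr rfl, hri', by simp⟩ hri'
  by_cases hw : ∃ e < op.rows n, ∃ j, Reach op.past e i j ∧ r j ≠ op.universal
  swap
  · have hu : (binarySpec false r op).useConst i = true := by
      simp only [binarySpec, hop, Bool.false_eq_true, if_false, Bool.not_false, Bool.true_and,
        Bool.not_eq_true', decide_eq_false_iff_not]
      exact fun h => hw h.2
    rw [hu, if_pos rfl, hv, hri]
    refine iff_of_false ?_ (by simp)
    rintro ⟨e, he, j, hj, hrj, -⟩
    exact hw ⟨e, he, j, hj, by rw [hrj]; simp⟩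
  have hu : (binarySpec false r op).useConst i = false := by
    simp only [binarySpec, hop, Bool.false_eq_true, if_false, Bool.not_false, Bool.true_and,
      Bool.not_eq_false', decide_eq_true_eq]
    exact ⟨hri, hw⟩
  rw [hu, if_neg Bool.false_ne_true]
  have hc : (binarySpec false r op).conj = !op.universal := by simp [binarySpec]
  have key := (binarySpec false r op).gridValue_eq_not_conj rfl l
    ((binarySpec false r op).rows - 1) i
  rw [hc, Bool.not_not] at key
  have hmask : ∀ k, (binarySpec false r op).mask k = true ↔
      ∃ j, neighbor op.past k = some j ∧ r j = op.universal := by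
    intro k
    simp only [binarySpec, Bool.false_eq_true, if_false]
    cases neighbor op.past k <;> simp
  -- Let `e₀` be the distance of the nearest witness.
  have hmin := Nat.find_spec hw
  have hlt := fun e he => Nat.find_min hw (m := e) he
  generalize Nat.find hw = e₀ at hmin hlt
  obtain ⟨he₀, j₀, hj₀, hrj₀⟩ := hmin
  have hr_lt : ∀ e < e₀, ∀ j, Reach op.past e i j → r j = op.universal := by
    intro e he j hj
    by_contra h
    exact hlt e he ⟨by omega, j, hj, h⟩
  constructor
  · rintro ⟨e₁, he₁, j₁, hj₁, hrj₁, hl₁⟩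
    by_contra hg
    have hg' : (binarySpec false r op).gridValue l ((binarySpec false r op).rows - 1) i =
        op.universal := by
      revert hg
      cases (binarySpec false r op).gridValue l ((binarySpec false r op).rows - 1) i <;>
        cases op.universal <;> simp
    obtain ⟨e, he, j, hj, hlj, hm⟩ := key.mp hg'
    -- Otherwise the mask at distance `e₀ - 1` would say that the position at distance `e₀` is not a
    -- witness.
    have h1 : e < e₀ := by
      by_contra hge
      obtain ⟨e', rfl⟩ : ∃ e', e₀ = e' + 1 := Nat.exists_eq_succ_of_ne_zero fun h0 => by
        rw [h0] at hj₀
        rw [reach_zero.mp hj₀] at hrj₀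
        exact hrj₀ hri
      obtain ⟨k, hk⟩ := hj₀.exists_of_le (Nat.le_succ e')
      obtain ⟨j', hj', hrj'⟩ := (hmask k).mp (hm e' (by omega) k hk)
      rw [hj₀.unique (hk.succ_iff.mp hj')] at hrj₀
      exact hrj₀ hrj'
    have h2 : e₀ ≤ e₁ := by
      by_contra hlt'
      have := hr_lt e₁ (by omega) j₁ hj₁
      rw [this] at hrj₁
      simp at hrj₁
    have := hl₁ e (by omega) j hj
    rw [hlj] at this
    simp at this
  · intro hg
    refine ⟨e₀, he₀, j₀, hj₀, ?_, fun e he k hk => ?_⟩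
    · revert hrj₀; cases r j₀ <;> cases op.universal <;> simp
    · by_contra hlk
      have hlk' : l k = op.universal := by
        revert hlk; cases l k <;> cases op.universal <;> simp
      -- The positions at distances `1, …, e` come before the nearest witness, so all columns on the
      -- way to `k` are masked.
      have hx := key.mpr ⟨e, by simp only [binarySpec]; omega, k, hk, hlk', fun e' he' k' hk' => by
        rw [hmask]
        obtain ⟨j', hj'⟩ := hj₀.exists_of_le (show e' + 1 ≤ e₀ by omega)
        exact ⟨j', hk'.succ_iff.mpr hj', hr_lt (e' + 1) (by omega) j' hj'⟩⟩
      rw [hx] at hg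
      simp at hg

end PathCheck

namespace PathCheck

namespace Logspace

/-! ### Bounded quantifiers, arithmetic and symbol counts in logarithmic space -/

section Derived

variable {A : Type} {d : ℕ}

theorem Num.congr {f g : List A → (ℕ → ℕ) → ℕ} (hf : Num d f) (h : ∀ x v, f x v = g x v) :
    Num d g := by
  have : f = g := by funext x v; exact h x v
  exact this ▸ hf

theorem Emit.congr {f g : List A → (ℕ → ℕ) → List A} (hf : Emit d f) (h : ∀ x v, f x v = g x v) :
    Emit d g := by
  have : f = g := by funext x v; exact h x v
  exact this ▸ hf

/-- A solution exists iff the number of solutions is not zero. -/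
theorem Pred.exists {b : List A → (ℕ → ℕ) → ℕ} {P : List A → (ℕ → ℕ) → Prop}
    (hb : Num d b) (hP : Pred (d + 1) P) :
    Pred d fun x v => ∃ j < b x v, P x (Function.update v d j) := by
  classical
  exact (Pred.eq (Num.count hb hP) .zero).not.iff fun x v => Nat.count_ne_iff_exists

theorem Pred.forall {b : List A → (ℕ → ℕ) → ℕ} {P : List A → (ℕ → ℕ) → Prop}
    (hb : Num d b) (hP : Pred (d + 1) P) :
    Pred d fun x v => ∀ j < b x v, P x (Function.update v d j) :=
  (Pred.exists hb hP.not).not.iff fun x v => by simp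

/-- The number `f x v` is smaller iff it occurs among the numbers below `g x v`. -/
theorem Pred.lt {f g : List A → (ℕ → ℕ) → ℕ} (hf : Num d f) (hg : Num d g) :
    Pred d fun x v => f x v < g x v :=
  (Pred.exists hg (Pred.eq (.var (i := d) (by omega)) (hf.mono (Nat.le_succ d)))).iff
    fun x v => by simp [hf.update]

theorem count_not_lt (a b : ℕ) : Nat.count (fun j => ¬ j < b) a = a - b := by
  induction a with
  | zero => simp
  | succ a ih => rw [Nat.count_succ, ih]; split_ifs <;> omega

/-- Sums may exceed the bound `x.length + 1` on registers, but truncated differences do not: `a - b`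
counts the numbers below `a` that are not below `b`. -/
theorem Num.sub {f g : List A → (ℕ → ℕ) → ℕ} (hf : Num d f) (hg : Num d g) :
    Num d fun x v => f x v - g x v := by
  classical
  refine (Num.count hf (Pred.lt (.var (i := d) (by omega)) (hg.mono (Nat.le_succ d))).not).congr
    fun x v => ?_
  simp only [hg.update, Function.update_self]
  rw [← count_not_lt]

theorem Num.length : Num (A := A) d fun x _ => x.length :=
  (Num.sub .top .one).congr fun x v => by simp

/-- The number two, cut off at the length of the input word plus one. -/
theorem Num.two : Num (A := A) d fun x _ => Min.min 2 (x.length + 1) := by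
  classical
  refine (Num.count .top (Pred.lt .one (.var (i := d) (by omega))).not).congr fun x v => ?_
  simp only [Function.update_self]
  generalize x.length + 1 = m
  induction m with
  | zero => simp
  | succ m ih => rw [Nat.count_succ, ih]; split_ifs <;> omega

open Classical in
theorem count_symbol (P : A → Prop) (x : List A) (m : ℕ) :
    Nat.count (fun j => ∃ a, x[j]? = some a ∧ P a) m = (x.take m).countP fun a => decide (P a) := by
  induction m with
  | zero => simp
  | succ m ih =>
    rw [Nat.count_succ, ih, List.take_add_one, List.countP_append]
    cases x[m]? with
    | none => simp
    | some a => by_cases h : P a <;> simp [h]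

open Classical in
theorem Pred.symbolAt {g : List A → (ℕ → ℕ) → ℕ} (hg : Num d g) (P : A → Prop) :
    Pred d fun x v => ∃ a, x[g x v]? = some a ∧ P a :=
  (Pred.symbol hg fun o => o.any fun a => decide (P a)).iff fun x v => by
    cases x[g x v]? <;> simp

open Classical in
theorem Num.countTake {g : List A → (ℕ → ℕ) → ℕ} (hg : Num d g) (P : A → Prop) :
    Num d fun x v => (x.take (g x v)).countP fun a => decide (P a) :=
  (Num.count hg (Pred.symbolAt (.var (i := d) (by omega)) P)).congr fun x v => by
    simp only [Function.update_self]
    exact count_symbol P x _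

open Classical in
theorem Num.countP (P : A → Prop) : Num d fun x _ => x.countP fun a => decide (P a) :=
  (Num.countTake .length P).congr fun x v => by simp

theorem Pred.has (P : A → Prop) : Pred d fun x _ => ∃ a ∈ x, P a := by
  classical
  exact (Pred.eq (Num.countP P) .zero).not.iff fun x v => by simp [List.countP_eq_zero]

theorem Emit.cons {f : List A → (ℕ → ℕ) → List A} (s : A) (hf : Emit d f) :
    Emit d fun x v => s :: f x v :=
  (Emit.symbol s).append hf

theorem Emit.ite_of_decidable {P : List A → (ℕ → ℕ) → Prop} [∀ x v, Decidable (P x v)]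
    {f g : List A → (ℕ → ℕ) → List A} (hP : Pred d P) (hf : Emit d f) (hg : Emit d g) :
    Emit d fun x v => if P x v then f x v else g x v :=
  (Emit.ite hP hf hg).congr fun x v => by split_ifs <;> rfl

end Derived

/-! ## Writing the code of a grid circuit -/

section Code

variable {d : ℕ} {f g h : List Sym → (ℕ → ℕ) → ℕ}

theorem Emit.ticks (hf : Num d f) : Emit d fun x v => List.replicate (f x v) Sym.tick := by
  refine (Emit.loop hf (Emit.symbol Sym.tick)).congr fun x v => ?_
  induction f x v with
  | zero => rfl
  | succ m ih => rw [List.range_succ, List.flatMap_append, ih, List.replicate_succ']; rfl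

/-- A product may be too large for a register. It is not computed but written in unary by nested
loops. -/
theorem Emit.ticks_mul (hf : Num d f) (hg : Num d g) :
    Emit d fun x v => List.replicate (f x v * g x v) Sym.tick := by
  refine (Emit.loop hg (Emit.ticks (hf.mono (Nat.le_succ d)))).congr fun x v => ?_
  simp only [hf.update]
  induction g x v with
  | zero => simp
  | succ m ih =>
    rw [List.range_succ, List.flatMap_append, ih, Nat.mul_succ, ← List.replicate_append_replicate]
    simp

theorem Emit.codeNat (hf : Num d f) (hg : Num d g) (hh : Num d h) :
    Emit d fun x v => PathCheck.codeNat (h x v + f x v * g x v) :=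
  (((Emit.ticks hh).append (.ticks_mul hf hg)).append (.symbol .endNat)).congr fun x v => by
    rw [PathCheck.codeNat, ← List.replicate_append_replicate]

/-- The successor is written as an additional tick, since it need not fit into a register. -/
theorem Emit.codeNat_succ (hf : Num d f) (hg : Num d g) (hh : Num d h) :
    Emit d fun x v => PathCheck.codeNat (h x v + 1 + f x v * g x v) :=
  ((Emit.symbol .tick).append (.codeNat hf hg hh)).congr fun x v => by
    rw [PathCheck.codeNat, PathCheck.codeNat, Nat.add_right_comm, List.replicate_succ]
    rfl

/-- A property of a number and the input word that can be decided in logarithmic space. -/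
def UPred (P : List Sym → ℕ → Prop) : Prop :=
  ∀ {d : ℕ} {g : List Sym → (ℕ → ℕ) → ℕ}, Num d g → Pred d fun x v => P x (g x v)

end Code

end Logspace

/-! ### Grid data and the code of the circuit they describe -/

open Logspace

/-- The data of a grid circuit as properties of numbers. -/
structure GridData where
  n : ℕ
  rows : ℕ
  past : Prop
  diag : Prop
  conj : Prop
  mask : ℕ → Prop
  useConst : ℕ → Prop
  value : ℕ → Prop

namespace GridData

variable (D : GridData)

/-- The code of the number of a gate. -/
def gateWord (r i : ℕ) : List Sym := codeNat (i + D.n * r)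

open Classical in
/-- The code of a gate in column `i` above the row `r` that may refer to column `j`. -/
noncomputable def nbWord (r i j : ℕ) : List Sym :=
  if D.diag then .id :: D.gateWord r j
  else if D.mask i then
    (if D.conj then [.and] else [.or]) ++ (D.gateWord r i ++ D.gateWord r j)
  else .id :: D.gateWord r i

open Classical in
/-- The code of a gate in column `i` above the row `r`. -/
noncomputable def cellWord (r i : ℕ) : List Sym :=
  if D.past then (if i = 0 then .id :: D.gateWord r i else D.nbWord r i (i - 1))
  else if 1 < D.n - i then D.nbWord r i (i + 1)
  else .id :: D.gateWord r i

open Classical in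
/-- The code of the grid circuit. -/
noncomputable def word : List Sym :=
  (List.range D.rows).flatMap (fun d => (List.range D.n).flatMap fun i =>
    .gate :: if d = 0 then [.var] else D.cellWord (d - 1) i) ++
  (List.range D.n).flatMap (fun i => .gate :: if D.value i then [.one] else [.zero]) ++
  .inputs :: (if D.rows = 0 then [] else (List.range D.n).flatMap fun i => D.gateWord 0 i) ++
  .outputs :: (List.range D.n).flatMap fun i =>
    if D.useConst i then D.gateWord D.rows i else D.gateWord (D.rows - 1) i

/-- The data describe a grid circuit. -/
structure Describes {n : ℕ} (S : GridSpec n) : Prop where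
  n_eq : D.n = n
  rows_eq : D.rows = S.rows
  past_iff : D.past ↔ S.past = true
  diag_iff : D.diag ↔ S.diag = true
  conj_iff : D.conj ↔ S.conj = true
  mask_iff : ∀ i : Fin n, D.mask i ↔ S.mask i = true
  useConst_iff : ∀ i : Fin n, D.useConst i ↔ S.useConst i = true
  value_iff : ∀ i : Fin n, D.value i ↔ S.value i = true

variable {D}

theorem flatMap_finRange {α : Type*} (n : ℕ) (f : ℕ → List α) :
    (List.finRange n).flatMap (fun i : Fin n => f (i : ℕ)) = (List.range n).flatMap f := by
  rw [← List.map_coe_finRange_eq_range, List.flatMap_map]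

/-- Gates are numbered row by row, so a listing by numbers is a nested listing by rows and columns.
-/
theorem flatMap_finRange_mul {α : Type*} (m n : ℕ) (f : Fin (m * n) → List α) :
    (List.finRange (m * n)).flatMap f =
      (List.finRange m).flatMap fun d => (List.finRange n).flatMap fun i =>
        f (finProdFinEquiv (d, i)) := by
  rw [List.flatMap_def, ← List.ofFn_eq_map, List.ofFn_mul, List.flatten_flatten,
    List.ofFn_eq_map, List.map_map, ← List.flatMap_def]
  refine congrArg List.flatten (List.map_congr_left fun d _ => ?_)
  simp only [Function.comp_apply]
  rw [List.ofFn_eq_map, ← List.flatMap_def]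
  refine congrArg List.flatten (List.map_congr_left fun i _ => ?_)
  congr 1
  ext
  simp [finProdFinEquiv]
  ring

/-- The neighbor is found by arithmetic on columns: `i - 1` exists unless `i = 0`, and `i + 1`
exists iff `1 < n - i`. -/
theorem Describes.cellWord_eq {n : ℕ} {S : GridSpec n} (h : D.Describes S)
    (r : Fin (S.rows + 1)) (i : Fin n) :
    D.cellWord r i = ((S.cell r i).map S.number).code := by
  have hn := fun j => neighbor_eq_some (past := S.past) (i := i) (j := j)
  have hg : ∀ (r : Fin (S.rows + 1)) (j : Fin n), D.gateWord r j = codeNat (S.number (r, j)) :=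
    fun r j => by simp [gateWord, h.n_eq]
  have hnb : ∀ j : Fin n, neighbor S.past i = some j →
      D.nbWord r i j = ((S.cell r i).map S.number).code := by
    intro j hj
    simp only [nbWord, h.diag_iff, h.mask_iff, h.conj_iff, GridSpec.cell, hj, hg]
    split_ifs <;> simp [GateLabel.map, GateLabel.code]
  have hid : neighbor S.past i = none →
      .id :: D.gateWord r i = ((S.cell r i).map S.number).code := by
    intro hj
    simp [GridSpec.cell, hj, hg, GateLabel.map, GateLabel.code]
  unfold cellWord
  simp only [h.past_iff, h.n_eq]
  by_cases hp : S.past = true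
  · rw [if_pos hp]
    simp only [hp, if_true] at hn
    split_ifs with h0
    · refine hid ?_
      cases hj : neighbor S.past i with
      | none => rfl
      | some j => rw [hp] at hj; have := (hn j).mp hj; omega
    · refine hnb ⟨i - 1, by omega⟩ ?_
      rw [hp, hn]
      simp only
      omega
  · rw [if_neg hp]
    rw [Bool.not_eq_true] at hp
    simp only [hp, Bool.false_eq_true, if_false] at hn hnb hid
    split_ifs with h0
    · exact hnb ⟨i + 1, by omega⟩ ((hn _).mpr rfl)
    · refine hid ?_
      cases hj : neighbor false i with
      | none => rfl
      | some j => have := (hn j).mp hj; omega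

-- The row of constants has the largest number and is split off from the list of gates; it is the
-- second loop of `word`.
open Classical in
theorem Describes.word_eq {n : ℕ} {S : GridSpec n} (h : D.Describes S) :
    D.word = (NumberedTransducer.mk _ S.transducer).code := by
  have hg : ∀ (r : Fin (S.rows + 1)) (j : Fin n), D.gateWord r j = codeNat (S.number (r, j)) :=
    fun r j => by simp [gateWord, h.n_eq]
  have hgates : (List.finRange ((S.rows + 1) * n)).flatMap
      (fun g => Sym.gate :: (S.transducer.label g).code) =
      (List.range D.rows).flatMap (fun d => (List.range D.n).flatMap fun i =>
        Sym.gate :: if d = 0 then [.var] else D.cellWord (d - 1) i) ++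
      (List.range D.n).flatMap (fun i => Sym.gate :: if D.value i then [.one] else [.zero]) := by
    rw [flatMap_finRange_mul, h.n_eq, h.rows_eq, List.finRange_succ_last, List.flatMap_append]
    congr 1
    · rw [List.flatMap_map, ← flatMap_finRange]
      refine congrArg List.flatten (List.map_congr_left fun d _ => ?_)
      rw [← flatMap_finRange]
      refine congrArg List.flatten (List.map_congr_left fun i _ => ?_)
      have hl := S.transducer_label (d.castSucc, i)
      rw [GridSpec.number] at hl
      rw [hl]
      have hd : (d : ℕ) ≠ S.rows := by omega
      by_cases h0 : (d : ℕ) = 0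
      · simp [GridSpec.gridLabel, h0, GateLabel.map, GateLabel.code]
        rw [if_neg (by omega)]
      · simp only [GridSpec.gridLabel, Fin.val_castSucc, hd, h0, if_false]
        rw [← h.cellWord_eq]
    · rw [List.flatMap_singleton, ← flatMap_finRange]
      refine congrArg List.flatten (List.map_congr_left fun i _ => ?_)
      have hl := S.transducer_label (Fin.last _, i)
      rw [GridSpec.number] at hl
      rw [hl]
      simp only [GridSpec.gridLabel, Fin.val_last, if_true, h.value_iff]
      cases S.value i <;> rfl
  have hin : S.transducer.inputs.flatMap (fun g : Fin _ => codeNat (g : ℕ)) =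
      if D.rows = 0 then [] else (List.range D.n).flatMap fun i => D.gateWord 0 i := by
    have e : S.transducer.inputs = if S.rows = 0 then [] else
      (List.finRange n).map fun i => S.number (0, i) := rfl
    rw [e, h.rows_eq, h.n_eq]
    split_ifs
    · rfl
    · rw [List.flatMap_map, ← flatMap_finRange]
      refine congrArg List.flatten (List.map_congr_left fun i _ => ?_)
      exact (hg 0 i).symm
  have hout : S.transducer.outputs.flatMap (fun g : Fin _ => codeNat (g : ℕ)) =
      (List.range D.n).flatMap fun i =>
        if D.useConst i then D.gateWord D.rows i else D.gateWord (D.rows - 1) i := by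
    have e : S.transducer.outputs = (List.finRange n).map fun i => S.number (S.outCoord i) := rfl
    rw [e, h.rows_eq, h.n_eq, List.flatMap_map, ← flatMap_finRange]
    refine congrArg List.flatten (List.map_congr_left fun i _ => ?_)
    simp only [h.useConst_iff, GridSpec.outCoord]
    split_ifs
    · exact (hg (Fin.last _) i).symm
    · exact (hg ⟨S.rows - 1, by omega⟩ i).symm
  rw [NumberedTransducer.code]
  simp only [List.bind_eq_flatMap, List.pure_def, List.flatMap_assoc, List.flatMap_singleton]
  rw [hgates, hin, hout, word]

end GridData

/-! ### Writing the circuit from grid data that are computable in logarithmic space -/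

namespace Logspace

/-- A family of grid data, indexed by words, that can be computed in logarithmic space. -/
structure ComputesData (F : List Sym → GridData) : Prop where
  n : ∀ d, Num d fun x _ => (F x).n
  rows : ∀ d, Num d fun x _ => (F x).rows
  past : ∀ d, Pred d fun x _ => (F x).past
  diag : ∀ d, Pred d fun x _ => (F x).diag
  conj : ∀ d, Pred d fun x _ => (F x).conj
  mask : UPred fun x => (F x).mask
  useConst : UPred fun x => (F x).useConst
  value : UPred fun x => (F x).value

variable {F : List Sym → GridData} {d : ℕ} {g h : List Sym → (ℕ → ℕ) → ℕ}

theorem ComputesData.gateWord (hF : ComputesData F) (hg : Num d g) (hh : Num d h) :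
    Emit d fun x v => (F x).gateWord (g x v) (h x v) :=
  Emit.codeNat (hF.n d) hg hh

/-- The column `j` enters only through the word of its gate, because a successor column is provided
as a word (`Emit.codeNat_succ`) and not as a `Num`. -/
theorem ComputesData.nbWord (hF : ComputesData F) (hg : Num d g) (hh : Num d h)
    {j : List Sym → (ℕ → ℕ) → ℕ} (hj : Emit d fun x v => (F x).gateWord (g x v) (j x v)) :
    Emit d fun x v => (F x).nbWord (g x v) (h x v) (j x v) :=
  .ite (hF.diag d) (.cons .id hj) (.ite (hF.mask hh)
    ((Emit.ite (hF.conj d) (.symbol .and) (.symbol .or)).append ((hF.gateWord hg hh).append hj))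
    (.cons .id (hF.gateWord hg hh)))

theorem ComputesData.cellWord (hF : ComputesData F) (hg : Num d g) (hh : Num d h) :
    Emit d fun x v => (F x).cellWord (g x v) (h x v) := by
  have hid := Emit.cons .id (hF.gateWord hg hh)
  exact .ite (hF.past d)
    (.ite_of_decidable (.eq hh .zero) hid (hF.nbWord hg hh (hF.gateWord hg (.sub hh .one))))
    (.ite_of_decidable (.lt .one (.sub (hF.n d) hh))
      (hF.nbWord hg hh (Emit.codeNat_succ (hF.n d) hg hh)) hid)

theorem ComputesData.word (hF : ComputesData F) : Emit 0 fun x _ => (F x).word := by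
  have v0 : ∀ {d}, Num (A := Sym) (d + 1) fun _ v => v 0 := .var (Nat.succ_pos _)
  have v1 : Num (A := Sym) 2 fun _ v => v 1 := .var one_lt_two
  -- Variable `0` runs over the rows and variable `1` over the columns.
  have e1 := Emit.loop (hF.rows 0) (Emit.loop (hF.n 1) (Emit.cons .gate
    (Emit.ite_of_decidable (.eq v0 .zero) (.symbol .var) (hF.cellWord (.sub v0 .one) v1))))
  have e2 := Emit.loop (hF.n 0) (Emit.cons .gate
    (Emit.ite (hF.value (v0 (d := 0))) (.symbol .one) (.symbol .zero)))
  have e3 := Emit.cons Sym.inputs (Emit.ite_of_decidable (.eq (hF.rows 0) .zero) .nil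
    (Emit.loop (hF.n 0) (hF.gateWord .zero v0)))
  have e4 := Emit.cons Sym.outputs (Emit.loop (hF.n 0)
    (Emit.ite (hF.useConst (v0 (d := 0))) (hF.gateWord (hF.rows 1) v0)
      (hF.gateWord (.sub (hF.rows 1) .one) v0)))
  refine (((e1.append e2).append e3).append e4).congr fun x v => ?_
  have hv : ∀ j, Function.update v 0 j 0 = j := fun j => Function.update_self ..
  simp only [GridData.word, hv, zero_add, ne_eq, zero_ne_one, not_false_eq_true,
    Function.update_self, Function.update_of_ne, List.append_assoc, List.cons_append]
  congr! 6

end Logspace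

end PathCheck

namespace PathCheck

open Logspace

/-! ## Reading the argument of the circuit construction from its code -/

/-- One of the symbols of `L` occurs in the word `x`. -/
def Has (L : List Sym) (x : List Sym) : Prop := ∃ a ∈ x, a ∈ L

open Classical in
/-- The number of occurrences of the symbols of `L` in the word `x`. -/
noncomputable def occurrences (L : List Sym) (x : List Sym) : ℕ := x.countP fun a => decide (a ∈ L)

/-- The number of states. -/
noncomputable def stateCount (x : List Sym) : ℕ := occurrences [.state] x

/-- The length of the code of the bound. -/
noncomputable def boundLength (x : List Sym) : ℕ := occurrences [.tick, .endNat] x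

/-- The argument is a past operator. -/
def PastWord (x : List Sym) : Prop :=
  Has [.since, .trigger, .boundedSince, .boundedTrigger, .strongYesterday, .weakYesterday] x

/-- The argument is an operator of universal type. -/
def UniversalWord (x : List Sym) : Prop :=
  Has [.and, .release, .trigger, .boundedRelease, .boundedTrigger] x

/-- The argument is a unary operator. -/
def UnaryWord (x : List Sym) : Prop :=
  Has [.strongNext, .weakNext, .strongYesterday, .weakYesterday] x

/-- The position of the first bit of a given value sequence. -/
noncomputable def bitsStart (x : List Sym) : ℕ :=
  open Classical in
  if Has [.left] x then x.length - stateCount x - 1 - boundLength x else x.length - stateCount x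

/-- The given value sequence is true at the position `i`. -/
def BitAt (x : List Sym) (i : ℕ) : Prop :=
  ∃ q < x.length + 1, x[q]? = some .one ∧ ¬ q < bitsStart x ∧ q - bitsStart x = i

/-- The value at the position `i` does not decide the value of the operator. -/
def Neutral (x : List Sym) (i : ℕ) : Prop := BitAt x i ↔ UniversalWord x

/-- At the positions `u` and `w` the word has the same bit, or no bit. -/
def SameBit (x : List Sym) (u w : ℕ) : Prop :=
  (x[u]? = some .zero ↔ x[w]? = some .zero) ∧ (x[u]? = some .one ↔ x[w]? = some .one)

/-- After the position `q` the word has the same bits as after the position `q₀`. -/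
def SameBits (x : List Sym) (q q₀ : ℕ) : Prop :=
  ∀ w < x.length + 1, q₀ < w → ∃ u < x.length + 1, q < u ∧ w - q₀ = u - q ∧ SameBit x u w

/-- The position `q` contains the start of a proposition that is true in the state `i`. -/
def PropAt (x : List Sym) (q i : ℕ) : Prop :=
  x[q]? = some .prop ∧ occurrences [.state] (x.take q) ≠ 0 ∧
    occurrences [.state] (x.take q) - 1 = i

/-- The given atomic proposition is true in the state `i`. -/
def AtomTrue (x : List Sym) (i : ℕ) : Prop :=
  ∃ q₀ < x.length + 1, x[q₀]? = some .atom ∧ ∃ q < x.length + 1, PropAt x q i ∧ SameBits x q q₀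

/-- The number of rows of the circuit. -/
noncomputable def rowCount (x : List Sym) : ℕ :=
  open Classical in
  if Has [.or, .and] x then 1 else if UnaryWord x then min 2 (x.length + 1)
  else if Has [.atom] x then 0 else if boundLength x = 0 then stateCount x else boundLength x

/-- The neighbor of the position `i` exists and is neutral. -/
def NeutralNeighbor (x : List Sym) (i : ℕ) : Prop :=
  (PastWord x ∧ ¬ i = 0 ∧ Neutral x (i - 1)) ∨
    (¬ PastWord x ∧ ∃ j < stateCount x, j - i = 1 ∧ Neutral x j)

/-- The neighbor of the position `i` exists. -/
def HasNeighbor (x : List Sym) (i : ℕ) : Prop :=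
  (PastWord x ∧ ¬ i = 0) ∨ (¬ PastWord x ∧ 1 < stateCount x - i)

/-- The operator refers from the position `i` to a position that is not neutral. -/
def Decided (x : List Sym) (i : ℕ) : Prop :=
  ∃ j < stateCount x, ((PastWord x ∧ ¬ i < j ∧ i - j < rowCount x) ∨
    (¬ PastWord x ∧ ¬ j < i ∧ j - i < rowCount x)) ∧ ¬ Neutral x j

/-- The data of the circuit for the argument that is given by a word. -/
noncomputable def wordData (x : List Sym) : GridData where
  n := stateCount x
  rows := rowCount x
  past := PastWord x
  diag := UnaryWord x
  conj := Has [.left, .right] x ∧ (UniversalWord x ↔ Has [.left] x)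
  mask i := (Has [.left] x ∧ ¬ Neutral x i) ∨ (Has [.right] x ∧ NeutralNeighbor x i)
  useConst i := Has [.atom] x ∨ (UnaryWord x ∧ ¬ HasNeighbor x i) ∨
    (Has [.or, .and] x ∧ ¬ Neutral x i) ∨
    (Has [.right] x ∧ ¬ Has [.or, .and] x ∧ ¬ (Neutral x i ∧ Decided x i))
  value i := (Has [.atom] x ∧ AtomTrue x i) ∨ Has [.weakNext, .weakYesterday] x ∨
    (Has [.left, .right] x ∧ BitAt x i)

/-! ### Logspace computability of the data read from a word -/

namespace Logspace

variable {d : ℕ} {f g h : List Sym → (ℕ → ℕ) → ℕ}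

theorem Pred.equiv {P Q : List Sym → (ℕ → ℕ) → Prop} (hP : Pred d P) (hQ : Pred d Q) :
    Pred d fun x v => P x v ↔ Q x v :=
  ((hP.and hQ).or (hP.not.and hQ.not)).iff fun x v => by tauto

theorem Num.ite_of_decidable {P : List Sym → (ℕ → ℕ) → Prop} [∀ x v, Decidable (P x v)]
    (hP : Pred d P) (hf : Num d f) (hg : Num d g) :
    Num d fun x v => if P x v then f x v else g x v :=
  (Num.ite hP hf hg).congr fun x v => by split_ifs <;> rfl

theorem Pred.hasOf (L : List Sym) : Pred d fun x _ => Has L x := Pred.has fun a => a ∈ L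

theorem Pred.symbolEq (hg : Num d g) (s : Sym) : Pred d fun x v => x[g x v]? = some s :=
  (Pred.symbolAt hg fun a => a = s).iff fun x v => by simp

theorem Num.occurrences (L : List Sym) (hg : Num d g) :
    Num d fun x v => occurrences L (x.take (g x v)) :=
  (Num.countTake hg fun a => a ∈ L).congr fun x v => List.countP_congr fun a _ => by simp

theorem Num.stateCount : Num d fun x _ => stateCount x :=
  (Num.occurrences _ .length).congr fun x _ => by rw [List.take_length]; rfl

theorem Num.boundLength : Num d fun x _ => boundLength x :=
  (Num.occurrences _ .length).congr fun x _ => by rw [List.take_length]; rfl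

theorem Num.bitsStart : Num d fun x _ => bitsStart x :=
  .ite (.hasOf _) (.sub (.sub (.sub .length .stateCount) .one) .boundLength)
    (.sub .length .stateCount)

theorem Pred.bitAt : UPred BitAt := fun {d g} hg => by
  have v0 : Num (A := Sym) (d + 1) fun _ v => v d := .var (Nat.lt_succ_self d)
  refine (Pred.exists .top ((Pred.symbolEq v0 .one).and ((Pred.lt v0 .bitsStart).not.and
    (.eq (.sub v0 .bitsStart) (hg.mono (Nat.le_succ d)))))).iff fun x v => ?_
  simp [BitAt, hg.update]

theorem Pred.universalWord : Pred d fun x _ => UniversalWord x := .hasOf _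

theorem Pred.pastWord : Pred d fun x _ => PastWord x := .hasOf _

theorem Pred.unaryWord : Pred d fun x _ => UnaryWord x := .hasOf _

theorem Pred.neutral : UPred Neutral := fun hg => (Pred.bitAt hg).equiv .universalWord

theorem Pred.sameBit (hf : Num d f) (hg : Num d g) :
    Pred d fun x v => SameBit x (f x v) (g x v) :=
  ((Pred.symbolEq hf _).equiv (.symbolEq hg _)).and ((Pred.symbolEq hf _).equiv (.symbolEq hg _))

theorem Pred.sameBits (hf : Num d f) (hg : Num d g) :
    Pred d fun x v => SameBits x (f x v) (g x v) := by
  have v0 : Num (A := Sym) (d + 1) fun _ v => v d := .var (by omega)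
  have v0' : Num (A := Sym) (d + 2) fun _ v => v d := .var (by omega)
  have v1 : Num (A := Sym) (d + 2) fun _ v => v (d + 1) := .var (by omega)
  have hf1 := hf.mono (Nat.le_succ d)
  have hg1 := hg.mono (Nat.le_succ d)
  have hf2 := hf1.mono (Nat.le_succ (d + 1))
  have hg2 := hg1.mono (Nat.le_succ (d + 1))
  have e := Pred.exists (d := d + 1) .top ((Pred.lt hf2 v1).and
    ((Pred.eq (.sub v0' hg2) (.sub v1 hf2)).and (.sameBit v1 v0')))
  refine (Pred.forall .top ((Pred.lt hg1 v0).not.or e)).iff fun x v => ?_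
  simp [SameBits, hf.update, hg.update, hf1.update, hg1.update, imp_iff_not_or]

theorem Pred.propAt (hf : Num d f) (hg : Num d g) :
    Pred d fun x v => PropAt x (f x v) (g x v) := by
  have hc := Num.occurrences [.state] hf
  exact (Pred.symbolEq hf _).and ((Pred.eq hc .zero).not.and (.eq (.sub hc .one) hg))

theorem Pred.atomTrue : UPred AtomTrue := fun {d g} hg => by
  have v0 : Num (A := Sym) (d + 1) fun _ v => v d := .var (by omega)
  have v0' : Num (A := Sym) (d + 2) fun _ v => v d := .var (by omega)
  have v1 : Num (A := Sym) (d + 2) fun _ v => v (d + 1) := .var (by omega)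
  have hg1 := hg.mono (Nat.le_succ d)
  have hg2 := hg1.mono (Nat.le_succ (d + 1))
  refine (Pred.exists .top ((Pred.symbolEq v0 .atom).and (Pred.exists .top
    ((Pred.propAt v1 hg2).and (Pred.sameBits v1 v0'))))).iff fun x v => ?_
  simp [AtomTrue, hg.update, hg1.update]

theorem Num.rowCount : Num d fun x _ => rowCount x :=
  .ite (.hasOf _) .one (.ite .unaryWord .two (.ite (.hasOf _) .zero
    (.ite_of_decidable (.eq .boundLength .zero) .stateCount .boundLength)))

theorem Pred.neutralNeighbor : UPred NeutralNeighbor := fun {d g} hg => by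
  have v0 : Num (A := Sym) (d + 1) fun _ v => v d := .var (by omega)
  have e := Pred.exists .stateCount ((Pred.eq (.sub v0 (hg.mono (Nat.le_succ d))) .one).and
    (Pred.neutral v0))
  refine ((Pred.pastWord.and ((Pred.eq hg .zero).not.and (Pred.neutral (.sub hg .one)))).or
    (Pred.pastWord.not.and e)).iff fun x v => ?_
  simp [NeutralNeighbor, hg.update]

theorem Pred.hasNeighbor : UPred HasNeighbor := fun hg =>
  (Pred.pastWord.and (Pred.eq hg .zero).not).or
    (Pred.pastWord.not.and (.lt .one (.sub .stateCount hg)))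

theorem Pred.decided : UPred Decided := fun {d g} hg => by
  have v0 : Num (A := Sym) (d + 1) fun _ v => v d := .var (by omega)
  have hg1 := hg.mono (Nat.le_succ d)
  refine (Pred.exists .stateCount (((Pred.pastWord.and ((Pred.lt hg1 v0).not.and
    (.lt (.sub hg1 v0) .rowCount))).or (Pred.pastWord.not.and ((Pred.lt v0 hg1).not.and
    (.lt (.sub v0 hg1) .rowCount)))).and (Pred.neutral v0).not)).iff fun x v => ?_
  simp [Decided, hg.update]

theorem computesData_wordData : ComputesData wordData where
  n _ := .stateCount
  rows _ := .rowCount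
  past _ := .pastWord
  diag _ := .unaryWord
  conj _ := (Pred.hasOf _).and (Pred.universalWord.equiv (.hasOf _))
  mask hg := ((Pred.hasOf _).and (Pred.neutral hg).not).or
    ((Pred.hasOf _).and (Pred.neutralNeighbor hg))
  useConst hg := (Pred.hasOf _).or ((Pred.unaryWord.and (Pred.hasNeighbor hg).not).or
    (((Pred.hasOf _).and (Pred.neutral hg).not).or ((Pred.hasOf _).and
    ((Pred.hasOf _).not.and ((Pred.neutral hg).and (Pred.decided hg)).not))))
  value hg := ((Pred.hasOf _).and (Pred.atomTrue hg)).or ((Pred.hasOf _).or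
    ((Pred.hasOf _).and (Pred.bitAt hg)))

end Logspace

end PathCheck

namespace PathCheck

/-! ## The symbols of an argument -/

variable {P : Type*} {name : P → List Bool} {n : ℕ} {L x y : List Sym}

/-- The symbols that do not determine the kind of an argument. -/
def Sym.IsPlain (a : Sym) : Prop := a ∈ [Sym.zero, .one, .tick, .endNat, .state, .prop]

/-- The symbol of a binary operator. -/
def BinOp.symbol : BinOp → Sym
  | .or => .or
  | .and => .and
  | .until => .until
  | .release => .release
  | .since => .since
  | .trigger => .trigger
  | .boundedUntil _ => .boundedUntil
  | .boundedRelease _ => .boundedRelease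
  | .boundedSince _ => .boundedSince
  | .boundedTrigger _ => .boundedTrigger

/-- The code of the bound of a binary operator. -/
def BinOp.boundCode : BinOp → List Sym
  | .boundedUntil b => codeNat b
  | .boundedRelease b => codeNat b
  | .boundedSince b => codeNat b
  | .boundedTrigger b => codeNat b
  | _ => []

theorem BinOp.code_eq (op : BinOp) : op.code = op.symbol :: op.boundCode := by
  cases op <;> rfl

/-- The symbols of an argument that determine its kind. -/
def CirArg.symbols : CirArg P n → List Sym
  | .atom _ => [.atom]
  | .unary op => op.code
  | .left _ op => [.left, op.symbol]
  | .right op _ => [.right, op.symbol]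

theorem eq_of_mem_codeBits {w : List Bool} {a : Sym} (h : a ∈ codeBits w) :
    a = .zero ∨ a = .one := by
  obtain ⟨b, -, rfl⟩ := List.mem_map.mp h
  cases b <;> simp

theorem eq_of_mem_codeNat {k : ℕ} {a : Sym} (h : a ∈ codeNat k) : a = .tick ∨ a = .endNat := by
  simp only [codeNat, List.mem_append, List.mem_replicate, List.mem_singleton] at h
  tauto

theorem eq_of_mem_boundCode {op : BinOp} {a : Sym} (h : a ∈ op.boundCode) :
    a = .tick ∨ a = .endNat := by
  cases op <;> first | exact eq_of_mem_codeNat h | exact absurd h List.not_mem_nil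

theorem eq_of_mem_codeState {l : List P} {a : Sym} (h : a ∈ codeState name l) :
    a = .state ∨ a = .prop ∨ a = .zero ∨ a = .one := by
  rcases List.mem_cons.mp h with rfl | h
  · simp
  · obtain ⟨p, -, h⟩ := List.mem_flatMap.mp h
    rcases List.mem_cons.mp h with rfl | h
    · simp
    · rcases eq_of_mem_codeBits h with rfl | rfl <;> simp

theorem has_append : Has L (x ++ y) ↔ Has L x ∨ Has L y := by
  simp [Has, or_and_right, exists_or]

theorem has_cons {a : Sym} : Has L (a :: x) ↔ a ∈ L ∨ Has L x := by
  simp [Has]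

theorem has_nil : ¬ Has L [] := by
  simp [Has]

theorem not_has (h : ∀ a ∈ x, a ∉ L) : ¬ Has L x := fun ⟨a, ha, haL⟩ => h a ha haL

/-- States, names, value sequences and bounds are written with plain symbols only. So any other
symbol belongs to the argument and reveals its kind, wherever it stands in the word. -/
theorem CirInput.Presented.has_iff {z : CirInput P} (hx : z.Presented name x)
    (hL : ∀ a ∈ L, ¬ a.IsPlain) : Has L x ↔ Has L z.arg.symbols := by
  have hz : Sym.zero ∉ L := fun h => hL _ h (by simp [Sym.IsPlain])
  have ho : Sym.one ∉ L := fun h => hL _ h (by simp [Sym.IsPlain])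
  have ht : Sym.tick ∉ L := fun h => hL _ h (by simp [Sym.IsPlain])
  have he : Sym.endNat ∉ L := fun h => hL _ h (by simp [Sym.IsPlain])
  have hs : Sym.state ∉ L := fun h => hL _ h (by simp [Sym.IsPlain])
  have hp : Sym.prop ∉ L := fun h => hL _ h (by simp [Sym.IsPlain])
  obtain ⟨l, -, rfl⟩ := hx
  have h1 : ¬ Has L ((List.ofFn l).flatMap (codeState name)) := not_has fun a ha => by
    obtain ⟨m, -, ha⟩ := List.mem_flatMap.mp ha
    rcases eq_of_mem_codeState ha with rfl | rfl | rfl | rfl <;> assumption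
  have h2 : ∀ w, ¬ Has L (codeBits w) := fun w => not_has fun a ha => by
    rcases eq_of_mem_codeBits ha with rfl | rfl <;> assumption
  have h3 : ∀ op : BinOp, ¬ Has L op.boundCode := fun op => not_has fun a ha => by
    rcases eq_of_mem_boundCode ha with rfl | rfl <;> assumption
  rw [has_append, or_iff_right h1]
  cases z.arg <;>
    simp [CirArg.code, CirArg.symbols, BinOp.code_eq, has_append, has_cons, h2, h3, has_nil]

theorem occurrences_append : occurrences L (x ++ y) = occurrences L x + occurrences L y :=
  List.countP_append

theorem occurrences_cons_of_mem {a : Sym} (h : a ∈ L) :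
    occurrences L (a :: x) = occurrences L x + 1 := by
  simp [occurrences, h]

theorem occurrences_cons_of_notMem {a : Sym} (h : a ∉ L) :
    occurrences L (a :: x) = occurrences L x := by
  simp [occurrences, h]

theorem occurrences_eq_zero (h : ∀ a ∈ x, a ∉ L) : occurrences L x = 0 := by
  simpa [occurrences, List.countP_eq_zero] using h

theorem occurrences_eq_length (h : ∀ a ∈ x, a ∈ L) : occurrences L x = x.length := by
  simpa [occurrences, List.countP_eq_length] using h

theorem occurrences_state_codeState (l : List P) : occurrences [.state] (codeState name l) = 1 := by
  rw [codeState, occurrences_cons_of_mem (by simp), occurrences_eq_zero]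
  intro a ha
  obtain ⟨p, -, h⟩ := List.mem_flatMap.mp ha
  rcases List.mem_cons.mp h with rfl | h
  · simp
  · rcases eq_of_mem_codeBits h with rfl | rfl <;> simp

theorem occurrences_state_flatMap (m : List (List P)) :
    occurrences [.state] (m.flatMap (codeState name)) = m.length := by
  induction m with
  | nil => rfl
  | cons l m ih =>
    rw [List.flatMap_cons, occurrences_append, ih, occurrences_state_codeState, List.length_cons,
      add_comm]

theorem eq_of_mem_arg {a : CirArg P n} {c : Sym} (h : c ∈ a.code name) :
    c ∈ a.symbols ∨ c = .zero ∨ c = .one ∨ c = .tick ∨ c = .endNat := by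
  have hb : ∀ w, c ∈ codeBits w → c = .zero ∨ c = .one := fun w => eq_of_mem_codeBits
  have hc : ∀ op : BinOp, c ∈ op.boundCode → c = .tick ∨ c = .endNat :=
    fun op => eq_of_mem_boundCode
  cases a with
  | atom p =>
    have := hb (name p)
    simp only [CirArg.code, CirArg.symbols, List.mem_cons] at *
    tauto
  | unary op => exact .inl h
  | left s op | right op s =>
    have := hb (List.ofFn s)
    have := hc op
    simp only [CirArg.code, CirArg.symbols, List.mem_cons, List.mem_append, BinOp.code_eq] at *
    tauto

theorem not_isPlain_of_mem_symbols {a : CirArg P n} {c : Sym} (h : c ∈ a.symbols) :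
    ¬ c.IsPlain := by
  cases a with
  | atom p => simp_all [CirArg.symbols, Sym.IsPlain]
  | unary op => cases op <;> simp_all [CirArg.symbols, Sym.IsPlain, UnOp.code]
  | left s op | right op s =>
    rcases List.mem_pair.mp h with rfl | rfl
    · simp [Sym.IsPlain]
    · cases op <;> simp [Sym.IsPlain, BinOp.symbol]

/-- The symbol `state` opens each state and occurs nowhere else. -/
theorem CirInput.Presented.stateCount_eq {z : CirInput P} (hx : z.Presented name x) :
    stateCount x = z.n := by
  obtain ⟨l, -, rfl⟩ := hx
  rw [stateCount, occurrences_append, occurrences_state_flatMap, occurrences_eq_zero,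
    List.length_ofFn, add_zero]
  intro a ha
  rcases eq_of_mem_arg ha with h | rfl | rfl | rfl | rfl
  · intro h'
    exact not_isPlain_of_mem_symbols h (by simp_all [Sym.IsPlain])
  all_goals simp

/-- The code of the bound of an argument. -/
def CirArg.boundCode : CirArg P n → List Sym
  | .left _ op => op.boundCode
  | .right op _ => op.boundCode
  | _ => []

/-- The symbols `tick` and `endNat` occur in bounds only. The code of a bound `b` has length `b +
1`, which is the number of rows for a bounded operator; without a bound the length is zero. -/
theorem CirInput.Presented.boundLength_eq {z : CirInput P} (hx : z.Presented name x) :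
    boundLength x = z.arg.boundCode.length := by
  have h2 : ∀ w, occurrences [.tick, .endNat] (codeBits w) = 0 :=
    fun w => occurrences_eq_zero fun a ha => by
      rcases eq_of_mem_codeBits ha with rfl | rfl <;> simp
  have h3 : ∀ op : BinOp, occurrences [.tick, .endNat] op.boundCode = op.boundCode.length :=
    fun op => occurrences_eq_length fun a ha => by
      rcases eq_of_mem_boundCode ha with rfl | rfl <;> simp
  have h4 : ∀ op : BinOp, op.symbol ∉ [Sym.tick, .endNat] := fun op => by
    cases op <;> simp [BinOp.symbol]
  obtain ⟨l, -, rfl⟩ := hx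
  rw [boundLength, occurrences_append, occurrences_eq_zero, zero_add]
  · cases z.arg with
    | atom p =>
      rw [CirArg.code, occurrences_cons_of_notMem (by simp), h2]
      rfl
    | unary op => cases op <;> exact occurrences_cons_of_notMem (by simp)
    | left s op =>
      rw [CirArg.code, occurrences_cons_of_notMem (by simp), occurrences_append, h2, BinOp.code_eq,
        occurrences_cons_of_notMem (h4 op), h3, zero_add]
      rfl
    | right op s =>
      rw [CirArg.code, occurrences_cons_of_notMem (by simp), occurrences_append, h2, BinOp.code_eq,
        occurrences_cons_of_notMem (h4 op), h3, add_zero]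
      rfl
  · intro a ha
    obtain ⟨m, -, ha⟩ := List.mem_flatMap.mp ha
    rcases eq_of_mem_codeState ha with rfl | rfl | rfl | rfl <;> simp

/-! ## Reading value sequences -/

theorem bitAt_iff {i : ℕ} : BitAt x i ↔ x[bitsStart x + i]? = some .one := by
  constructor
  · rintro ⟨q, -, h1, h2, h3⟩
    rwa [← h3, Nat.add_sub_cancel' (not_lt.mp h2)]
  · intro h
    obtain ⟨hq, -⟩ := List.getElem?_eq_some_iff.mp h
    exact ⟨_, by omega, h, by omega, by omega⟩

theorem bitAt_of_eq {s : Fin n → Bool} {u w : List Sym}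
    (e : x = u ++ (codeBits (List.ofFn s) ++ w)) (h : bitsStart x = u.length) (i : Fin n) :
    BitAt x i ↔ s i = true := by
  rw [bitAt_iff, h, e, List.getElem?_append_right (by omega), Nat.add_sub_cancel_left,
    List.getElem?_append_left (by simp [codeBits])]
  simp only [codeBits, List.getElem?_map, List.getElem?_ofFn, i.2, dif_pos, Option.map_some]
  cases s i <;> simp

/-- The value sequence has one bit per state and is followed by one operator symbol and the bound,
so its start is found by counting from the end of the word. -/
theorem CirInput.Presented.bitAt_left {ρ : Fin n → Set P} {s : Fin n → Bool} {op : BinOp}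
    (hx : CirInput.Presented name ⟨n, ρ, .left s op⟩ x) (i : Fin n) : BitAt x i ↔ s i = true := by
  have h1 := hx.stateCount_eq
  have h2 := hx.boundLength_eq
  have h3 : Has [.left] x := (hx.has_iff (by simp [Sym.IsPlain])).mpr ⟨.left, by
    simp [CirArg.symbols], by simp⟩
  obtain ⟨l, -, e⟩ := hx
  refine bitAt_of_eq (u := (List.ofFn l).flatMap (codeState name) ++ [.left]) (w := op.code)
    (by simp [e, CirArg.code]) ?_ i
  rw [bitsStart, if_pos h3, h1, h2, e]
  simp only [CirArg.code, CirArg.boundCode, BinOp.code_eq, codeBits, List.length_append,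
    List.length_cons, List.length_map, List.length_ofFn, List.length_nil]
  omega

theorem CirInput.Presented.bitAt_right {ρ : Fin n → Set P} {s : Fin n → Bool} {op : BinOp}
    (hx : CirInput.Presented name ⟨n, ρ, .right op s⟩ x) (i : Fin n) : BitAt x i ↔ s i = true := by
  have h1 := hx.stateCount_eq
  have h3 : ¬ Has [.left] x := by
    rw [hx.has_iff (by simp [Sym.IsPlain])]
    cases op <;> simp [Has, CirArg.symbols, BinOp.symbol]
  obtain ⟨l, -, e⟩ := hx
  refine bitAt_of_eq (u := (List.ofFn l).flatMap (codeState name) ++ .right :: op.code) (w := [])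
    (by simp [e, CirArg.code]) ?_ i
  rw [bitsStart, if_neg h3, h1, e]
  simp only [CirArg.code, codeBits, List.length_append, List.length_cons, List.length_map,
    List.length_ofFn]
  omega

/-! ## Reading atomic propositions -/

/-- The word consists of the bits `b`, followed by a symbol that is not a bit and further
symbols. -/
def StartsWith (b : List Bool) (x : List Sym) : Prop :=
  ∃ c w, x = codeBits b ++ c :: w ∧ c ≠ .zero ∧ c ≠ .one

/-- The proposition with the name `b` occurs in `x` after `i` states. -/
def PropOccurs (b : List Bool) (x : List Sym) (i : ℕ) : Prop :=
  ∃ q, x[q]? = some .prop ∧ occurrences [.state] (x.take q) = i ∧ StartsWith b (x.drop (q + 1))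

theorem propOccurs_cons {b : List Bool} {a : Sym} {i : ℕ} :
    PropOccurs b (a :: x) i ↔ (a = .prop ∧ i = 0 ∧ StartsWith b x) ∨
      ∃ j, occurrences [.state] [a] + j = i ∧ PropOccurs b x j := by
  constructor
  · rintro ⟨q, h1, h2, h3⟩
    cases q with
    | zero => exact .inl ⟨by simpa using h1, h2.symm, by simpa using h3⟩
    | succ q =>
      refine .inr ⟨_, ?_, q, by simpa using h1, rfl, by simpa using h3⟩
      rw [← h2, ← occurrences_append]
      simp
  · rintro (⟨rfl, rfl, h⟩ | ⟨j, rfl, q, h1, h2, h3⟩)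
    · exact ⟨0, by simp, rfl, by simpa using h⟩
    · refine ⟨q + 1, by simpa using h1, ?_, by simpa using h3⟩
      rw [← h2, ← occurrences_append]
      simp

theorem propOccurs_cons_of_ne {b : List Bool} {a : Sym} {i : ℕ} (h1 : a ≠ .prop)
    (h2 : a ≠ .state) : PropOccurs b (a :: x) i ↔ PropOccurs b x i := by
  rw [propOccurs_cons, occurrences_cons_of_notMem (by simpa using h2)]
  simp [h1, occurrences]

theorem propOccurs_state {b : List Bool} {i : ℕ} :
    PropOccurs b (.state :: x) i ↔ ∃ j, i = j + 1 ∧ PropOccurs b x j := by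
  rw [propOccurs_cons, occurrences_cons_of_mem (by simp)]
  simp [occurrences, add_comm, eq_comm]

theorem propOccurs_prop {b : List Bool} {i : ℕ} :
    PropOccurs b (.prop :: x) i ↔ (i = 0 ∧ StartsWith b x) ∨ PropOccurs b x i := by
  rw [propOccurs_cons, occurrences_cons_of_notMem (by simp)]
  simp [occurrences]

theorem propOccurs_codeBits_append {b w : List Bool} {i : ℕ} :
    PropOccurs b (codeBits w ++ x) i ↔ PropOccurs b x i := by
  induction w with
  | nil => rfl
  | cons c w ih =>
    rw [← ih]
    exact propOccurs_cons_of_ne (by cases c <;> simp) (by cases c <;> simp)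

/-- The longest initial run of bits will do; it ends before `a` at the latest. -/
theorem exists_startsWith {a : Sym} (h : a ∈ x) (h0 : a ≠ .zero) (h1 : a ≠ .one) :
    ∃ b, StartsWith b x := by
  induction x with
  | nil => exact absurd h List.not_mem_nil
  | cons c x ih =>
    by_cases hc : c = .zero ∨ c = .one
    · obtain ⟨b, d, w, rfl, hd⟩ := ih ((List.mem_cons.mp h).resolve_left
        (by rintro rfl; exact hc.elim h0 h1))
      rcases hc with rfl | rfl
      · exact ⟨false :: b, d, w, rfl, hd⟩
      · exact ⟨true :: b, d, w, rfl, hd⟩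
    · rw [not_or] at hc
      exact ⟨[], c, x, rfl, hc⟩

/-- The first symbol that is not a bit marks the end of the name, so the name is determined by the
word. -/
theorem startsWith_codeBits {b w : List Bool} {c : Sym} (h0 : c ≠ .zero) (h1 : c ≠ .one) :
    StartsWith b (codeBits w ++ c :: x) ↔ b = w := by
  constructor
  · rintro ⟨a, u, e, h2, h3⟩
    induction b generalizing w with
    | nil =>
      cases w with
      | nil => rfl
      | cons t w =>
        have := (List.cons.inj e).1
        cases t <;> simp_all
    | cons s b ih =>
      cases w with
      | nil =>
        have := (List.cons.inj e).1
        cases s <;> simp_all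
      | cons t w =>
        obtain ⟨e1, e2⟩ := List.cons.inj e
        rw [ih e2]
        cases s <;> cases t <;> simp_all
  · rintro rfl
    exact ⟨c, x, rfl, h0, h1⟩

/-- Each name is followed by a symbol that is not a bit: the next `prop`, or `c` after the last
name. -/
theorem propOccurs_flatMap_append {b : List Bool} {l : List P} {c : Sym} {i : ℕ} (h0 : c ≠ .zero)
    (h1 : c ≠ .one) :
    PropOccurs b ((l.flatMap fun p => .prop :: codeBits (name p)) ++ c :: x) i ↔
      (i = 0 ∧ ∃ p ∈ l, b = name p) ∨ PropOccurs b (c :: x) i := by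
  induction l with
  | nil => simp
  | cons p l ih =>
    rw [List.flatMap_cons, List.append_assoc, List.cons_append, propOccurs_prop,
      propOccurs_codeBits_append, ih]
    have : StartsWith b (codeBits (name p) ++
        ((l.flatMap fun p => .prop :: codeBits (name p)) ++ c :: x)) ↔ b = name p := by
      cases l with
      | nil => exact startsWith_codeBits h0 h1
      | cons p' l => exact startsWith_codeBits (by simp) (by simp)
    rw [this]
    simp only [List.mem_cons, exists_eq_or_imp, and_or_left, or_assoc]

/-- The count is shifted by one because a proposition stands behind the `state` symbol of its own
state. -/
theorem propOccurs_states {b : List Bool} {m : List (List P)} {w : List Bool} {i : ℕ} :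
    PropOccurs b (m.flatMap (codeState name) ++ .atom :: codeBits w) (i + 1) ↔
      ∃ l, m[i]? = some l ∧ ∃ p ∈ l, b = name p := by
  have hend : ∀ j, ¬ PropOccurs b (.atom :: codeBits w) j := by
    intro j
    rw [propOccurs_cons_of_ne (by simp) (by simp), ← List.append_nil (codeBits w),
      propOccurs_codeBits_append]
    rintro ⟨q, h, -⟩
    simp at h
  induction m generalizing i with
  | nil => simp [hend]
  | cons l m ih =>
    have h0 : ¬ PropOccurs b (m.flatMap (codeState name) ++ .atom :: codeBits w) 0 := by
      cases m with
      | nil => exact hend 0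
      | cons l m =>
        rw [List.flatMap_cons, codeState, List.append_assoc, List.cons_append, propOccurs_state]
        simp
    have hc : ∃ c u, m.flatMap (codeState name) ++ .atom :: codeBits w = c :: u ∧ c ≠ .zero ∧
        c ≠ .one := by
      cases m with
      | nil => exact ⟨_, _, rfl, by simp, by simp⟩
      | cons l m => exact ⟨_, _, rfl, by simp, by simp⟩
    obtain ⟨c, u, e, hc0, hc1⟩ := hc
    rw [List.flatMap_cons, List.append_assoc, codeState, List.cons_append, propOccurs_state]
    simp only [Nat.add_right_cancel_iff, exists_eq_left']
    rw [e, propOccurs_flatMap_append hc0 hc1, ← e]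
    cases i with
    | zero => simp [h0]
    | succ i => simp [ih]

/-- The index `k = w.length` is included: `w` has no bit there, which forces `b` to end as well. -/
theorem sameBits_iff {u : List Sym} {b w : List Bool} {c : Sym} (h0 : c ≠ .zero) (h1 : c ≠ .one) :
    (∀ k ≤ w.length,
      ((codeBits b ++ c :: u)[k]? = some .zero ↔ (codeBits w)[k]? = some .zero) ∧
      ((codeBits b ++ c :: u)[k]? = some .one ↔ (codeBits w)[k]? = some .one)) ↔ w = b := by
  induction b generalizing w with
  | nil =>
    cases w with
    | nil => simp [codeBits, h0, h1]
    | cons t w =>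
      simp only [reduceCtorEq, iff_false]
      intro h
      have := h 0 (Nat.zero_le _)
      cases t <;> simp_all [codeBits]
  | cons s b ih =>
    cases w with
    | nil =>
      simp only [reduceCtorEq, iff_false]
      intro h
      have := h 0 (Nat.zero_le _)
      cases s <;> simp_all [codeBits]
    | cons t w =>
      rw [List.cons.injEq, ← ih]
      constructor
      · intro h
        refine ⟨?_, fun k hk => by simpa [codeBits] using h (k + 1) (by simpa using hk)⟩
        have := h 0 (Nat.zero_le _)
        cases s <;> cases t <;> simp_all [codeBits]
      · rintro ⟨rfl, h⟩ k hk
        cases k with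
        | zero => simp [codeBits]
        | succ k => simpa [codeBits] using h k (by simpa using hk)

/-- Positions are replaced by their offsets `k`. The quantifier in `SameBits` extends to the
position just behind the word, hence `≤`. -/
theorem sameBits_iff_drop {q q₀ : ℕ} (h : q < q₀) (h₀ : q₀ < x.length) :
    SameBits x q q₀ ↔ ∀ k ≤ (x.drop (q₀ + 1)).length,
      ((x.drop (q + 1))[k]? = some .zero ↔ (x.drop (q₀ + 1))[k]? = some .zero) ∧
      ((x.drop (q + 1))[k]? = some .one ↔ (x.drop (q₀ + 1))[k]? = some .one) := by
  simp only [List.getElem?_drop, List.length_drop]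
  constructor
  · intro hs k hk
    obtain ⟨u, -, hu, hu', hb⟩ := hs (q₀ + 1 + k) (by omega) (by omega)
    obtain rfl : u = q + 1 + k := by omega
    exact hb
  · intro hs w hw hw'
    obtain ⟨k, rfl⟩ : ∃ k, w = q₀ + 1 + k := ⟨w - (q₀ + 1), by omega⟩
    exact ⟨q + 1 + k, by omega, by omega, by omega, hs k (by omega)⟩

/-- The name in the argument ends with the word, a name in a state ends at the next symbol that is
not a bit, and `SameBits` compares them including their ends. As `name` is injective, equal names
mean equal propositions, whatever the order in the lists. -/
theorem CirInput.Presented.atomTrue_iff (hname : Function.Injective name) {ρ : Fin n → Set P}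
    {p : P} (hx : CirInput.Presented name ⟨n, ρ, .atom p⟩ x) (i : Fin n) :
    AtomTrue x i ↔ p ∈ ρ i := by
  obtain ⟨l, hl, e⟩ := hx
  simp only at l hl e
  set S := (List.ofFn l).flatMap (codeState name) with hS
  have hdrop : x.drop (S.length + 1) = codeBits (name p) := by
    rw [e, ← List.drop_drop, List.drop_left]; rfl
  have hlen : S.length < x.length := by rw [e]; simp [CirArg.code]
  -- The symbol `atom` occurs only at the start of the argument.
  have hatom : ∀ q, x[q]? = some .atom ↔ q = S.length := by
    intro q
    constructor
    · intro h
      rw [e] at h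
      rcases lt_trichotomy q S.length with hq | hq | hq
      · rw [List.getElem?_append_left hq] at h
        obtain ⟨m, -, ha⟩ := List.mem_flatMap.mp (List.mem_of_getElem? h)
        simpa using eq_of_mem_codeState ha
      · exact hq
      · rw [List.getElem?_append_right hq.le, CirArg.code, List.getElem?_cons,
          if_neg (by omega)] at h
        simpa using eq_of_mem_codeBits (List.mem_of_getElem? h)
    · rintro rfl
      rw [e, List.getElem?_append_right le_rfl]
      simp [CirArg.code]
  have hprop : ∀ q, x[q]? = some .prop → q < S.length := by
    intro q h
    by_contra hq
    rw [e, List.getElem?_append_right (not_lt.mp hq)] at h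
    rcases List.mem_cons.mp (List.mem_of_getElem? h) with h | h
    · simp at h
    · simpa using eq_of_mem_codeBits h
  have hocc : PropOccurs (name p) x (i + 1) ↔ p ∈ ρ i := by
    rw [e, CirArg.code, hS, propOccurs_states, hl i]
    simp [hname.eq_iff]
  rw [← hocc]
  have hstart : ∀ q, x[q]? = some .prop → ∃ b, StartsWith b (x.drop (q + 1)) := by
    intro q hq
    refine exists_startsWith (a := .atom) ?_ (by simp) (by simp)
    refine List.mem_of_getElem? (i := S.length - (q + 1)) ?_
    have := hprop q hq
    rw [List.getElem?_drop, hatom]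
    omega
  have key : ∀ q, x[q]? = some .prop →
      (SameBits x q S.length ↔ StartsWith (name p) (x.drop (q + 1))) := by
    intro q hq
    obtain ⟨b, c, u, hb, hc0, hc1⟩ := hstart q hq
    rw [sameBits_iff_drop (hprop q hq) hlen, hdrop, hb, startsWith_codeBits hc0 hc1,
      ← sameBits_iff (u := u) hc0 hc1]
    simp [codeBits]
  constructor
  · rintro ⟨q₀, -, h0, q, -, ⟨h1, h2, h3⟩, h4⟩
    obtain rfl := (hatom q₀).mp h0
    exact ⟨q, h1, by omega, (key q h1).mp h4⟩
  · rintro ⟨q, h1, h2, h3⟩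
    have := hprop q h1
    exact ⟨S.length, by omega, (hatom _).mpr rfl, q, by omega, ⟨h1, by omega, by omega⟩,
      (key q h1).mpr h3⟩

end PathCheck

/-! ### The data read from a word describe the circuit of the argument -/

namespace PathCheck

open Logspace

variable {P : Type*} {name : P → List Bool} {n : ℕ} {x : List Sym} {ρ : Fin n → Set P}

theorem neighbor_isNone {past : Bool} {i : Fin n} :
    (neighbor past i).isNone = true ↔
      if past then (i : ℕ) = 0 else ¬ 1 < n - (i : ℕ) := by
  cases past
  · by_cases h : (i : ℕ) + 1 < n
    · simp [neighbor, h]; omega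
    · simp [neighbor, h]; omega
  · by_cases h : 0 < (i : ℕ)
    · simp [neighbor, h]; omega
    · simp [neighbor, h]; omega

open Classical in
theorem CirInput.Presented.describes_atom (hname : Function.Injective name) {p : P}
    (hx : CirInput.Presented name ⟨n, ρ, .atom p⟩ x) :
    (wordData x).Describes (atomSpec fun i => decide (p ∈ ρ i)) := by
  have hs : ∀ {L : List Sym}, (∀ a ∈ L, ¬ a.IsPlain) → (Has L x ↔ Has L [.atom]) := hx.has_iff
  refine ⟨hx.stateCount_eq, ?_, ?_, ?_, ?_, fun i => ?_, fun i => ?_, fun i => ?_⟩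
  all_goals
    simp [wordData, rowCount, PastWord, UnaryWord, UniversalWord, hs, Sym.IsPlain, has_cons, has_nil, atomSpec,
      hx.atomTrue_iff hname]

theorem CirInput.Presented.describes_unary {op : UnOp}
    (hx : CirInput.Presented name ⟨n, ρ, .unary op⟩ x) :
    (wordData x).Describes (unarySpec n op) := by
  have hs : ∀ {L : List Sym}, (∀ a ∈ L, ¬ a.IsPlain) → (Has L x ↔ Has L op.code) := hx.has_iff
  have hn := hx.stateCount_eq
  -- The word contains the operator symbol, so the cut-off in `min 2 (x.length + 1)` has no effect.
  have hl : 2 ≤ x.length + 1 := by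
    obtain ⟨l, -, rfl⟩ := hx
    cases op <;> simp [CirArg.code, UnOp.code]
  refine ⟨hn, ?_, ?_, ?_, ?_, fun i => ?_, fun i => ?_, fun i => ?_⟩
  all_goals
    cases op <;>
    simp [wordData, rowCount, PastWord, UnaryWord, UniversalWord, hs, Sym.IsPlain, has_cons, has_nil, unarySpec,
      UnOp.code, UnOp.past, UnOp.weak, HasNeighbor, hn, -Option.isNone_iff_eq_none, neighbor_isNone]
  all_goals omega

/-- The word gives a binary operator with the value sequence of the left or of the right
argument. -/
structure IsBinaryWord (x : List Sym) (left : Bool) (s : Fin n → Bool) (op : BinOp) : Prop where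
  stateCount_eq : stateCount x = n
  rowCount_eq : rowCount x = op.rows n
  past_iff : PastWord x ↔ op.past = true
  universal_iff : UniversalWord x ↔ op.universal = true
  connective_iff : Has [.or, .and] x ↔ op.connective = true
  left_iff : Has [.left] x ↔ left = true
  right_iff : Has [.right] x ↔ left = false
  binary : Has [.left, .right] x
  not_unary : ¬ UnaryWord x
  not_weak : ¬ Has [.weakNext, .weakYesterday] x
  not_atom : ¬ Has [.atom] x
  bitAt_iff : ∀ i : Fin n, BitAt x i ↔ s i = true

theorem CirInput.Presented.isBinaryWord_left {op : BinOp} {s : Fin n → Bool}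
    (hx : CirInput.Presented name ⟨n, ρ, .left s op⟩ x) : IsBinaryWord x true s op := by
  have hs : ∀ {L : List Sym}, (∀ a ∈ L, ¬ a.IsPlain) → (Has L x ↔ Has L [.left, op.symbol]) :=
    hx.has_iff
  have hn := hx.stateCount_eq
  have hb := hx.boundLength_eq
  refine ⟨hn, ?_, ?_, ?_, ?_, ?_, ?_, ?_, ?_, ?_, ?_, hx.bitAt_left⟩
  all_goals
    cases op <;>
    simp [rowCount, PastWord, UnaryWord, UniversalWord, hs, Sym.IsPlain, has_cons, has_nil, BinOp.symbol,
      BinOp.past, BinOp.universal, BinOp.connective, BinOp.rows, hn, hb, CirArg.boundCode,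
      BinOp.boundCode, codeNat]

theorem CirInput.Presented.isBinaryWord_right {op : BinOp} {s : Fin n → Bool}
    (hx : CirInput.Presented name ⟨n, ρ, .right op s⟩ x) : IsBinaryWord x false s op := by
  have hs : ∀ {L : List Sym}, (∀ a ∈ L, ¬ a.IsPlain) → (Has L x ↔ Has L [.right, op.symbol]) :=
    hx.has_iff
  have hn := hx.stateCount_eq
  have hb := hx.boundLength_eq
  refine ⟨hn, ?_, ?_, ?_, ?_, ?_, ?_, ?_, ?_, ?_, ?_, hx.bitAt_right⟩
  all_goals
    cases op <;>
    simp [rowCount, PastWord, UnaryWord, UniversalWord, hs, Sym.IsPlain, has_cons, has_nil, BinOp.symbol,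
      BinOp.past, BinOp.universal, BinOp.connective, BinOp.rows, hn, hb, CirArg.boundCode,
      BinOp.boundCode, codeNat]

namespace IsBinaryWord

variable {left : Bool} {s : Fin n → Bool} {op : BinOp}

theorem neutral_iff (h : IsBinaryWord x left s op) (i : Fin n) : Neutral x i ↔ s i = op.universal := by
  rw [Neutral, h.bitAt_iff, h.universal_iff, ← Bool.eq_iff_iff]

theorem neutralNeighbor_iff (h : IsBinaryWord x left s op) (i : Fin n) :
    NeutralNeighbor x i ↔ ∃ j, neighbor op.past i = some j ∧ s j = op.universal := by
  simp only [NeutralNeighbor, h.past_iff, h.stateCount_eq, neighbor_eq_some, ← h.neutral_iff]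
  have := i.2
  cases hp : op.past
  · simp only [Bool.false_eq_true, if_false, false_and, not_false_eq_true, true_and, false_or]
    constructor
    · rintro ⟨j, hj, hj', hi⟩
      exact ⟨⟨j, hj⟩, by simp only; omega, hi⟩
    · rintro ⟨j, hj, hi⟩
      exact ⟨j, j.2, by omega, hi⟩
  · simp only [if_true, true_and, not_true_eq_false, false_and, or_false]
    constructor
    · rintro ⟨h0, hi⟩
      exact ⟨⟨i - 1, by omega⟩, by simp only; omega, hi⟩
    · rintro ⟨j, hj, hi⟩
      refine ⟨by omega, ?_⟩
      rwa [← hj, Nat.add_sub_cancel]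

theorem decided_iff (h : IsBinaryWord x left s op) (i : Fin n) : Decided x i ↔
    ∃ e < op.rows n, ∃ j, Reach op.past e i j ∧ s j ≠ op.universal := by
  simp only [Decided, Reach, h.past_iff, h.stateCount_eq, h.rowCount_eq, ne_eq, ← h.neutral_iff]
  have := i.2
  cases hp : op.past
  · simp only [Bool.false_eq_true, if_false, false_and, not_false_eq_true, true_and, false_or]
    constructor
    · rintro ⟨j, hj, ⟨h1, h2⟩, hi⟩
      exact ⟨j - i, h2, ⟨j, hj⟩, by simp only; omega, hi⟩
    · rintro ⟨e, he, j, hj, hi⟩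
      exact ⟨j, j.2, ⟨by omega, by omega⟩, hi⟩
  · simp only [if_true, true_and, not_true_eq_false, false_and, or_false]
    constructor
    · rintro ⟨j, hj, ⟨h1, h2⟩, hi⟩
      exact ⟨i - j, h2, ⟨j, hj⟩, by simp only; omega, hi⟩
    · rintro ⟨e, he, j, hj, hi⟩
      exact ⟨j, j.2, ⟨by omega, by omega⟩, hi⟩

theorem describes (h : IsBinaryWord x left s op) : (wordData x).Describes (binarySpec left s op) where
  n_eq := h.stateCount_eq
  rows_eq := h.rowCount_eq
  past_iff := h.past_iff
  diag_iff := by simpa [binarySpec, wordData] using h.not_unary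
  conj_iff := by
    simp only [binarySpec, wordData, h.binary, h.universal_iff, h.left_iff]
    cases op.universal <;> cases left <;> simp
  mask_iff i := by
    simp only [binarySpec, wordData, h.left_iff, h.right_iff, h.neutral_iff, h.neutralNeighbor_iff]
    cases left
    · cases neighbor op.past i <;> simp
    · simp
  useConst_iff i := by
    simp only [binarySpec, wordData, h.not_atom, h.not_unary, h.right_iff, h.connective_iff,
      h.neutral_iff, h.decided_iff]
    cases hc : op.connective <;> simp [imp_iff_not_or]
  value_iff i := by
    simp [binarySpec, wordData, h.not_atom, h.not_weak, h.binary, h.bitAt_iff]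

end IsBinaryWord

open Classical in
/-- The grid circuit for a path and an argument. -/
noncomputable def CirInput.spec (z : CirInput P) : GridSpec z.n :=
  match z.arg with
  | .atom p => atomSpec fun i => decide (p ∈ z.path i)
  | .unary op => unarySpec z.n op
  | .left s op => binarySpec true s op
  | .right op s => binarySpec false s op

theorem CirInput.Presented.describes (hname : Function.Injective name) {z : CirInput P}
    (hx : z.Presented name x) : (wordData x).Describes z.spec := by
  obtain ⟨n, ρ, a⟩ := z
  cases a with
  | atom p => exact hx.describes_atom hname
  | unary op => exact hx.describes_unary
  | left s op => exact hx.isBinaryWord_left.describes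
  | right op s => exact hx.isBinaryWord_right.describes

end PathCheck

/-! ### The circuit function -/

theorem mainTheorem5 {P : Type*} (name : P → List Bool) (hname : Function.Injective name) :
    ∃ cir : CirInput P → NumberedTransducer,
      LogspaceComputable (CirInput.Presented name) NumberedTransducer.code cir ∧
      ∀ (n : ℕ) (ρ : Fin n → Set P),
        (∀ a : CirArg P n,
          (cir ⟨n, ρ, a⟩).circuit.IsEvaluated ∧
          (cir ⟨n, ρ, a⟩).circuit.IsOneInputFacePlanar) ∧
        (∀ p : P,
          (cir ⟨n, ρ, .atom p⟩).circuit.Maps (Fin.elim0 : Fin 0 → Bool)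
            (truthSeq ρ (.atom p))) ∧
        (∀ (op : UnOp) (φ : Formula P),
          (cir ⟨n, ρ, .unary op⟩).circuit.Maps (truthSeq ρ φ)
            (truthSeq ρ (.unary op φ))) ∧
        (∀ (op : BinOp) (φ ψ : Formula P),
          (cir ⟨n, ρ, .left (truthSeq ρ φ) op⟩).circuit.Maps (truthSeq ρ ψ)
            (truthSeq ρ (.binary op φ ψ)) ∧
          (cir ⟨n, ρ, .right op (truthSeq ρ ψ)⟩).circuit.Maps (truthSeq ρ φ)
            (truthSeq ρ (.binary op φ ψ))) := by
  refine ⟨fun z => ⟨_, z.spec.transducer⟩, ?_, fun n ρ =>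
    ⟨fun a => ⟨GridSpec.isEvaluated _, GridSpec.isOneInputFacePlanar _⟩, fun p => ?_,
      fun op φ => ?_, fun op φ ψ => ⟨?_, ?_⟩⟩⟩
  -- The machine sees only the word. All presentations of `z` describe the same grid circuit, so
  -- they lead to the same output.
  · obtain ⟨M, K, h⟩ := (Logspace.computesData_wordData.word).machine
    refine ⟨M, K, fun z x hx => ?_⟩
    rw [← (hx.describes hname).word_eq]
    exact h x
  · exact atomSpec_maps _ _
  · exact unarySpec_maps op _ _ fun i => by
      simp only [truthSeq, decide_eq_true_iff]
      rfl
  · exact binarySpec_left_maps op _ _ _ fun i => by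
      simp only [truthSeq, decide_eq_true_iff]
      rfl
  · exact binarySpec_right_maps op _ _ _ fun i => by
      simp only [truthSeq, decide_eq_true_iff]
      rfl
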